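/- **Setting.** Let $\Phi\subset\mathfrak h^*$ be a reduced, crystallographic, irreducible root system spanning $\mathfrak h^*$, where $\mathfrak h$ is the complexified reflection representation of its Weyl group $W$; fix positive roots $\Phi_+$. Let $\theta_{\max}$ be the highest root, $h^\vee=1+\sum_i g_i$ with $\theta_{\max}^\vee=\sum_i g_i\alpha_i^\vee$ (simple coroots $\alpha_i^\vee$) the dual Coxeter number, and $(\cdot|\cdot)$ the nondegenerate $W$-invariant symmetric bilinear form on $\mathfrak h$ with $(\theta_{\max}^\vee|\theta_{\max}^\vee)=2$. Let $\pi:\mathfrak h\to\mathfrak h^*$ be the induced isomorphism; we use it to transport $(\cdot|\cdot)$ to $\mathfrak h^*$. Let $P^\vee=\{\mu\in\mathfrak h:\alpha(\mu)\in\mathbb Z\ \forall\alpha\in\Phi\}$. Fix $\tau$ with $\operatorname{Im}\tau>0$, put $\Lambda_\tau=\mathbb Z+\mathbb Z\tau$, $T=\mathfrak h/(P^\vee+\tau P^\vee)$, and let $T_{reg}\subset T$ be the image of $\mathfrak h_{reg}=\{z\in\mathfrak h:\alpha(z)\notin\Lambda_\tau\ \forall\alpha\in\Phi\}$. With $q=e^{2\pi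 i\tau}$, $u=e^{2\pi iz}$ let $$\theta(z|\tau)=\frac{e^{\pi i z}}{2\pi i}\prod_{s>0}(1-q^su)\prod_{s\ge0}(1-q^su^{-1})\prod_{s>0}(1-q^s)^{-2},\qquad k(z,x|\tau)=\frac{\theta(z+x|\tau)}{\theta(z|\tau)\theta(x|\tau)}-\frac1x ,$$ $k$ being expanded as a power series in $x$ at $x=0$ for $z\notin\Lambda_\tau$; $\theta'=\partial\theta/\partial z$. *The Lie algebra $A_{ell}$* is generated by elements $t_\alpha=t_{-\alpha}$ ($\alpha\in\Phi$) and two linear maps $x,y:\mathfrak h\to A_{ell}$ with relations: $[t_\alpha,\sum_{\beta\in\Psi\cap\Phi_+}t_\beta]=0$ for $\Psi\subset\Phi$ with $\langle\Psi\rangle_{\mathbb Z}\cap\Phi=\Psi$ and $\alpha\in\Psi$; $[x(u),x(v)]=[y(u),y(v)]=0$; $[y(u),x(v)]=\sum_{\gamma\in\Phi_+}\gamma(u)\gamma(v)t_\gamma$; $[t_\alpha,x(u)]=[t_\alpha,y(u)]=0$ if $\alpha(u)=0$. It is graded by $\deg x(u)=\deg y(u)=1$, $\deg t_\alpha=2$.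 The universal KZB connection, with values in its degree completion, is $$\nabla_{KZB,\tau}=d-\sum_{\alpha\in\Phi_+}k\big(\alpha,\operatorname{ad}\tfrac{x(\alpha^\vee)}2\big|\tau\big)(t_\alpha)\,d\alpha+\sum_i y(u^i)\,du_i ,$$ $\{u^i\},\{u_i\}$ dual bases of $\mathfrak h,\mathfrak h^*$. *The rational Cherednik algebra $H_{\hbar,c}$.* Let $S\subset W$ be the set of reflections. $H_{\hbar,c}$ is generated by $\mathbb CW$, $\mathfrak h$, $\mathfrak h^*$ and central elements $\hbar$, $c_s$ ($s\in S/W$), with $wxw^{-1}=w(x)$, $wyw^{-1}=w(y)$, $[x,x']=[y,y']=0$ and $$[y,x]=\hbar\langle y,x\rangle-\sum_{s\in S}c_s\langle\alpha_s,y\rangle\langle\alpha_s^\vee,x\rangle s\qquad(x,x'\in\mathfrak h^*,\ y,y'\in\mathfrak h),$$ where $\alpha_s\in\Phi$ is a root with reflection $s$. It is graded by $\deg w=0$, $\deg x=\deg y=1$, $\deg\hbar=\deg c_s=2$; let $\widehat H_{\hbar,c}$ be its degree completion. Write $c_\alpha=c_{s_\alpha}$. **Theorem.** There is a graded Lie algebra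 homomorphism $\xi:A_{ell}\to H_{\hbar,c}$ with $$x(v)\mapsto\pi(v),\qquad y(u)\mapsto u,\qquad t_\gamma\mapsto\frac{\hbar}{h^\vee}-\frac{2c_\gamma}{(\gamma|\gamma)}s_\gamma ,$$ and the map it induces on degree completions carries $\nabla_{KZB,\tau}$ (over $\mathfrak h_{reg}$) to $$\nabla_{H_{\hbar,c},\tau}=d+\sum_{\alpha\in\Phi_+}\frac{2c_\alpha}{(\alpha|\alpha)}\,k\big(\alpha,\operatorname{ad}\tfrac{\alpha^\vee}2\big|\tau\big)(s_\alpha)\,d\alpha-\sum_{\alpha\in\Phi_+}\frac{\hbar}{h^\vee}\frac{\theta'(\alpha|\tau)}{\theta(\alpha|\tau)}\,d\alpha+\sum_iu^i\,du_i ,$$ where in $\operatorname{ad}\frac{\alpha^\vee}2$ the coroot is regarded as the element $\pi(\alpha^\vee)\in\mathfrak h^*\subset H_{\hbar,c}$. The connection $\nabla_{H_{\hbar,c},\tau}=d+\omega$ has the following properties. 1. It descends to $T_{reg}$, on the bundle whose sections are the $f$ on (preimages in $\mathfrak h_{reg}$ of) open subsets of $T_{reg}$ with $f(z+\mu)=f(z)$,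 $f(z+\tau\mu)=e^{-2\pi i\pi(\mu)}f(z)$ for $\mu\in P^\vee$: that is, $\omega(z+\mu)=\omega(z)$ and $\omega(z+\tau\mu)=e^{-2\pi i\operatorname{ad}\pi(\mu)}\omega(z)$. 2. It is flat: $\omega$ is holomorphic on $\mathfrak h_{reg}$ and $d\omega+\omega\wedge\omega=0$. 3. It is $W$-equivariant: $\omega_{wz}(wu)=w\,\omega_z(u)\,w^{-1}$ for $w\in W$, $z\in\mathfrak h_{reg}$, $u\in\mathfrak h$. -/

import Mathlib

open scoped UpperHalfPlane

attribute [local instance 100] LieRing.ofAssociativeRing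

noncomputable section

namespace KZB

/-! ### Root-theoretic data

A reduced crystallographic root system over `ℂ` is a `RootPairing ι ℂ V H`: `H` is the
complexified reflection representation `𝔥`, `V` is its dual `𝔥*`, the roots lie in `V` and the
coroots in `H`. The Weyl group is `P.weylGroup`, which acts on `V` by `•`. -/

section Roots

variable {ι V H : Type*} [AddCommGroup V] [Module ℂ V] [AddCommGroup H] [Module ℂ H]

/-- The action of the Weyl group on `𝔥`, contragredient to its action on `𝔥*`. -/
def wAct (P : RootPairing ι ℂ V H) (g : P.weylGroup) : H →ₗ[ℂ] H :=
  ((g⁻¹ : P.weylGroup) : P.Aut).toHom.coweightMap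

/-- `θ` is (the index of) the highest root: for every root `α`, the difference `θ - α` is a
combination of simple roots with coefficients in `ℕ`. -/
def IsHighestRoot {P : RootPairing ι ℂ V H} (b : P.Base) (θ : ι) : Prop :=
  ∀ i, P.root θ - P.root i ∈ AddSubmonoid.closure (P.root '' b.support)

/-- The dual Coxeter number `1 + ∑ gᵢ`, where `θ^∨ = ∑ gᵢ αᵢ^∨` for the highest root `θ` and the
simple coroots `αᵢ^∨` (`b.flip.height θ` is the sum of the coefficients of the coroot of `θ`). -/
def dualCoxeter {P : RootPairing ι ℂ V H} (b : P.Base) (θ : ι) : ℤ :=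
  1 + b.flip.height θ

theorem finite_coweight (P : RootPairing ι ℂ V H) [Finite ι] [P.IsRootSystem] :
    Module.Finite ℂ H :=
  ⟨⟨(Set.finite_range P.coroot).toFinset, by
    simp⟩⟩

/-- The nondegenerate Weyl-group-invariant symmetric bilinear form `(·|·)` on `𝔥`, normalised by
`(θ^∨|θ^∨) = 2` for the highest root `θ`. -/
structure NormalizedForm (P : RootPairing ι ℂ V H) (θ : ι) where
  form : LinearMap.BilinForm ℂ H
  symm : ∀ u v, form u v = form v u
  nondegenerate : form.Nondegenerate
  invariant : ∀ (g : P.weylGroup) (u v : H), form (wAct P g u) (wAct P g v) = form u v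
  normalized : form (P.coroot θ) (P.coroot θ) = 2

namespace NormalizedForm

variable {P : RootPairing ι ℂ V H} {θ : ι} [Finite ι] [P.IsRootSystem]

/-- The isomorphism `π : 𝔥 → 𝔥*` induced by `(·|·)`, i.e. `⟨π(v), u⟩ = (v|u)`. -/
def iso (B : NormalizedForm P θ) : H ≃ₗ[ℂ] V :=
  haveI := finite_coweight P
  (B.form.toDual B.nondegenerate).trans P.toLinearMap.toPerfPair.symm

theorem iso_apply (B : NormalizedForm P θ) (v u : H) : P.toLinearMap (B.iso v) u = B.form v u := by
  have := finite_coweight P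
  have h : P.toLinearMap.toPerfPair (B.iso v) = B.form.toDual B.nondegenerate v := by
    simp [iso]
  exact congrArg (fun f : Module.Dual ℂ H => f u) h

/-- The squared length `(x|x)` of `x ∈ 𝔥*` for the form on `𝔥*` that corresponds to `(·|·)`
under `π`. -/
def normSq (B : NormalizedForm P θ) (x : V) : ℂ :=
  B.form (B.iso.symm x) (B.iso.symm x)

end NormalizedForm

/-- The lattice `Λ_τ = ℤ + ℤτ`. -/
def lattice (τ : ℍ) : Set ℂ := {w | ∃ m n : ℤ, w = m + n * (τ : ℂ)}

/-- The preimage in `𝔥` of the elliptic configuration space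
`T_reg = T \ ⋃ T_α`, `T = 𝔥/(P^∨ + τP^∨)`. -/
def regular (P : RootPairing ι ℂ V H) (τ : ℍ) : Set H :=
  {z | ∀ i, P.root' i z ∉ lattice τ}

/-- The coweight lattice `P^∨`, dual to the root lattice. -/
def IsCoweight (P : RootPairing ι ℂ V H) (μ : H) : Prop :=
  ∀ i, ∃ m : ℤ, P.root' i μ = m

end Roots

/-! ### Theta functions -/

/-- The theta function normalised by `∂θ/∂z(0|τ) = 1`:
`u^{1/2} ∏_{s>0} (1 - q^s u) ∏_{s≥0} (1 - q^s u⁻¹) (2πi)⁻¹ ∏_{s>0} (1 - q^s)⁻²`, where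
`u = e^{2πiz}` and `q = e^{2πiτ}`. -/
def theta (τ : ℍ) (z : ℂ) : ℂ :=
  let q : ℂ := Complex.exp (2 * Real.pi * Complex.I * (τ : ℂ))
  let u : ℂ := Complex.exp (2 * Real.pi * Complex.I * z)
  Complex.exp (Real.pi * Complex.I * z) * (∏' s : ℕ, (1 - q ^ (s + 1) * u)) *
    (∏' s : ℕ, (1 - q ^ s * u⁻¹)) * (1 / (2 * Real.pi * Complex.I)) *
    ((∏' s : ℕ, (1 - q ^ (s + 1))) ^ 2)⁻¹

/-- `k(z, x|τ) = θ(z+x)/(θ(z)θ(x)) - 1/x` as a function of `x`, with its removable singularity at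
`x = 0` filled in by the limit. -/
def kFun (τ : ℍ) (z : ℂ) : ℂ → ℂ :=
  let f : ℂ → ℂ := fun x => theta τ (z + x) / (theta τ z * theta τ x) - 1 / x
  Function.update f 0 (Filter.limUnder (nhdsWithin 0 {0}ᶜ) f)

/-- The `m`-th coefficient of the Taylor series of `k(z, x|τ)` in `x` at `0`. -/
def kCoeff (τ : ℍ) (z : ℂ) (m : ℕ) : ℂ :=
  iteratedDeriv m (kFun τ z) 0 / (m.factorial : ℂ)

/-! ### Degree completion of a graded algebra -/

section Completion

variable {A : Type*} [Ring A] [Algebra ℂ A]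

/-- The degree completion `∏ₙ Aₙ` of a graded algebra `A = ⨁ Aₙ`; a sequence `(aₙ)` is encoded as
the power series `∑ aₙ tⁿ`, which gives the right multiplication. -/
def Completion (𝒜 : ℕ → Submodule ℂ A) [SetLike.GradedMonoid 𝒜] :
    Subalgebra ℂ (PowerSeries A) where
  carrier := {f | ∀ n, PowerSeries.coeff n f ∈ 𝒜 n}
  mul_mem' := by
    intro f g hf hg n
    rw [PowerSeries.coeff_mul]
    refine Submodule.sum_mem _ fun p hp => ?_
    rw [← Finset.HasAntidiagonal.mem_antidiagonal.mp hp]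
    exact SetLike.GradedMul.mul_mem (hf _) (hg _)
  add_mem' := by
    intro f g hf hg n
    rw [map_add]
    exact Submodule.add_mem _ (hf n) (hg n)
  algebraMap_mem' := by
    intro r n
    rw [Algebra.algebraMap_eq_smul_one, PowerSeries.coeff_smul, PowerSeries.coeff_one]
    split_ifs with h
    · subst h
      exact Submodule.smul_mem _ _ SetLike.GradedOne.one_mem
    · rw [smul_zero]
      exact Submodule.zero_mem _

variable (𝒜 : ℕ → Submodule ℂ A) [SetLike.GradedMonoid 𝒜]

/-- A homogeneous element of degree `n`, as an element of the completion. -/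
def homog (n : ℕ) (a : A) (ha : a ∈ 𝒜 n) : Completion 𝒜 :=
  ⟨PowerSeries.monomial n a, by
    intro m
    rw [PowerSeries.coeff_monomial]
    split_ifs with h
    · rw [h]; exact ha
    · exact Submodule.zero_mem _⟩

variable {𝒜}

/-- The degree `n` component of an element of the completion. -/
def component (n : ℕ) (f : Completion 𝒜) : A := PowerSeries.coeff n (f : PowerSeries A)

/-- The value `∑ₘ κₘ (ad X)^m (T)` of the power series `∑ₘ κₘ x^m` at `x = ad X`, applied to `T`.
It is used for `X` without component in degree `0`; then `(ad X)^m (T)` has no component in degrees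
less than `m`, and the component of the sum in degree `n` is the finite sum over `m ≤ n`. -/
def adSeries (κ : ℕ → ℂ) (X T : Completion 𝒜) : Completion 𝒜 :=
  ⟨PowerSeries.mk fun n =>
      ∑ m ∈ Finset.range (n + 1), κ m • component n ((fun Y => X * Y - Y * X)^[m] T), by
    intro n
    rw [PowerSeries.coeff_mk]
    exact Submodule.sum_mem _ fun m _ => Submodule.smul_mem _ _
      (Subtype.prop ((fun Y => X * Y - Y * X)^[m] T) n)⟩

variable {H : Type*} [AddCommGroup H] [Module ℂ H]

/-- `F'` is the derivative at `z` in direction `u` of the function `F` with values in the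
completion. Each homogeneous component `Aₙ` (in the application: a finite-dimensional space) is
tested against linear functionals. -/
def HasDirDeriv (F : H → Completion 𝒜) (F' : Completion 𝒜) (u z : H) : Prop :=
  ∀ (n : ℕ) (l : A →ₗ[ℂ] ℂ),
    HasDerivAt (fun s : ℂ => l (component n (F (z + s • u)))) (l (component n F')) 0

/-- Flatness of the holomorphic connection `∇ = d + ω` on `U`: the form `ω` is holomorphic and its
curvature `dω + ω ∧ ω` vanishes, that is `∂ᵤω(v) - ∂ᵥω(u) + [ω(u), ω(v)] = 0`. -/
def IsFlatOn (U : Set H) (ω : H → H →ₗ[ℂ] Completion 𝒜) : Prop :=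
  ∀ z ∈ U, ∀ u v : H, ∃ Duv Dvu : Completion 𝒜,
    HasDirDeriv (fun z' => ω z' v) Duv u z ∧ HasDirDeriv (fun z' => ω z' u) Dvu v z ∧
      Duv - Dvu + (ω z u * ω z v - ω z v * ω z u) = 0

end Completion

/-! ### The Lie algebra `A_ell` -/

section Aell

variable {ι V H : Type*} [AddCommGroup V] [Module ℂ V] [AddCommGroup H] [Module ℂ H]

/-- The generators of `A_ell`. -/
inductive AellGen (ι H : Type*)
  | t (i : ι)
  | x (u : H)
  | y (u : H)

/-- The free Lie algebra on the generators. -/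
abbrev AellFree (ι H : Type*) := FreeLieAlgebra ℂ (AellGen ι H)

/-- A generator in the free Lie algebra. -/
abbrev fr {ι H : Type*} (a : AellGen ι H) : AellFree ι H := FreeLieAlgebra.of ℂ a

/-- `Ψ ⊆ Φ` is a root subsystem: `⟨Ψ⟩_ℤ ∩ Φ = Ψ`. -/
def IsRootSubsystem (P : RootPairing ι ℂ V H) (Ψ : Set ι) : Prop :=
  ∀ i, P.root i ∈ AddSubgroup.closure (P.root '' Ψ) ↔ i ∈ Ψ

open Classical in
/-- The defining relators of `A_ell`. -/
inductive AellRelator [Fintype ι] (P : RootPairing ι ℂ V H) (b : P.Base) : AellFree ι H → Prop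
  | t_neg (i j : ι) (h : P.root j = -P.root i) : AellRelator P b (fr (.t j) - fr (.t i))
  | x_add (u v : H) : AellRelator P b (fr (.x (u + v)) - (fr (.x u) + fr (.x v)))
  | x_smul (r : ℂ) (u : H) : AellRelator P b (fr (.x (r • u)) - r • fr (.x u))
  | y_add (u v : H) : AellRelator P b (fr (.y (u + v)) - (fr (.y u) + fr (.y v)))
  | y_smul (r : ℂ) (u : H) : AellRelator P b (fr (.y (r • u)) - r • fr (.y u))
  | tt (Ψ : Set ι) (hΨ : IsRootSubsystem P Ψ) (i : ι) (hi : i ∈ Ψ) :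
      AellRelator P b ⁅(fr (.t i) : AellFree ι H), ∑ j with j ∈ Ψ ∧ b.IsPos j, fr (.t j)⁆
  | xx (u v : H) : AellRelator P b ⁅(fr (.x u) : AellFree ι H), (fr (.x v) : AellFree ι H)⁆
  | yy (u v : H) : AellRelator P b ⁅(fr (.y u) : AellFree ι H), (fr (.y v) : AellFree ι H)⁆
  | yx (u v : H) : AellRelator P b (⁅(fr (.y u) : AellFree ι H), (fr (.x v) : AellFree ι H)⁆ -
      ∑ j with b.IsPos j, (P.root' j v * P.root' j u) • fr (.t j))
  | tx (i : ι) (u : H) (h : P.root' i u = 0) : AellRelator P b ⁅(fr (.t i) : AellFree ι H), (fr (.x u) : AellFree ι H)⁆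
  | ty (i : ι) (u : H) (h : P.root' i u = 0) : AellRelator P b ⁅(fr (.t i) : AellFree ι H), (fr (.y u) : AellFree ι H)⁆

/-- The ideal generated by the relators. -/
def aellIdeal [Fintype ι] (P : RootPairing ι ℂ V H) (b : P.Base) : LieIdeal ℂ (AellFree ι H) :=
  LieSubmodule.lieSpan ℂ (AellFree ι H) {a | AellRelator P b a}

/-- The Lie algebra `A_ell`. -/
abbrev Aell [Fintype ι] (P : RootPairing ι ℂ V H) (b : P.Base) := AellFree ι H ⧸ aellIdeal P b

variable [Fintype ι] (P : RootPairing ι ℂ V H) (b : P.Base)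

/-- The generators `t_α` of `A_ell`. -/
def Aell.t (i : ι) : Aell P b := LieSubmodule.Quotient.mk (fr (.t i))

/-- The generators `x(u)` of `A_ell`. -/
def Aell.x (u : H) : Aell P b := LieSubmodule.Quotient.mk (fr (.x u))

/-- The generators `y(u)` of `A_ell`. -/
def Aell.y (u : H) : Aell P b := LieSubmodule.Quotient.mk (fr (.y u))

/-- Lie monomials of degree `n`, where `deg x(u) = deg y(u) = 1` and `deg t_α = 2`. -/
inductive AellMonomial : ℕ → Aell P b → Prop
  | t (i : ι) : AellMonomial 2 (Aell.t P b i)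
  | x (u : H) : AellMonomial 1 (Aell.x P b u)
  | y (u : H) : AellMonomial 1 (Aell.y P b u)
  | bracket {m n : ℕ} {a a' : Aell P b} (h : AellMonomial m a) (h' : AellMonomial n a') :
      AellMonomial (m + n) ⁅a, a'⁆

/-- The homogeneous component of degree `n` of `A_ell`. -/
def aellDeg (n : ℕ) : Submodule ℂ (Aell P b) := Submodule.span ℂ {a | AellMonomial P b n a}

/-- The degree completion `∏ₙ (A_ell)ₙ` of `A_ell`. -/
abbrev AellHat : Submodule ℂ (ℕ → Aell P b) := Submodule.pi Set.univ (aellDeg P b)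

theorem monomial_ad (i : ι) (u : H) (m : ℕ) :
    AellMonomial P b (m + 2) ((fun Y => ⁅Aell.x P b u, Y⁆)^[m] (Aell.t P b i)) := by
  induction m with
  | zero => exact .t i
  | succ m ih =>
    rw [Function.iterate_succ_apply', show m + 1 + 2 = 1 + (m + 2) by omega]
    exact .bracket (.x u) ih

/-- `k(z, ad (x_{α^∨}/2)|τ)(t_α)` in the completion of `A_ell`; the summand
`kₘ(z) (ad (x_{α^∨}/2))^m (t_α)` has degree `m + 2`. -/
def aellK (τ : ℍ) (i : ι) (z : ℂ) : AellHat P b :=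
  ⟨fun n => if 2 ≤ n then
      kCoeff τ z (n - 2) •
        (fun Y => ⁅Aell.x P b ((1 / 2 : ℂ) • P.coroot i), Y⁆)^[n - 2] (Aell.t P b i)
    else 0, by
    intro n _
    dsimp only
    split_ifs with h
    · refine Submodule.smul_mem _ _ (Submodule.subset_span ?_)
      have := monomial_ad P b i ((1 / 2 : ℂ) • P.coroot i) (n - 2)
      rwa [Nat.sub_add_cancel h] at this
    · exact Submodule.zero_mem _⟩

/-- `y(u)` in the completion of `A_ell`. -/
def aellY (u : H) : AellHat P b :=
  ⟨fun n => if n = 1 then Aell.y P b u else 0, by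
    intro n _
    dsimp only
    split_ifs with h
    · subst h
      exact Submodule.subset_span (.y u)
    · exact Submodule.zero_mem _⟩

open Classical in
/-- The form `ω = -∑_{α>0} k(α, ad (x_{α^∨}/2)|τ)(t_α) dα + ∑ y(uⁱ) duᵢ` of the universal KZB
connection `∇_{KZB,τ} = d + ω`, where `uⁱ = e i` is a basis of `𝔥` with dual basis `uᵢ`. -/
def kzbForm {κ : Type*} [Fintype κ] (e : Module.Basis κ ℂ H) (τ : ℍ) (z : H) :
    H →ₗ[ℂ] AellHat P b :=
  -(∑ i with b.IsPos i, (P.root' i).smulRight (aellK P b τ i (P.root' i z))) +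
    ∑ j, (e.coord j).smulRight (aellY P b (e j))

end Aell

/-! ### The rational Cherednik algebra -/

section RCA

variable {ι V H : Type*} [AddCommGroup V] [Module ℂ V] [AddCommGroup H] [Module ℂ H]

/-- The set `S` of reflections in the Weyl group. -/
abbrev reflections (P : RootPairing ι ℂ V H) : Set P.weylGroup :=
  Set.range (RootPairing.weylGroup.ofIdx P)

/-- The set `S/W` of conjugacy classes of reflections. -/
abbrev ReflClass (P : RootPairing ι ℂ V H) :=
  {C : ConjClasses P.weylGroup // ∃ s ∈ reflections P, C = ConjClasses.mk s}

/-- The conjugacy class of a reflection. -/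
def reflClass {P : RootPairing ι ℂ V H} (s : reflections P) : ReflClass P :=
  ⟨ConjClasses.mk s.1, s.1, s.2, rfl⟩

/-- The reflection `s_α` of a root `α`. -/
def reflOf (P : RootPairing ι ℂ V H) (i : ι) : reflections P :=
  ⟨RootPairing.weylGroup.ofIdx P i, i, rfl⟩

/-- A root `α_s` whose reflection is `s`. -/
def rootIdx {P : RootPairing ι ℂ V H} (s : reflections P) : ι := s.2.choose

/-- The generators of the rational Cherednik algebra: the Weyl group, `𝔥*`, `𝔥`, and the coordinate
functions `ħ` and `c_s`, `s ∈ S/W`, on the parameter space. -/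
inductive RCAGen (P : RootPairing ι ℂ V H)
  | w (g : P.weylGroup)
  | x (v : V)
  | y (u : H)
  | hbar
  | c (C : ReflClass P)

/-- The free algebra on the generators. -/
abbrev RCAFree (P : RootPairing ι ℂ V H) := FreeAlgebra ℂ (RCAGen P)

/-- A generator in the free algebra. -/
abbrev fa {P : RootPairing ι ℂ V H} (a : RCAGen P) : RCAFree P := FreeAlgebra.ι ℂ a

/-- The relations of the rational Cherednik algebra. The relations from `w_one` to `c_comm` present
the algebra `(ℂW ⋉ T(𝔥 ⊕ 𝔥*))[K ⊕ ℂ]`. -/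
inductive RCARel (P : RootPairing ι ℂ V H) : RCAFree P → RCAFree P → Prop
  | w_one : RCARel P (fa (.w 1)) 1
  | w_mul (g h : P.weylGroup) : RCARel P (fa (.w (g * h))) (fa (.w g) * fa (.w h))
  | x_add (v v' : V) : RCARel P (fa (.x (v + v'))) (fa (.x v) + fa (.x v'))
  | x_smul (r : ℂ) (v : V) : RCARel P (fa (.x (r • v))) (r • fa (.x v))
  | y_add (u u' : H) : RCARel P (fa (.y (u + u'))) (fa (.y u) + fa (.y u'))
  | y_smul (r : ℂ) (u : H) : RCARel P (fa (.y (r • u))) (r • fa (.y u))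
  | w_x (g : P.weylGroup) (v : V) :
      RCARel P (fa (.w g) * fa (.x v)) (fa (.x (g • v)) * fa (.w g))
  | w_y (g : P.weylGroup) (u : H) :
      RCARel P (fa (.w g) * fa (.y u)) (fa (.y (wAct P g u)) * fa (.w g))
  | hbar_comm (a : RCAGen P) : RCARel P (fa .hbar * fa a) (fa a * fa .hbar)
  | c_comm (C : ReflClass P) (a : RCAGen P) : RCARel P (fa (.c C) * fa a) (fa a * fa (.c C))
  | xx (v v' : V) : RCARel P (fa (.x v) * fa (.x v') - fa (.x v') * fa (.x v)) 0
  | yy (u u' : H) : RCARel P (fa (.y u) * fa (.y u') - fa (.y u') * fa (.y u)) 0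
  | yx (u : H) (v : V) : RCARel P (fa (.y u) * fa (.x v) - fa (.x v) * fa (.y u))
      (P.toLinearMap v u • fa .hbar -
        ∑ᶠ s : reflections P,
          (P.root' (rootIdx s) u * P.coroot' (rootIdx s) v) • (fa (.c (reflClass s)) * fa (.w s.1)))

/-- The rational Cherednik algebra `H_{ħ,c}` of the Weyl group. -/
def RCA (P : RootPairing ι ℂ V H) := RingQuot (RCARel P)

instance (P : RootPairing ι ℂ V H) : Ring (RCA P) := inferInstanceAs (Ring (RingQuot (RCARel P)))

instance (P : RootPairing ι ℂ V H) : Algebra ℂ (RCA P) :=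
  inferInstanceAs (Algebra ℂ (RingQuot (RCARel P)))

/-- A generator in the rational Cherednik algebra. -/
def RCA.of (P : RootPairing ι ℂ V H) (a : RCAGen P) : RCA P :=
  RingQuot.mkAlgHom ℂ (RCARel P) (fa a)

/-- The degrees of the generators: `deg w = 0`, `deg x = deg y = 1`, `deg ħ = deg c_s = 2`. -/
def RCAGen.deg {P : RootPairing ι ℂ V H} : RCAGen P → ℕ
  | .w _ => 0
  | .x _ => 1
  | .y _ => 1
  | .hbar => 2
  | .c _ => 2

variable (P : RootPairing ι ℂ V H)

/-- The homogeneous component of degree `n`, spanned by the monomials of degree `n` in the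
generators. -/
def rcaDeg (n : ℕ) : Submodule ℂ (RCA P) :=
  Submodule.span ℂ {a | ∃ l : List (RCAGen P), (l.map RCAGen.deg).sum = n ∧
    a = (l.map (RCA.of P)).prod}

instance : SetLike.GradedMonoid (rcaDeg P) where
  one_mem := Submodule.subset_span ⟨[], by simp, by simp⟩
  mul_mem := by
    intro m n a a' ha ha'
    have h := Submodule.mul_mem_mul ha ha'
    rw [rcaDeg, rcaDeg, Submodule.span_mul_span] at h
    refine Submodule.span_mono ?_ h
    rintro _ ⟨_, ⟨l, hl, rfl⟩, _, ⟨l', hl', rfl⟩, rfl⟩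
    exact ⟨l ++ l', by simp [hl, hl'], by simp⟩

/-- The degree completion of the rational Cherednik algebra. -/
abbrev RCAHat := Completion (rcaDeg P)

/-- A generator in the completed rational Cherednik algebra. -/
def RCAHat.of (a : RCAGen P) : RCAHat P :=
  homog (rcaDeg P) a.deg (RCA.of P a) (Submodule.subset_span ⟨[a], by simp, by simp⟩)

section Connection

variable {P} [Fintype ι] [P.IsRootSystem] {θ : ι} (b : P.Base) (B : NormalizedForm P θ)

open Classical in
/-- The form
`ω = ∑_{α>0} (2c_α/(α|α)) k(α, ad (α^∨/2)|τ) s_α dα - ∑_{α>0} (ħ/h^∨) (θ'(α|τ)/θ(α|τ)) dα + ∑ uⁱ duᵢ`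
of the elliptic KZ connection `∇ = d + ω` with values in the completed rational Cherednik algebra.
In `ad (α^∨/2)` the coroot is regarded as the element `π(α^∨) ∈ 𝔥*` of the algebra, and
`uⁱ = e i` is a basis of `𝔥` with dual basis `uᵢ`. -/
def rcaForm {κ : Type*} [Fintype κ] (e : Module.Basis κ ℂ H) (τ : ℍ) (z : H) :
    H →ₗ[ℂ] RCAHat P :=
  ∑ i with b.IsPos i, (P.root' i).smulRight
      ((2 / B.normSq (P.root i)) • (RCAHat.of P (.c (reflClass (reflOf P i))) *
        adSeries (kCoeff τ (P.root' i z))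
          ((1 / 2 : ℂ) • RCAHat.of P (.x (B.iso (P.coroot i))))
          (RCAHat.of P (.w (reflOf P i).1)))) -
    ∑ i with b.IsPos i, (P.root' i).smulRight
      ((1 / (dualCoxeter b θ : ℂ) *
        (deriv (theta τ) (P.root' i z) / theta τ (P.root' i z))) • RCAHat.of P .hbar) +
    ∑ j, (e.coord j).smulRight (RCAHat.of P (.y (e j)))

/-- The map between the degree completions induced by a graded linear map from `A_ell` to the
rational Cherednik algebra. -/
def completeMap (ξ : Aell P b →ₗ⁅ℂ⁆ RCA P)
    (hξ : ∀ n, ∀ a ∈ aellDeg P b n, ξ a ∈ rcaDeg P n) (f : AellHat P b) : RCAHat P :=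
  ⟨PowerSeries.mk fun n => ξ (f.1 n), by
    intro n
    rw [PowerSeries.coeff_mk]
    exact hξ n _ (f.2 n (Set.mem_univ n))⟩

/-- `d + ω` descends to a connection over `T_reg` on the bundle whose sections are the functions
`f` on the preimage of `T_reg` in `𝔥` with
`f(z + μ) = f(z)` and `f(z + τμ) = e^{-2πi x(μ)} f(z)` for `μ ∈ P^∨`; here `x(μ) = π(μ)`. -/
def DescendsToTorus (τ : ℍ) (ω : H → H →ₗ[ℂ] RCAHat P) : Prop :=
  ∀ z ∈ regular P τ, ∀ μ : H, IsCoweight P μ → ∀ u : H,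
    ω (z + μ) u = ω z u ∧
    ω (z + (τ : ℂ) • μ) u =
      adSeries (fun m => (-2 * Real.pi * Complex.I) ^ m / (m.factorial : ℂ))
        (RCAHat.of P (.x (B.iso μ))) (ω z u)

/-- `W`-equivariance of `d + ω`, where `W` acts on the rational Cherednik algebra by
conjugation. -/
def IsWEquivariantOn (U : Set H) (ω : H → H →ₗ[ℂ] RCAHat P) : Prop :=
  ∀ (g : P.weylGroup), ∀ z ∈ U, ∀ u : H,
    ω (wAct P g z) (wAct P g u) =
      RCAHat.of P (.w g) * ω z u * RCAHat.of P (.w g⁻¹)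

end Connection

end RCA

end KZB

end

/-! Write F(z, x) = θ(z+x)/(θ(z)θ(x)), so that k = F - 1/x, and let k_m(z) be the Taylor
coefficients of k in x. Since s_α sends π(α^∨) to its negative, (ad π(α^∨)/2)^m (s_α) = π(α^∨)^m
s_α. Hence ω(u) has degree 1 component u and degree n+2 component (1/2) ∑_α α(u) k_n(α(z))
(2c_α/(α|α)) π(α^∨)^n s_α over all roots, plus a multiple of ħ for n = 0. The coefficients of ħ also
involve k_0, because θ'/θ = k_0 (`kCoeff_zero`). Everything is checked degree by degree on these
components.

The map ξ exists because of ∑_{γ>0} γ(u)γ(v) = h^∨ (u|v) (`sum_root'_mul_root'`): the left side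
defines a W-invariant operator, which is scalar by irreducibility, and the scalar is found by
pairing the highest coroot with the positive roots. The other relations express conjugation by
reflections. Equivariance is a relabelling of the sum over roots by w. Descent comes from F(z+nτ, x)
= e^{-2πinx} F(z, x): thus 1 + xk is multiplied by an exponential, while k acquires an extra term,
which the iterated brackets of π(μ) with y(u) supply; the ħ parts match by the same quadratic
identity.

For flatness, ω is a sum of closed forms f(α)dα and a constant form, so only [ω(u), ω(v)] = 0 is
needed. Its component in degree n+4 becomes a sum over pairs of roots (α, β) of (α∧β)(u, v) c_α c_β
times a polynomial in the commuting elements π(γ^∨), times s_β s_α. The permutation (α, β) ↦ (β, s_β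
α) fixes c_α c_β and s_β s_α and changes the sign of α∧β, so it suffices that the alternating sum of
the polynomials over each orbit vanishes (`RootChain.sum_kCoeff`). That is the Taylor expansion of ∑
(-1)^k F(a_{k+1}, x_{k+1}) F(a_k, x_{k+2}) = 0 (`RootChain.sum_ellTerm`), where a_k and x_k run
along the chains of roots and coroots. As a function of a_1 the sum has no poles, because residues
of neighbouring terms cancel, and it is quasi-periodic with a nontrivial multiplier, so it is zero
(`eq_zero_of_quasiPeriodic`). -/

namespace KZB

open Complex Filter Topology

/-! ### The infinite product -/

/-- The infinite product `∏_{s > 0} (1 - q^s w)`. -/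
noncomputable def qProd (q w : ℂ) : ℂ := ∏' s : ℕ, (1 - q ^ (s + 1) * w)

section qProd

variable {q : ℂ}

theorem summable_norm_qProd (hq : ‖q‖ < 1) (w : ℂ) : Summable fun s : ℕ => ‖-(q ^ (s + 1) * w)‖ := by
  simp only [norm_neg, norm_mul, norm_pow]
  exact ((summable_nat_add_iff 1).mpr
    (summable_geometric_of_lt_one (norm_nonneg _) hq)).mul_right _

theorem multipliable_qProd (hq : ‖q‖ < 1) (w : ℂ) : Multipliable fun s : ℕ => 1 - q ^ (s + 1) * w := by
  simp only [sub_eq_add_neg]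
  exact multipliable_one_add_of_summable (summable_norm_qProd hq w)

theorem qProd_eq_zero_iff (hq : ‖q‖ < 1) (w : ℂ) : qProd q w = 0 ↔ ∃ s : ℕ, q ^ (s + 1) * w = 1 := by
  constructor
  · intro h
    by_contra! hne
    refine tprod_one_add_ne_zero_of_summable (f := fun s : ℕ => -(q ^ (s + 1) * w)) (fun i hi => ?_)
      (summable_norm_qProd hq w) ?_
    · exact hne i (by linear_combination -hi)
    · simpa only [qProd, sub_eq_add_neg] using h
  · rintro ⟨s, hs⟩
    have : HasProd (fun s : ℕ => 1 - q ^ (s + 1) * w) 0 := by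
      refine hasProd_zero_of_exists_eq_zero ⟨s, by rw [hs, sub_self]⟩
    exact this.tprod_eq

theorem tprod_eq_one_sub_mul_qProd (hq : ‖q‖ < 1) (w : ℂ) :
    ∏' s : ℕ, (1 - q ^ s * w) = (1 - w) * qProd q w := by
  by_cases h : w = 1
  · subst h
    rw [sub_self, zero_mul]
    exact (hasProd_zero_of_exists_eq_zero ⟨0, by simp⟩).tprod_eq
  · have := tprod_eq_zero_mul' (f := fun s : ℕ => 1 - q ^ s * w) (multipliable_qProd hq w)
    simpa [qProd] using this

/-- A shift of the index of the product. This is the source of the quasi-periodicity of θ under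
translation by τ. -/
theorem qProd_eq_mul (hq : ‖q‖ < 1) (w : ℂ) : qProd q w = (1 - q * w) * qProd q (q * w) := by
  rw [← tprod_eq_one_sub_mul_qProd hq]
  simp only [qProd, pow_succ, mul_assoc]

theorem differentiable_qProd (hq : ‖q‖ < 1) : Differentiable ℂ (qProd q) := by
  intro w
  -- On the ball of radius ‖w‖ + 1 the factors are dominated by their values at the real point ‖w‖ +
  -- 1, so convergence is locally uniform and the limit is holomorphic.
  have h1 : HasProdLocallyUniformlyOn (fun (n : ℕ) (x : ℂ) => 1 + -(q ^ (n + 1) * x))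
      (fun x => ∏' i : ℕ, (1 + -(q ^ (i + 1) * x))) (Metric.ball 0 (‖w‖ + 1)) := by
    refine Summable.hasProdLocallyUniformlyOn_nat_one_add Metric.isOpen_ball
      (summable_norm_qProd hq ((‖w‖ + 1 : ℝ) : ℂ)) (.of_forall fun n x hx => ?_)
      (fun n => by fun_prop)
    simp only [norm_neg, norm_mul, Complex.norm_real]
    gcongr
    rw [mem_ball_zero_iff] at hx
    exact hx.le.trans (le_abs_self _)
  have h2 : DifferentiableOn ℂ (qProd q) (Metric.ball 0 (‖w‖ + 1)) := by
    have := h1.differentiableOn (.of_forall fun _ => by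
      simpa [Finset.prod_fn] using
        DifferentiableOn.finsetProd (fun _ _ => by fun_prop)) Metric.isOpen_ball
    refine this.congr fun x _ => ?_
    simp only [qProd, sub_eq_add_neg]
  exact h2.differentiableAt (Metric.isOpen_ball.mem_nhds (by simp))

end qProd

/-! ### The theta function -/

variable (τ : ℍ)

/-- The nome `q = e^{2πiτ}`. -/
noncomputable def nome : ℂ := cexp (2 * Real.pi * I * (τ : ℂ))

theorem norm_nome_lt_one : ‖nome τ‖ < 1 := UpperHalfPlane.norm_exp_two_pi_I_lt_one τ

theorem nome_ne_zero : nome τ ≠ 0 := Complex.exp_ne_zero _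

theorem qProd_nome_one_ne_zero : qProd (nome τ) 1 ≠ 0 := by
  intro h
  obtain ⟨s, hs⟩ := (qProd_eq_zero_iff (norm_nome_lt_one τ) 1).1 h
  have := pow_lt_one₀ (norm_nonneg _) (norm_nome_lt_one τ) (Nat.succ_ne_zero s)
  rw [← norm_pow] at this
  rw [mul_one] at hs
  simp [hs] at this

/-- The factor s = 0 of the second product is absorbed into e^{πiz}. In this symmetric form oddness,
the zero at 0 and the derivative there can be read off. -/
theorem theta_eq (z : ℂ) :
    theta τ z = (cexp (Real.pi * I * z) - cexp (-(Real.pi * I * z))) *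
      (qProd (nome τ) (cexp (2 * Real.pi * I * z)) *
        qProd (nome τ) (cexp (-(2 * Real.pi * I * z)))) *
      (1 / (2 * Real.pi * I) * ((qProd (nome τ) 1) ^ 2)⁻¹) := by
  have h1 : cexp (Real.pi * I * z) * (1 - cexp (-(2 * Real.pi * I * z))) =
      cexp (Real.pi * I * z) - cexp (-(Real.pi * I * z)) := by
    rw [mul_sub, mul_one, ← Complex.exp_add]
    ring_nf
  have h2 : ∏' s : ℕ, (1 - nome τ ^ (s + 1)) = qProd (nome τ) 1 := by simp [qProd]
  have h3 : theta τ z = cexp (Real.pi * I * z) *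
      (∏' s : ℕ, (1 - nome τ ^ (s + 1) * cexp (2 * Real.pi * I * z))) *
      (∏' s : ℕ, (1 - nome τ ^ s * (cexp (2 * Real.pi * I * z))⁻¹)) * (1 / (2 * Real.pi * I)) *
      ((∏' s : ℕ, (1 - nome τ ^ (s + 1))) ^ 2)⁻¹ := rfl
  rw [← h1, h3, ← Complex.exp_neg, tprod_eq_one_sub_mul_qProd (norm_nome_lt_one τ), h2,
    show (∏' s : ℕ, (1 - nome τ ^ (s + 1) * cexp (2 * Real.pi * I * z))) =
      qProd (nome τ) (cexp (2 * Real.pi * I * z)) from rfl]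
  ring

theorem differentiable_theta : Differentiable ℂ (theta τ) := by
  have h := differentiable_qProd (norm_nome_lt_one τ)
  have h1 : Differentiable ℂ fun z : ℂ => qProd (nome τ) (cexp (2 * Real.pi * I * z)) :=
    h.comp (by fun_prop)
  have h2 : Differentiable ℂ fun z : ℂ => qProd (nome τ) (cexp (-(2 * Real.pi * I * z))) :=
    h.comp (by fun_prop)
  rw [show theta τ = _ from funext (theta_eq τ)]
  fun_prop

theorem analyticAt_theta (z : ℂ) : AnalyticAt ℂ (theta τ) z :=
  (differentiable_theta τ).analyticAt z

theorem theta_neg (z : ℂ) : theta τ (-z) = -theta τ z := by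
  rw [theta_eq, theta_eq]
  simp only [mul_neg, neg_neg]
  ring

@[simp] theorem theta_zero : theta τ 0 = 0 := by simp [theta_eq]

theorem theta_add_one (z : ℂ) : theta τ (z + 1) = -theta τ z := by
  have h1 : cexp (Real.pi * I * (z + 1)) = -cexp (Real.pi * I * z) := by
    rw [mul_add, mul_one, Complex.exp_add, Complex.exp_pi_mul_I]; ring
  have h2 : cexp (2 * Real.pi * I * (z + 1)) = cexp (2 * Real.pi * I * z) := by
    rw [mul_add, mul_one, Complex.exp_add, Complex.exp_two_pi_mul_I, mul_one]
  rw [theta_eq, theta_eq]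
  simp only [Complex.exp_neg, h1, h2, inv_neg]
  ring

theorem theta_add_tau (z : ℂ) :
    theta τ (z + τ) = -cexp (-(Real.pi * I * τ)) * cexp (-(2 * Real.pi * I * z)) * theta τ z := by
  have hq := norm_nome_lt_one τ
  -- With the square roots p of q and w of u, the claim becomes an algebraic identity after one
  -- shift in each infinite product.
  set p : ℂ := cexp (Real.pi * I * τ) with hp
  set w : ℂ := cexp (Real.pi * I * z) with hw
  have hp0 : p ≠ 0 := Complex.exp_ne_zero _
  have hw0 : w ≠ 0 := Complex.exp_ne_zero _
  have hn : nome τ = p ^ 2 := by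
    rw [nome, hp, ← Complex.exp_nat_mul]; congr 1; push_cast; ring
  have hu : cexp (2 * Real.pi * I * z) = w ^ 2 := by
    rw [hw, ← Complex.exp_nat_mul]; congr 1; push_cast; ring
  have h1 : cexp (Real.pi * I * (z + τ)) = w * p := by rw [mul_add, Complex.exp_add]
  have h2 : cexp (2 * Real.pi * I * (z + τ)) = nome τ * w ^ 2 := by
    rw [mul_add, Complex.exp_add, hu, nome, mul_comm]
  rw [theta_eq, theta_eq]
  simp only [Complex.exp_neg, h1, h2, hu, ← hp, ← hw]
  have e1 := qProd_eq_mul hq (w ^ 2)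
  have e2 := qProd_eq_mul hq ((nome τ * w ^ 2)⁻¹)
  have e3 : nome τ * (nome τ * w ^ 2)⁻¹ = (w ^ 2)⁻¹ := by
    have := nome_ne_zero τ
    field_simp
  rw [e3] at e2
  rw [e1, e2, hn]
  generalize qProd (p ^ 2) (p ^ 2 * w ^ 2) = A
  generalize qProd (p ^ 2) (w ^ 2)⁻¹ = B
  generalize qProd (p ^ 2) 1 = D
  have e4 : w * p - (w * p)⁻¹ = -(w * p)⁻¹ * (1 - p ^ 2 * w ^ 2) := by field_simp; ring
  have e5 : 1 - (w ^ 2)⁻¹ = w⁻¹ * (w - w⁻¹) := by field_simp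
  rw [e4, e5, mul_inv]
  ring

/-- Quasi-periodicity of `θ` with respect to `Λ_τ`. -/
theorem exists_theta_add_lattice (m n : ℤ) :
    ∃ C : ℂ, C ≠ 0 ∧ ∀ z, theta τ (z + (m + n * τ)) = C * cexp (-(2 * Real.pi * I * n * z)) *
      theta τ z := by
  have hm : ∀ m : ℤ, ∃ C : ℂ, C ≠ 0 ∧ ∀ z, theta τ (z + m) = C * theta τ z := by
    intro m
    induction m using Int.induction_on with
    | zero => exact ⟨1, one_ne_zero, by simp⟩
    | succ k ih =>
      obtain ⟨C, hC, h⟩ := ih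
      refine ⟨-C, neg_ne_zero.2 hC, fun z => ?_⟩
      rw [Int.cast_add, Int.cast_one, ← add_assoc, theta_add_one, h]; ring
    | pred k ih =>
      obtain ⟨C, hC, h⟩ := ih
      refine ⟨-C, neg_ne_zero.2 hC, fun z => ?_⟩
      have := theta_add_one τ (z + ((-(k : ℤ) - 1 : ℤ) : ℂ))
      rw [show z + ((-(k : ℤ) - 1 : ℤ) : ℂ) + 1 = z + ((-(k : ℤ) : ℤ) : ℂ) by push_cast; ring, h]
        at this
      linear_combination this
  have hn : ∀ n : ℤ, ∃ C : ℂ, C ≠ 0 ∧ ∀ z, theta τ (z + n * τ) =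
      C * cexp (-(2 * Real.pi * I * n * z)) * theta τ z := by
    intro n
    induction n using Int.induction_on with
    | zero => exact ⟨1, one_ne_zero, by simp⟩
    | succ k ih =>
      obtain ⟨C, hC, h⟩ := ih
      refine ⟨-C * cexp (-(Real.pi * I * τ)) * cexp (-(2 * Real.pi * I * (k * τ))), by
        simp [hC, Complex.exp_ne_zero], fun z => ?_⟩
      rw [show z + ((k + 1 : ℤ) : ℂ) * τ = z + ((k : ℤ) : ℂ) * τ + τ by push_cast; ring,
        theta_add_tau, h]
      have : cexp (-(2 * Real.pi * I * (z + ((k : ℤ) : ℂ) * τ))) *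
          cexp (-(2 * Real.pi * I * ((k : ℤ) : ℂ) * z)) = cexp (-(2 * Real.pi * I * (k * τ))) *
            cexp (-(2 * Real.pi * I * ((k + 1 : ℤ) : ℂ) * z)) := by
        rw [← Complex.exp_add, ← Complex.exp_add]; congr 1; push_cast; ring
      linear_combination (-C * cexp (-(Real.pi * I * τ)) * theta τ z) * this
    | pred k ih =>
      obtain ⟨C, hC, h⟩ := ih
      refine ⟨-C * cexp (Real.pi * I * τ) * cexp (2 * Real.pi * I * ((-k - 1) * τ)), by
        simp [hC, Complex.exp_ne_zero], fun z => ?_⟩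
      have h1 := theta_add_tau τ (z + ((-(k : ℤ) - 1 : ℤ) : ℂ) * τ)
      rw [show z + ((-(k : ℤ) - 1 : ℤ) : ℂ) * τ + τ = z + ((-(k : ℤ) : ℤ) : ℂ) * τ by
        push_cast; ring, h] at h1
      have h2 : cexp (Real.pi * I * τ) * cexp (-(Real.pi * I * τ)) = 1 := by
        rw [← Complex.exp_add]; simp
      have h3 : cexp (2 * Real.pi * I * (z + ((-(k : ℤ) - 1 : ℤ) : ℂ) * τ)) *
          cexp (-(2 * Real.pi * I * (z + ((-(k : ℤ) - 1 : ℤ) : ℂ) * τ))) = 1 := by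
        rw [← Complex.exp_add]; simp
      have h4 : cexp (2 * Real.pi * I * (z + ((-(k : ℤ) - 1 : ℤ) : ℂ) * τ)) *
          cexp (-(2 * Real.pi * I * ((-(k : ℤ) : ℤ) : ℂ) * z)) =
          cexp (2 * Real.pi * I * ((-k - 1) * τ)) *
            cexp (-(2 * Real.pi * I * ((-(k : ℤ) - 1 : ℤ) : ℂ) * z)) := by
        rw [← Complex.exp_add, ← Complex.exp_add]; congr 1; push_cast; ring
      generalize theta τ (z + ((-(k : ℤ) - 1 : ℤ) : ℂ) * τ) = T at *
      generalize cexp (2 * Real.pi * I * (z + ((-(k : ℤ) - 1 : ℤ) : ℂ) * τ)) = a at *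
      generalize cexp (-(2 * Real.pi * I * (z + ((-(k : ℤ) - 1 : ℤ) : ℂ) * τ))) = a' at *
      generalize cexp (Real.pi * I * τ) = b at *
      generalize cexp (-(Real.pi * I * τ)) = b' at *
      linear_combination (a * b) * h1 - T * h2 - b * b' * T * h3 - b * C * theta τ z * h4
  obtain ⟨C, hC, h⟩ := hm m
  obtain ⟨C', hC', h'⟩ := hn n
  refine ⟨C * C', mul_ne_zero hC hC', fun z => ?_⟩
  rw [show z + (m + n * τ) = z + n * τ + m by ring, h, h']; ring

theorem theta_eq_zero_iff (z : ℂ) : theta τ z = 0 ↔ z ∈ lattice τ := by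
  constructor
  · intro h
    have hq := norm_nome_lt_one τ
    -- A vanishing factor 1 - q^{s+1}e^{2πiw} places w in -(s+1)τ + ℤ. It is used for w = z and w =
    -- -z, one for each product; the sine factor accounts for the remaining zeros, the integers.
    have key : ∀ (w : ℂ) (s : ℕ), nome τ ^ (s + 1) * cexp (2 * Real.pi * I * w) = 1 →
        ∃ m : ℤ, w = m + ((-(s + 1 : ℤ) : ℤ) : ℂ) * τ := by
      intro w s hs
      rw [nome, ← Complex.exp_nat_mul, ← Complex.exp_add, Complex.exp_eq_one_iff] at hs
      obtain ⟨m, hm⟩ := hs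
      refine ⟨m, ?_⟩
      have h0 : (2 * Real.pi * I : ℂ) ≠ 0 := by simp [Real.pi_ne_zero]
      apply mul_left_cancel₀ h0
      push_cast at hm ⊢
      linear_combination hm
    rw [theta_eq] at h
    have h0 : (1 / (2 * Real.pi * I) * ((qProd (nome τ) 1) ^ 2)⁻¹) ≠ 0 := by
      simp [Real.pi_ne_zero, qProd_nome_one_ne_zero]
    rcases mul_eq_zero.1 ((mul_eq_zero.1 h).resolve_right h0) with h | h
    · have h1 : cexp (2 * Real.pi * I * z) = 1 := by
        have : cexp (Real.pi * I * z) * cexp (-(Real.pi * I * z)) = 1 := by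
          rw [← Complex.exp_add]; simp
        rw [show 2 * Real.pi * I * z = Real.pi * I * z + Real.pi * I * z by ring, Complex.exp_add]
        linear_combination cexp (Real.pi * I * z) * h + this
      rw [Complex.exp_eq_one_iff] at h1
      obtain ⟨m, hm⟩ := h1
      refine ⟨m, 0, ?_⟩
      have h0 : (2 * Real.pi * I : ℂ) ≠ 0 := by simp [Real.pi_ne_zero]
      apply mul_left_cancel₀ h0
      rw [hm]; push_cast; ring
    · rcases mul_eq_zero.1 h with h | h
      · obtain ⟨s, hs⟩ := (qProd_eq_zero_iff hq _).1 h
        obtain ⟨m, hm⟩ := key z s hs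
        exact ⟨m, _, hm⟩
      · obtain ⟨s, hs⟩ := (qProd_eq_zero_iff hq _).1 h
        rw [← mul_neg] at hs
        obtain ⟨m, hm⟩ := key (-z) s hs
        refine ⟨-m, s + 1, ?_⟩
        push_cast at hm ⊢
        linear_combination -hm
  · rintro ⟨m, n, rfl⟩
    obtain ⟨C, -, h⟩ := exists_theta_add_lattice τ m n
    simpa using h 0

theorem hasDerivAt_theta_zero : HasDerivAt (theta τ) 1 0 := by
  have h := differentiable_qProd (norm_nome_lt_one τ)
  have h1 : Differentiable ℂ fun z : ℂ => qProd (nome τ) (cexp (2 * Real.pi * I * z)) :=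
    h.comp (by fun_prop)
  have h2 : Differentiable ℂ fun z : ℂ => qProd (nome τ) (cexp (-(2 * Real.pi * I * z))) :=
    h.comp (by fun_prop)
  have h3 : HasDerivAt (fun z : ℂ => cexp (Real.pi * I * z) - cexp (-(Real.pi * I * z)))
      (2 * Real.pi * I) 0 := by
    have a : HasDerivAt (fun z : ℂ => Real.pi * I * z) (Real.pi * I) 0 := by
      simpa using (hasDerivAt_id (0 : ℂ)).const_mul (Real.pi * I : ℂ)
    refine (a.cexp.sub a.fun_neg.cexp).congr_deriv ?_
    simp only [mul_zero, neg_zero, Complex.exp_zero, one_mul]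
    ring
  have h4 := (h3.mul (h1.mul h2 0).hasDerivAt).mul_const
    (1 / (2 * Real.pi * I) * ((qProd (nome τ) 1) ^ 2)⁻¹)
  rw [show theta τ = _ from funext (theta_eq τ)]
  refine h4.congr_deriv ?_
  have := qProd_nome_one_ne_zero τ
  have hI : (2 * Real.pi * I : ℂ) ≠ 0 := by simp [Real.pi_ne_zero]
  simp only [mul_zero, neg_zero, Complex.exp_zero, sub_self, zero_mul, add_zero, Pi.mul_apply]
  field_simp

/-- Quasi-periodicity transports θ'(0) = 1 to every lattice point, so all zeros of θ are simple. -/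
theorem deriv_theta_lattice_ne_zero {w : ℂ} (hw : w ∈ lattice τ) : deriv (theta τ) w ≠ 0 := by
  obtain ⟨m, n, rfl⟩ := hw
  obtain ⟨C, hC, h⟩ := exists_theta_add_lattice τ m n
  have h1 : HasDerivAt (fun z => theta τ (z + (m + n * τ))) (deriv (theta τ) (m + n * τ)) 0 := by
    have := (differentiable_theta τ (0 + (m + n * τ))).hasDerivAt.comp_add_const
      (0 : ℂ) (m + n * τ)
    simpa using this
  have a : HasDerivAt (fun z : ℂ => -(2 * Real.pi * I * n * z)) (-(2 * Real.pi * I * n)) 0 := by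
    simpa using (hasDerivAt_id (0 : ℂ)).const_mul (-(2 * Real.pi * I * n) : ℂ)
  have h2 := (a.cexp.const_mul C).mul (hasDerivAt_theta_zero τ)
  rw [funext h] at h1
  rw [h1.unique h2]
  simpa using hC

theorem lattice_int_mul {w : ℂ} (k : ℤ) (hw : w ∈ lattice τ) : k * w ∈ lattice τ := by
  obtain ⟨m, n, rfl⟩ := hw
  exact ⟨k * m, k * n, by push_cast; ring⟩

theorem lattice_add {w w' : ℂ} (hw : w ∈ lattice τ) (hw' : w' ∈ lattice τ) :
    w + w' ∈ lattice τ := by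
  obtain ⟨m, n, rfl⟩ := hw
  obtain ⟨m', n', rfl⟩ := hw'
  exact ⟨m + m', n + n', by push_cast; ring⟩

end KZB

namespace KZB

open Complex Filter Topology
open Finset.HasAntidiagonal (antidiagonal)

/-! ### Taylor coefficients -/

/-- The `n`-th Taylor coefficient of `f` at `0`. -/
noncomputable def taylorCoeff (f : ℂ → ℂ) (n : ℕ) : ℂ := iteratedDeriv n f 0 / n.factorial

section Taylor

variable {f g : ℂ → ℂ}

theorem taylorCoeff_eq_of_hasFPowerSeriesAt {p : FormalMultilinearSeries ℂ ℂ ℂ}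
    (h : HasFPowerSeriesAt f p 0) (n : ℕ) : taylorCoeff f n = p.coeff n := by
  have := h.eq_formalMultilinearSeries h.analyticAt.hasFPowerSeriesAt
  rw [this, FormalMultilinearSeries.coeff_ofScalars, taylorCoeff]

theorem taylorCoeff_hasSum (hf : AnalyticAt ℂ f 0) :
    ∀ᶠ s in 𝓝 0, HasSum (fun n => taylorCoeff f n * s ^ n) (f s) := by
  have := hasFPowerSeriesAt_iff.1 hf.hasFPowerSeriesAt
  simpa only [FormalMultilinearSeries.coeff_ofScalars, zero_add, smul_eq_mul, mul_comm,
    taylorCoeff] using this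

theorem taylorCoeff_eq_of_hasSum {c : ℕ → ℂ}
    (h : ∀ᶠ s in 𝓝 0, HasSum (fun n => c n * s ^ n) (f s)) (n : ℕ) : taylorCoeff f n = c n := by
  have h' : HasFPowerSeriesAt f (FormalMultilinearSeries.ofScalars ℂ c) 0 := by
    refine hasFPowerSeriesAt_iff.2 ?_
    simpa only [FormalMultilinearSeries.coeff_ofScalars, zero_add, smul_eq_mul, mul_comm] using h
  rw [taylorCoeff_eq_of_hasFPowerSeriesAt h', FormalMultilinearSeries.coeff_ofScalars]

theorem taylorCoeff_congr (h : f =ᶠ[𝓝 0] g) (n : ℕ) : taylorCoeff f n = taylorCoeff g n := by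
  rw [taylorCoeff, taylorCoeff, h.iteratedDeriv_eq]

theorem taylorCoeff_zero (f : ℂ → ℂ) : taylorCoeff f 0 = f 0 := by simp [taylorCoeff]

theorem taylorCoeff_one (f : ℂ → ℂ) : taylorCoeff f 1 = deriv f 0 := by simp [taylorCoeff]

theorem taylorCoeff_mul (hf : AnalyticAt ℂ f 0) (hg : AnalyticAt ℂ g 0) (n : ℕ) :
    taylorCoeff (fun s => f s * g s) n =
      ∑ p ∈ antidiagonal n, taylorCoeff f p.1 * taylorCoeff g p.2 := by
  have h := iteratedDeriv_mul (n := n) hf.contDiffAt hg.contDiffAt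
  rw [taylorCoeff, show (fun s => f s * g s) = f * g from rfl, h,
    Finset.Nat.sum_antidiagonal_eq_sum_range_succ (fun i j => taylorCoeff f i * taylorCoeff g j),
    Finset.sum_div]
  refine Finset.sum_congr rfl fun i hi => ?_
  have hi' : i ≤ n := Nat.lt_succ_iff.1 (Finset.mem_range.1 hi)
  rw [taylorCoeff, taylorCoeff, Nat.cast_choose ℂ hi']
  have h1 : (n.factorial : ℂ) ≠ 0 := Nat.cast_ne_zero.2 n.factorial_ne_zero
  have h2 : (i.factorial : ℂ) ≠ 0 := Nat.cast_ne_zero.2 i.factorial_ne_zero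
  have h3 : ((n - i).factorial : ℂ) ≠ 0 := Nat.cast_ne_zero.2 (n - i).factorial_ne_zero
  field_simp

theorem taylorCoeff_const_mul (c : ℂ) (hf : AnalyticAt ℂ f 0) (n : ℕ) :
    taylorCoeff (fun s => c * f s) n = c * taylorCoeff f n := by
  refine taylorCoeff_eq_of_hasSum (c := fun n => c * taylorCoeff f n) ?_ n
  filter_upwards [taylorCoeff_hasSum hf] with s hs
  simpa only [mul_assoc] using hs.mul_left c

theorem taylorCoeff_sub (hf : AnalyticAt ℂ f 0) (hg : AnalyticAt ℂ g 0) (n : ℕ) :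
    taylorCoeff (fun s => f s - g s) n = taylorCoeff f n - taylorCoeff g n := by
  refine taylorCoeff_eq_of_hasSum (c := fun n => taylorCoeff f n - taylorCoeff g n) ?_ n
  filter_upwards [taylorCoeff_hasSum hf, taylorCoeff_hasSum hg] with s hs hs'
  simpa only [sub_mul] using hs.sub hs'

theorem taylorCoeff_sum {ι : Type*} (t : Finset ι) {F : ι → ℂ → ℂ}
    (hF : ∀ i ∈ t, AnalyticAt ℂ (F i) 0) (n : ℕ) :
    taylorCoeff (fun s => ∑ i ∈ t, F i s) n = ∑ i ∈ t, taylorCoeff (F i) n := by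
  refine taylorCoeff_eq_of_hasSum (c := fun n => ∑ i ∈ t, taylorCoeff (F i) n) ?_ n
  have : ∀ᶠ s in 𝓝 0, ∀ i ∈ t, HasSum (fun n => taylorCoeff (F i) n * s ^ n) (F i s) :=
    (eventually_all_finset t).2 fun i hi => taylorCoeff_hasSum (hF i hi)
  filter_upwards [this] with s hs
  simpa only [Finset.sum_mul] using hasSum_sum hs

theorem taylorCoeff_comp_mul (c : ℂ) (hf : AnalyticAt ℂ f 0) (n : ℕ) :
    taylorCoeff (fun s => f (c * s)) n = c ^ n * taylorCoeff f n := by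
  refine taylorCoeff_eq_of_hasSum (c := fun n => c ^ n * taylorCoeff f n) ?_ n
  have h : Tendsto (fun s : ℂ => c * s) (𝓝 0) (𝓝 0) := by
    simpa using (continuous_const_mul c).tendsto (0 : ℂ)
  filter_upwards [h.eventually (taylorCoeff_hasSum hf)] with s hs
  simpa only [mul_pow, mul_left_comm, mul_assoc, mul_comm] using hs

theorem taylorCoeff_id_mul (hf : AnalyticAt ℂ f 0) (n : ℕ) :
    taylorCoeff (fun s => s * f s) (n + 1) = taylorCoeff f n := by
  -- The coefficient sequence of f moved up by one place, with 0 in front.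
  let c : ℕ → ℂ := fun m => Nat.casesOn m 0 (taylorCoeff f)
  refine taylorCoeff_eq_of_hasSum (c := c) ?_ (n + 1)
  filter_upwards [taylorCoeff_hasSum hf] with s hs
  have h : HasSum (fun n => c (n + 1) * s ^ (n + 1)) (s * f s) := by
    simpa only [c, pow_succ, mul_left_comm, mul_assoc, mul_comm] using hs.mul_left s
  refine (hasSum_nat_add_iff' (f := fun n => c n * s ^ n) 1).1 ?_
  simpa [c] using h

theorem taylorCoeff_dslope (hf : AnalyticAt ℂ f 0) (n : ℕ) :
    taylorCoeff (dslope f 0) n = taylorCoeff f (n + 1) := by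
  have h := hf.hasFPowerSeriesAt
  rw [taylorCoeff_eq_of_hasFPowerSeriesAt h.has_fpower_series_dslope_fslope,
    FormalMultilinearSeries.coeff_fslope, ← taylorCoeff_eq_of_hasFPowerSeriesAt h]

theorem analyticAt_dslope (hf : AnalyticAt ℂ f 0) : AnalyticAt ℂ (dslope f 0) 0 :=
  hf.hasFPowerSeriesAt.has_fpower_series_dslope_fslope.analyticAt

theorem taylorCoeff_exp (c : ℂ) (n : ℕ) :
    taylorCoeff (fun s => cexp (c * s)) n = c ^ n / n.factorial := by
  rw [taylorCoeff_comp_mul c (f := cexp) (by fun_prop), taylorCoeff, iteratedDeriv_eq_iterate,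
    Complex.iter_deriv_exp, Complex.exp_zero]
  ring

end Taylor

/-! ### The coefficients of `k(z, x|τ)` -/

variable (τ : ℍ)

/-- The Kronecker function `θ(z + x) / (θ(z) θ(x))`. -/
noncomputable def kron (z x : ℂ) : ℂ := theta τ (z + x) / (theta τ z * theta τ x)

/-- The constants in the quasi-periodicity of θ and the exponentials in z cancel between numerator
and denominator; only the exponential in x survives. -/
theorem kron_add_lattice (m n : ℤ) (z x : ℂ) :
    kron τ (z + (m + n * τ)) x = cexp (-(2 * Real.pi * I * n) * x) * kron τ z x := by
  obtain ⟨C, hC, h⟩ := exists_theta_add_lattice τ m n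
  have hC' : C * C⁻¹ = 1 := mul_inv_cancel₀ hC
  have hb : cexp (-(2 * Real.pi * I * n * z)) * (cexp (-(2 * Real.pi * I * n * z)))⁻¹ = 1 :=
    mul_inv_cancel₀ (Complex.exp_ne_zero _)
  rw [kron, kron, show z + (m + n * τ) + x = z + x + (m + n * τ) by ring, h, h,
    show -(2 * Real.pi * I * n * (z + x)) = -(2 * Real.pi * I * n) * x + -(2 * Real.pi * I * n * z)
      by ring, Complex.exp_add]
  generalize cexp (-(2 * Real.pi * I * n) * x) = a at *
  generalize cexp (-(2 * Real.pi * I * n * z)) = b at *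
  simp only [div_eq_mul_inv, mul_inv]
  linear_combination (a * theta τ (z + x) * (theta τ z)⁻¹ * (theta τ x)⁻¹) * (b * b⁻¹ * hC' + hb)

/-- `θ(x) / x`. -/
noncomputable def thetaQuot : ℂ → ℂ := dslope (theta τ) 0

theorem mul_thetaQuot (x : ℂ) : x * thetaQuot τ x = theta τ x := by
  simpa [thetaQuot] using sub_smul_dslope_of_zero (theta_zero τ) x

theorem thetaQuot_zero : thetaQuot τ 0 = 1 := by
  rw [thetaQuot, dslope_same, (hasDerivAt_theta_zero τ).deriv]

theorem differentiable_thetaQuot : Differentiable ℂ (thetaQuot τ) := by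
  rw [← differentiableOn_univ, thetaQuot, Complex.differentiableOn_dslope univ_mem]
  exact (differentiable_theta τ).differentiableOn

theorem thetaQuot_neg (x : ℂ) : thetaQuot τ (-x) = thetaQuot τ x := by
  by_cases h : x = 0
  · simp [h]
  · apply mul_left_cancel₀ (neg_ne_zero.2 h)
    rw [mul_thetaQuot, theta_neg, neg_mul, mul_thetaQuot]

/-- θ(x)/x is even. Its missing linear term is the reason why k_0 is exactly θ'/θ. -/
theorem deriv_thetaQuot_zero : deriv (thetaQuot τ) 0 = 0 := by
  have h := deriv_comp_neg (f := thetaQuot τ) (x := 0)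
  rw [funext (thetaQuot_neg τ), neg_zero] at h
  exact self_eq_neg.1 h

/-- `x θ(z + x) / (θ(z) θ(x))`. -/
noncomputable def kronReg (z x : ℂ) : ℂ := theta τ (z + x) / (theta τ z * thetaQuot τ x)

variable {τ}

theorem kronReg_zero {z : ℂ} (hz : theta τ z ≠ 0) : kronReg τ z 0 = 1 := by
  simp [kronReg, thetaQuot_zero, hz]

theorem analyticAt_kronReg {z : ℂ} (hz : theta τ z ≠ 0) : AnalyticAt ℂ (kronReg τ z) 0 := by
  have h1 : AnalyticAt ℂ (fun x => theta τ (z + x)) 0 :=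
    ((differentiable_theta τ).comp (differentiable_id.const_add z)).analyticAt 0
  refine h1.div (analyticAt_const.mul ((differentiable_thetaQuot τ).analyticAt 0)) ?_
  simpa [thetaQuot_zero] using hz

theorem kron_eq_kronReg_div (z x : ℂ) : kron τ z x = kronReg τ z x / x := by
  rw [kron, kronReg, ← mul_thetaQuot τ x, div_div]
  congr 1; ring

/-- xF(z, x) is analytic at x = 0 with value 1, and k is its difference quotient there. Hence the
limit in `kFun` exists and the filled-in value is the derivative. -/
theorem kFun_eq_dslope {z : ℂ} (hz : theta τ z ≠ 0) :
    kFun τ z = dslope (kronReg τ z) 0 := by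
  have hslope : ∀ x : ℂ, x ≠ 0 →
      theta τ (z + x) / (theta τ z * theta τ x) - 1 / x = dslope (kronReg τ z) 0 x := by
    intro x hx
    rw [dslope_of_ne _ hx, slope_def_field, kronReg_zero hz, sub_zero, sub_div,
      ← kron_eq_kronReg_div z x, kron]
  funext x
  by_cases hx : x = 0
  · subst hx
    rw [kFun, Function.update_self]
    refine Tendsto.limUnder_eq ?_
    have := (analyticAt_dslope (analyticAt_kronReg hz)).continuousAt.tendsto
    refine (this.mono_left nhdsWithin_le_nhds).congr' ?_
    filter_upwards [self_mem_nhdsWithin] with x hx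
    exact (hslope x hx).symm
  · rw [kFun, Function.update_of_ne hx]
    exact hslope x hx

theorem analyticAt_kFun {z : ℂ} (hz : theta τ z ≠ 0) : AnalyticAt ℂ (kFun τ z) 0 := by
  rw [kFun_eq_dslope hz]
  exact analyticAt_dslope (analyticAt_kronReg hz)

theorem kFun_of_ne (z : ℂ) {x : ℂ} (hx : x ≠ 0) : kFun τ z x = kron τ z x - 1 / x := by
  rw [kFun, Function.update_of_ne hx, kron]

theorem kCoeff_eq_taylorCoeff (z : ℂ) (m : ℕ) : kCoeff τ z m = taylorCoeff (kFun τ z) m := rfl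

theorem kCoeff_eq {z : ℂ} (hz : theta τ z ≠ 0) (m : ℕ) :
    kCoeff τ z m = taylorCoeff (kronReg τ z) (m + 1) := by
  rw [kCoeff_eq_taylorCoeff, kFun_eq_dslope hz, taylorCoeff_dslope (analyticAt_kronReg hz)]

theorem theta_add_lattice_ne_zero {z : ℂ} (hz : theta τ z ≠ 0) (m n : ℤ) :
    theta τ (z + (m + n * τ)) ≠ 0 := by
  obtain ⟨C, hC, h⟩ := exists_theta_add_lattice τ m n
  rw [h]
  exact mul_ne_zero (mul_ne_zero hC (Complex.exp_ne_zero _)) hz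

theorem theta_neg_ne_zero {z : ℂ} (hz : theta τ z ≠ 0) : theta τ (-z) ≠ 0 := by
  rwa [theta_neg, neg_ne_zero]

theorem kCoeff_neg {z : ℂ} (hz : theta τ z ≠ 0) (m : ℕ) :
    kCoeff τ (-z) m = (-1) ^ (m + 1) * kCoeff τ z m := by
  have h : kronReg τ (-z) = fun x => kronReg τ z (-1 * x) := by
    funext x
    rw [kronReg, kronReg, neg_one_mul, thetaQuot_neg, theta_neg, ← theta_neg τ z,
      show -z + x = -(z + -x) by ring, theta_neg, theta_neg, neg_mul, neg_div_neg_eq]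
  rw [kCoeff_eq (theta_neg_ne_zero hz), kCoeff_eq hz, h,
    taylorCoeff_comp_mul _ (analyticAt_kronReg hz)]

/-- The coefficients of `x θ(z + x) / (θ(z) θ(x)) = 1 + x k(z, x|τ)`. -/
noncomputable def kronCoeff (τ : ℍ) (z : ℂ) : ℕ → ℂ
  | 0 => 1
  | m + 1 => kCoeff τ z m

theorem kronCoeff_eq {z : ℂ} (hz : theta τ z ≠ 0) (m : ℕ) :
    kronCoeff τ z m = taylorCoeff (kronReg τ z) m := by
  cases m with
  | zero => rw [taylorCoeff_zero, kronReg_zero hz, kronCoeff]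
  | succ m => rw [kronCoeff, kCoeff_eq hz]

/-- It is xF = 1 + xk, not k itself, that is multiplied by an exponential in x; the coefficients
therefore undergo a convolution. -/
theorem kronCoeff_add_lattice {z : ℂ} (hz : theta τ z ≠ 0) (m n : ℤ) (j : ℕ) :
    kronCoeff τ (z + (m + n * τ)) j =
      ∑ p ∈ antidiagonal j,
        (-(2 * Real.pi * I * n)) ^ p.1 / p.1.factorial * kronCoeff τ z p.2 := by
  have hz' := theta_add_lattice_ne_zero hz m n
  have h : kronReg τ (z + (m + n * τ)) =ᶠ[𝓝 0]
      fun x => cexp (-(2 * Real.pi * I * n) * x) * kronReg τ z x := by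
    refine Eventually.of_forall fun x => ?_
    by_cases hx : x = 0
    · subst hx
      dsimp only
      rw [kronReg_zero hz, kronReg_zero hz', mul_zero, Complex.exp_zero, one_mul]
    · have := kron_add_lattice τ m n z x
      rwa [kron_eq_kronReg_div _ x, kron_eq_kronReg_div _ x, mul_div_assoc',
        div_left_inj' hx] at this
  rw [kronCoeff_eq hz', taylorCoeff_congr h, taylorCoeff_mul (by fun_prop) (analyticAt_kronReg hz)]
  refine Finset.sum_congr rfl fun p _ => ?_
  rw [taylorCoeff_exp, kronCoeff_eq hz]

theorem kCoeff_add_int {z : ℂ} (hz : theta τ z ≠ 0) (m : ℤ) (j : ℕ) :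
    kCoeff τ (z + m) j = kCoeff τ z j := by
  have h := kronCoeff_add_lattice hz m 0 (j + 1)
  rw [Finset.sum_eq_single (0, j + 1)] at h
  · simpa [kronCoeff] using h
  · rintro ⟨a, b⟩ hab hne
    have : a ≠ 0 := by
      rintro rfl
      simp at hab hne
      omega
    simp [this]
  · simp

/-- The first summand comes from the constant term 1 of 1 + xk. -/
theorem kCoeff_add_int_mul_tau {z : ℂ} (hz : theta τ z ≠ 0) (n : ℤ) (j : ℕ) :
    kCoeff τ (z + n * τ) j =
      (-(2 * Real.pi * I * n)) ^ (j + 1) / (j + 1).factorial +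
      ∑ p ∈ antidiagonal j,
        (-(2 * Real.pi * I * n)) ^ p.1 / p.1.factorial * kCoeff τ z p.2 := by
  have h := kronCoeff_add_lattice hz 0 n (j + 1)
  rw [Finset.Nat.sum_antidiagonal_succ'] at h
  simpa [kronCoeff] using h

theorem analyticAt_inv_thetaQuot : AnalyticAt ℂ (fun x => (thetaQuot τ x)⁻¹) 0 :=
  ((differentiable_thetaQuot τ).analyticAt 0).fun_inv (by simp [thetaQuot_zero])

/-- Expresses k_m as a finite combination of the derivatives of θ at z divided by θ(z), which makes
its holomorphy in z visible. -/
theorem kCoeff_eq_sum {z : ℂ} (hz : theta τ z ≠ 0) (m : ℕ) :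
    kCoeff τ z m = ∑ p ∈ antidiagonal (m + 1),
      iteratedDeriv p.1 (theta τ) z / p.1.factorial *
        ((theta τ z)⁻¹ * taylorCoeff (fun x => (thetaQuot τ x)⁻¹) p.2) := by
  have h : kronReg τ z = fun x => theta τ (z + x) * ((theta τ z)⁻¹ * (thetaQuot τ x)⁻¹) := by
    funext x
    rw [kronReg, div_eq_mul_inv, mul_inv]
  have h1 : AnalyticAt ℂ (fun x => theta τ (z + x)) 0 :=
    ((differentiable_theta τ).comp (differentiable_id.const_add z)).analyticAt 0
  rw [kCoeff_eq hz, h, taylorCoeff_mul h1 (analyticAt_const.fun_mul analyticAt_inv_thetaQuot)]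
  refine Finset.sum_congr rfl fun p _ => ?_
  rw [taylorCoeff_const_mul _ analyticAt_inv_thetaQuot, taylorCoeff, iteratedDeriv_comp_const_add]
  simp

theorem kCoeff_zero {z : ℂ} (hz : theta τ z ≠ 0) :
    kCoeff τ z 0 = deriv (theta τ) z / theta τ z := by
  have h : deriv (fun x => (thetaQuot τ x)⁻¹) 0 = 0 := by
    rw [deriv_fun_inv'' ((differentiable_thetaQuot τ) 0) (by simp [thetaQuot_zero]),
      deriv_thetaQuot_zero, neg_zero, zero_div]
  rw [kCoeff_eq_sum hz, Finset.Nat.sum_antidiagonal_succ]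
  simp [taylorCoeff_zero, taylorCoeff_one, h, thetaQuot_zero, div_eq_mul_inv]

theorem differentiableAt_kCoeff {z : ℂ} (hz : theta τ z ≠ 0) (m : ℕ) :
    DifferentiableAt ℂ (fun z => kCoeff τ z m) z := by
  have hev : ∀ᶠ w in 𝓝 z, theta τ w ≠ 0 :=
    (differentiable_theta τ).continuous.continuousAt.eventually_ne hz
  have h : (fun w => kCoeff τ w m) =ᶠ[𝓝 z] fun w => ∑ p ∈ antidiagonal (m + 1),
      iteratedDeriv p.1 (theta τ) w / p.1.factorial *
        ((theta τ w)⁻¹ * taylorCoeff (fun x => (thetaQuot τ x)⁻¹) p.2) :=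
    hev.mono fun w hw => kCoeff_eq_sum hw m
  refine DifferentiableAt.congr_of_eventuallyEq ?_ h
  refine DifferentiableAt.fun_sum fun p _ => ?_
  refine ((DifferentiableAt.div_const ?_ _)).mul (DifferentiableAt.mul_const ?_ _)
  · exact ((differentiable_theta τ).contDiff (n := ⊤)).differentiable_iteratedDeriv p.1
      (by exact_mod_cast WithTop.coe_lt_top _) z
  · exact ((differentiable_theta τ) z).inv hz

end KZB

namespace KZB

open Complex Filter Topology
open Finset.HasAntidiagonal (antidiagonal)

/-! ### Quasi-periodic entire functions -/

/-- `f` extends analytically across `t`. -/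
def HasAnalyticExt (f : ℂ → ℂ) (t : ℂ) : Prop :=
  ∃ g : ℂ → ℂ, AnalyticAt ℂ g t ∧ f =ᶠ[𝓝[≠] t] g

theorem hasAnalyticExt_of_analyticAt {f : ℂ → ℂ} {t : ℂ} (h : AnalyticAt ℂ f t) :
    HasAnalyticExt f t := ⟨f, h, .rfl⟩

theorem HasAnalyticExt.add {f g : ℂ → ℂ} {t : ℂ} (hf : HasAnalyticExt f t)
    (hg : HasAnalyticExt g t) : HasAnalyticExt (fun s => f s + g s) t := by
  obtain ⟨F, hF, hfF⟩ := hf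
  obtain ⟨G, hG, hgG⟩ := hg
  exact ⟨fun s => F s + G s, hF.add hG, hfF.add hgG⟩

theorem HasAnalyticExt.const_mul {f : ℂ → ℂ} {t : ℂ} (c : ℂ) (hf : HasAnalyticExt f t) :
    HasAnalyticExt (fun s => c * f s) t := by
  obtain ⟨F, hF, hfF⟩ := hf
  exact ⟨fun s => c * F s, analyticAt_const.mul hF, EventuallyEq.rfl.mul hfF⟩

theorem HasAnalyticExt.sum {ι : Type*} (S : Finset ι) {f : ι → ℂ → ℂ} {t : ℂ}
    (hf : ∀ i ∈ S, HasAnalyticExt (f i) t) : HasAnalyticExt (fun s => ∑ i ∈ S, f i s) t := by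
  classical
  induction S using Finset.induction_on with
  | empty => simpa using hasAnalyticExt_of_analyticAt (f := fun _ => 0) (t := t) analyticAt_const
  | insert i S hi ih =>
    simp only [Finset.sum_insert hi]
    exact (hf i (Finset.mem_insert_self i S)).add
      (ih fun j hj => hf j (Finset.mem_insert_of_mem hj))

theorem HasAnalyticExt.div_of_simple_zero {f d : ℂ → ℂ} {t : ℂ} (hf : AnalyticAt ℂ f t)
    (hd : AnalyticAt ℂ d t) (hft : f t = 0) (hdt : d t = 0) (hd' : deriv d t ≠ 0) :
    HasAnalyticExt (fun s => f s / d s) t := by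
  have hF : AnalyticAt ℂ (dslope f t) t :=
    hf.hasFPowerSeriesAt.has_fpower_series_dslope_fslope.analyticAt
  have hD : AnalyticAt ℂ (dslope d t) t :=
    hd.hasFPowerSeriesAt.has_fpower_series_dslope_fslope.analyticAt
  refine ⟨fun s => dslope f t s / dslope d t s, hF.div hD (by rwa [dslope_same]), ?_⟩
  filter_upwards [self_mem_nhdsWithin] with s hs
  have hs' : s - t ≠ 0 := sub_ne_zero.2 hs
  rw [← sub_smul_dslope_of_zero hft s, ← sub_smul_dslope_of_zero hdt s, smul_eq_mul, smul_eq_mul,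
    mul_div_mul_left _ _ hs']

theorem eq_of_eventuallyEq_nhdsNE {f g : ℂ → ℂ} {t : ℂ} (hf : ContinuousAt f t)
    (hg : ContinuousAt g t) (h : f =ᶠ[𝓝[≠] t] g) : f t = g t :=
  tendsto_nhds_unique (hf.tendsto.mono_left nhdsWithin_le_nhds)
    ((hg.tendsto.mono_left nhdsWithin_le_nhds).congr' h.symm)

/-- The value at s is taken from the extension chosen at s. Near t these values agree with the
extension chosen at t, since both extensions equal f on a punctured neighbourhood of s and are
continuous. -/
theorem exists_differentiable_of_hasAnalyticExt {f : ℂ → ℂ} (h : ∀ t, HasAnalyticExt f t) :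
    ∃ g : ℂ → ℂ, Differentiable ℂ g ∧ ∀ t, f =ᶠ[𝓝[≠] t] g := by
  choose G hG hfG using h
  have key : ∀ t, (fun s => G s s) =ᶠ[𝓝[≠] t] G t := by
    intro t
    have h1 : ∀ᶠ s in 𝓝[≠] t, AnalyticAt ℂ (G t) s :=
      nhdsWithin_le_nhds (hG t).eventually_analyticAt
    have h2 := eventually_eventually_nhdsWithin.2 (hfG t)
    filter_upwards [h1, h2, self_mem_nhdsWithin] with s hs1 hs2 hs3
    refine eq_of_eventuallyEq_nhdsNE (hG s).continuousAt hs1.continuousAt ?_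
    have h3 : ∀ᶠ r in 𝓝[≠] s, f r = G t r := by
      have : 𝓝[{t}ᶜ] s = 𝓝 s := isOpen_compl_singleton.nhdsWithin_eq hs3
      rw [this] at hs2
      exact nhdsWithin_le_nhds hs2
    exact (hfG s).symm.trans h3
  refine ⟨fun s => G s s, fun t => ?_, fun t => (hfG t).trans (key t).symm⟩
  have : (fun s => G s s) =ᶠ[𝓝 t] G t := by
    rw [EventuallyEq, ← nhdsNE_sup_pure, eventually_sup]
    exact ⟨key t, by simp⟩
  exact (hG t).differentiableAt.congr_of_eventuallyEq this

variable {τ : ℍ}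

/-- Taking fractional parts of the coordinates with respect to 1, τ reduces every value of ‖h‖ to a
value on a compact parallelogram. -/
theorem isBounded_range_of_norm_periodic {h : ℂ → ℂ} (hc : Continuous h)
    (h1 : ∀ t, ‖h (t + 1)‖ = ‖h t‖) (h2 : ∀ t, ‖h (t + τ)‖ = ‖h t‖) :
    Bornology.IsBounded (Set.range h) := by
  have p1 : Function.Periodic (fun t => ‖h t‖) 1 := h1
  have p2 : Function.Periodic (fun t => ‖h t‖) (τ : ℂ) := h2
  have hK : IsCompact ((fun ab : ℝ × ℝ => (ab.1 : ℂ) + ab.2 * τ) ''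
      (Set.Icc 0 1 ×ˢ Set.Icc 0 1)) :=
    (isCompact_Icc.prod isCompact_Icc).image (by fun_prop)
  obtain ⟨C, hC⟩ := hK.exists_bound_of_continuousOn hc.continuousOn
  refine isBounded_iff_forall_norm_le.2 ⟨C, ?_⟩
  rintro _ ⟨t, rfl⟩
  have him : τ.im ≠ 0 := τ.im_pos.ne'
  set b : ℝ := t.im / τ.im with hb
  set a : ℝ := t.re - b * τ.re with ha
  have ht : t = a + b * (τ : ℂ) := by
    apply Complex.ext
    · simp [ha]
    · simp [hb]; field_simp
  have e : ‖h t‖ = ‖h ((Int.fract a : ℝ) + (Int.fract b : ℝ) * (τ : ℂ))‖ := by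
    have e1 := p1.int_mul ⌊a⌋ (((Int.fract a : ℝ) : ℂ) + b * (τ : ℂ))
    have e2 := p2.int_mul ⌊b⌋ (((Int.fract a : ℝ) : ℂ) + (Int.fract b : ℝ) * (τ : ℂ))
    rw [← e2, ht, show ((Int.fract a : ℝ) : ℂ) + (Int.fract b : ℝ) * (τ : ℂ) + ⌊b⌋ * (τ : ℂ) =
      ((Int.fract a : ℝ) : ℂ) + ((Int.fract b + ⌊b⌋ : ℝ) : ℂ) * τ by push_cast; ring,
      Int.fract_add_floor, ← e1]
    congr 2
    have := Int.fract_add_floor a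
    calc (a : ℂ) + b * τ = ((Int.fract a + ⌊a⌋ : ℝ) : ℂ) + b * τ := by rw [this]
      _ = _ := by push_cast; ring
  rw [e]
  exact hC _ ⟨(Int.fract a, Int.fract b), ⟨⟨Int.fract_nonneg a, (Int.fract_lt_one a).le⟩,
    ⟨Int.fract_nonneg b, (Int.fract_lt_one b).le⟩⟩, rfl⟩

/-- An entire function which is `1`-periodic and is multiplied by `e^{-2πix}`, `x ∉ Λ_τ`, under
translation by `τ` vanishes. -/
theorem eq_zero_of_quasiPeriodic {g : ℂ → ℂ} (hg : Differentiable ℂ g) {x : ℂ}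
    (hx : x ∉ lattice τ) (h1 : ∀ t, g (t + 1) = g t)
    (h2 : ∀ t, g (t + τ) = cexp (-(2 * Real.pi * I * x)) * g t) (t : ℂ) : g t = 0 := by
  have him : τ.im ≠ 0 := τ.im_pos.ne'
  -- Because ν is real, e^{iνt} keeps its modulus under t ↦ t + 1; this value of ν makes its growth
  -- under t ↦ t + τ cancel |e^{-2πix}|. The product with g is therefore bounded, hence constant.
  set ν : ℝ := 2 * Real.pi * x.im / τ.im with hν
  have hd : Differentiable ℂ fun t => g t * cexp (ν * I * t) := by fun_prop
  have hb := isBounded_range_of_norm_periodic (τ := τ) hd.continuous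
    (fun t => by
      rw [h1, mul_add, Complex.exp_add, norm_mul, norm_mul, norm_mul, mul_one,
        Complex.norm_exp_ofReal_mul_I, mul_one])
    (fun t => by
      have : ‖cexp (-(2 * Real.pi * I * x))‖ * ‖cexp (ν * I * τ)‖ = 1 := by
        rw [Complex.norm_exp, Complex.norm_exp, ← Real.exp_add, Real.exp_eq_one_iff]
        simp [hν]
        field_simp
        ring
      rw [h2, mul_add, Complex.exp_add, norm_mul, norm_mul, norm_mul, norm_mul]
      linear_combination (‖g t‖ * ‖cexp (ν * I * t)‖) * this)
  have hconst : ∀ s, g s * cexp (ν * I * s) = g t * cexp (ν * I * t) :=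
    fun s => hd.apply_eq_apply_of_bounded hb s t
  -- If the constant is not 0, both multipliers of the product equal 1. This gives ν = 2πn and then
  -- x = -m + nτ, against x ∉ Λ_τ.
  by_contra hne
  have hc : ∀ s, g s ≠ 0 := by
    intro s hs
    have := hconst s
    rw [hs, zero_mul] at this
    exact mul_ne_zero hne (Complex.exp_ne_zero _) this.symm
  have e1 : cexp (ν * I) = 1 := by
    have := (hconst (t + 1))
    rw [h1, mul_add, Complex.exp_add, mul_one] at this
    have h3 := mul_ne_zero (hc t) (Complex.exp_ne_zero (ν * I * t))
    apply mul_left_cancel₀ h3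
    linear_combination this
  have e2 : cexp (-(2 * Real.pi * I * x) + ν * I * τ) = 1 := by
    have := (hconst (t + τ))
    rw [h2, mul_add, Complex.exp_add] at this
    have h3 := mul_ne_zero (hc t) (Complex.exp_ne_zero (ν * I * t))
    rw [Complex.exp_add]
    apply mul_left_cancel₀ h3
    linear_combination this
  rw [Complex.exp_eq_one_iff] at e1 e2
  obtain ⟨n, hn⟩ := e1
  obtain ⟨m, hm⟩ := e2
  refine hx ⟨-m, n, ?_⟩
  have h0 : (2 * Real.pi * I : ℂ) ≠ 0 := by simp [Real.pi_ne_zero]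
  apply mul_left_cancel₀ h0
  push_cast
  linear_combination -hm + τ * hn

/-! ### Chains of roots in rank two -/

/-- The combinatorics of a sequence of roots `α₀, α₁, …` with `α_{k+2} = s_{α_{k+1}} α_k`, of period
`N`: `p` and `q` are the Cartan integers, and `α_k = u_k α₀ + v_k α₁`,
`α_k^∨ = u'_k α₀^∨ + v'_k α₁^∨`. -/
structure RootChain (N : ℕ) where
  (p q u v u' v' : ℕ → ℤ)
  even : Even N
  q_succ : ∀ k, q (k + 1) = -p k
  u_zero : u 0 = 1
  u_one : u 1 = 0
  v_zero : v 0 = 0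
  v_one : v 1 = 1
  u_add_two : ∀ k, u (k + 2) = u k - p k * u (k + 1)
  v_add_two : ∀ k, v (k + 2) = v k - p k * v (k + 1)
  u_period : ∀ k, u (k + N) = u k
  v_period : ∀ k, v (k + N) = v k
  u'_zero : u' 0 = 1
  u'_one : u' 1 = 0
  v'_zero : v' 0 = 0
  v'_one : v' 1 = 1
  u'_add_two : ∀ k, u' (k + 2) = u' k - q k * u' (k + 1)
  v'_add_two : ∀ k, v' (k + 2) = v' k - q k * v' (k + 1)
  u'_period : ∀ k, u' (k + N) = u' k
  v'_period : ∀ k, v' (k + N) = v' k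

theorem sum_range_shift {M : Type*} [AddCommGroup M] {N : ℕ} {f : ℕ → M} (h : f N = f 0) :
    ∑ k ∈ Finset.range N, f (k + 1) = ∑ k ∈ Finset.range N, f k := by
  have h1 := Finset.sum_range_succ f N
  rw [Finset.sum_range_succ', h] at h1
  exact add_right_cancel h1

namespace RootChain

variable {N : ℕ} (c : RootChain N)

theorem eq_of_add_two {R : Type*} [AddCommGroup R] {a : ℕ → R}
    (ha : ∀ k, a (k + 2) = a k - c.p k • a (k + 1)) (k : ℕ) :
    a k = c.u k • a 0 + c.v k • a 1 := by
  induction k using Nat.twoStepInduction with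
  | zero => simp [c.u_zero, c.v_zero]
  | one => simp [c.u_one, c.v_one]
  | more k h1 h2 =>
    rw [ha, c.u_add_two, c.v_add_two]
    conv_lhs => rw [h1, h2]
    module

theorem eq_of_add_two' {R : Type*} [AddCommGroup R] {a : ℕ → R}
    (ha : ∀ k, a (k + 2) = a k - c.q k • a (k + 1)) (k : ℕ) :
    a k = c.u' k • a 0 + c.v' k • a 1 := by
  induction k using Nat.twoStepInduction with
  | zero => simp [c.u'_zero, c.v'_zero]
  | one => simp [c.u'_one, c.v'_one]
  | more k h1 h2 =>
    rw [ha, c.u'_add_two, c.v'_add_two]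
    conv_lhs => rw [h1, h2]
    module

theorem period {R : Type*} [AddCommGroup R] {a : ℕ → R}
    (ha : ∀ k, a (k + 2) = a k - c.p k • a (k + 1)) (k : ℕ) : a (k + N) = a k := by
  rw [c.eq_of_add_two ha, c.eq_of_add_two ha k, c.u_period, c.v_period]

theorem period' {R : Type*} [AddCommGroup R] {a : ℕ → R}
    (ha : ∀ k, a (k + 2) = a k - c.q k • a (k + 1)) (k : ℕ) : a (k + N) = a k := by
  rw [c.eq_of_add_two' ha, c.eq_of_add_two' ha k, c.u'_period, c.v'_period]

/-- Each step of the recursion has determinant -1, so two consecutive members of the chain generate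
the same lattice as the first two. -/
theorem det (k : ℕ) : c.u k * c.v (k + 1) - c.u (k + 1) * c.v k = (-1) ^ k := by
  induction k with
  | zero => simp [c.u_zero, c.v_zero, c.u_one, c.v_one]
  | succ k ih =>
    rw [c.u_add_two, c.v_add_two, pow_succ, ← ih]
    ring

theorem neg_one_pow_add (c : RootChain N) (k : ℕ) : (-1 : ℂ) ^ (k + N) = (-1) ^ k := by
  rw [pow_add, c.even.neg_one_pow, mul_one]

/-- By `det`, ±a_0 is the integral combination v_{k+1}a_k - v_k a_{k+1}. Two consecutive a's in Λ_τ
would put a_0 there too, so the poles of the two factors of a term never meet. -/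
theorem theta_ne_zero_or {a0 : ℂ} (ha0 : theta τ a0 ≠ 0) (t : ℂ) (k : ℕ)
    (h : theta τ (c.u k * a0 + c.v k * t) = 0) :
    theta τ (c.u (k + 1) * a0 + c.v (k + 1) * t) ≠ 0 := by
  intro h'
  rw [theta_eq_zero_iff] at h h'
  apply ha0
  rw [theta_eq_zero_iff]
  have h1 := lattice_add τ (lattice_int_mul τ (c.v (k + 1)) h) (lattice_int_mul τ (-c.v k) h')
  have h2 := lattice_int_mul τ ((-1) ^ k) h1
  have hdet : (c.u k * c.v (k + 1) - c.u (k + 1) * c.v k : ℂ) = (-1) ^ k := by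
    exact_mod_cast c.det k
  have h3 : ((-1 : ℂ) ^ k) * (-1) ^ k = 1 := by rw [← mul_pow]; simp
  convert h2 using 1
  push_cast
  linear_combination (-a0) * h3 - ((-1) ^ k * a0) * hdet

/-- If v_k = 0, then `det` gives u_k = ±1 and a_k = ±a_0, which is not a zero. Hence a_k really
depends on t at its zeros, and the corresponding poles are simple. -/
theorem v_ne_zero {a0 : ℂ} (ha0 : theta τ a0 ≠ 0) (t : ℂ) (k : ℕ)
    (h : theta τ (c.u k * a0 + c.v k * t) = 0) : c.v k ≠ 0 := by
  intro hv
  have hdet := c.det k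
  rw [hv, mul_zero, sub_zero] at hdet
  rw [hv, Int.cast_zero, zero_mul, add_zero, theta_eq_zero_iff] at h
  apply ha0
  rw [theta_eq_zero_iff]
  have h1 := lattice_int_mul τ ((-1) ^ k * c.v (k + 1)) h
  have h3 : ((-1 : ℂ) ^ k) * (-1) ^ k = 1 := by rw [← mul_pow]; simp
  have hdet' : (c.u k * c.v (k + 1) : ℂ) = (-1) ^ k := by exact_mod_cast hdet
  convert h1 using 1
  push_cast
  linear_combination (-a0) * h3 - ((-1) ^ k * a0) * hdet'

theorem analyticAt_kron_comp {a : ℂ → ℂ} {t : ℂ} (ha : AnalyticAt ℂ a t) (x : ℂ)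
    (hx : theta τ x ≠ 0) (h : theta τ (a t) ≠ 0) : AnalyticAt ℂ (fun s => kron τ (a s) x) t := by
  have h1 : AnalyticAt ℂ (fun s => theta τ (a s + x)) t :=
    (analyticAt_theta τ _).fun_comp_of_eq (ha.add analyticAt_const) rfl
  have h2 : AnalyticAt ℂ (fun s => theta τ (a s)) t :=
    (analyticAt_theta τ _).fun_comp_of_eq ha rfl
  exact h1.div (h2.mul analyticAt_const) (mul_ne_zero h hx)

/-! ### The elliptic identity for a chain -/

variable {x : ℕ → ℂ} (a0 : ℂ)

/-- A summand of the elliptic identity attached to a chain of roots. -/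
noncomputable def ellTerm (τ : ℍ) (x : ℕ → ℂ) (k : ℕ) (t : ℂ) : ℂ :=
  (-1) ^ k * (kron τ (c.u (k + 1) * a0 + c.v (k + 1) * t) (x (k + 1)) *
    kron τ (c.u k * a0 + c.v k * t) (x (k + 2)))

theorem analyticAt_ellTerm (hθ : ∀ k, theta τ (x k) ≠ 0) {k : ℕ} {t : ℂ}
    (h : theta τ (c.u k * a0 + c.v k * t) ≠ 0)
    (h' : theta τ (c.u (k + 1) * a0 + c.v (k + 1) * t) ≠ 0) :
    AnalyticAt ℂ (c.ellTerm a0 τ x k) t := by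
  have ha : ∀ k, AnalyticAt ℂ (fun t => c.u k * a0 + c.v k * t) t := fun k => by fun_prop
  exact analyticAt_const.mul ((analyticAt_kron_comp (ha _) _ (hθ _) h').mul
    (analyticAt_kron_comp (ha _) _ (hθ _) h))

theorem ellTerm_period (hx : ∀ k, x (k + 2) = x k - c.q k • x (k + 1)) (k : ℕ) (t : ℂ) :
    c.ellTerm a0 τ x (k + N) t = c.ellTerm a0 τ x k t := by
  rw [ellTerm, ellTerm, c.neg_one_pow_add, c.u_period, c.v_period, add_right_comm k N 1,
    add_right_comm k N 2, c.u_period, c.v_period, c.period' hx, c.period' hx]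

/-- A zero of θ(a_{k+1}) is a simple pole of exactly the two terms k and k + 1. Their opposite signs
make the residues cancel, as the steps of the two recursions match through q_{k+1} = -p_k. -/
theorem hasAnalyticExt_ellTerm_add (hx : ∀ k, x (k + 2) = x k - c.q k • x (k + 1))
    (hθ : ∀ k, theta τ (x k) ≠ 0) (ha0 : theta τ a0 ≠ 0) {k : ℕ} {t : ℂ}
    (h : theta τ (c.u (k + 1) * a0 + c.v (k + 1) * t) = 0) :
    HasAnalyticExt (fun s => c.ellTerm a0 τ x k s + c.ellTerm a0 τ x (k + 1) s) t := by
  have hk : theta τ (c.u k * a0 + c.v k * t) ≠ 0 := fun h' => c.theta_ne_zero_or ha0 t k h' h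
  have hk2 := c.theta_ne_zero_or ha0 t (k + 1) h
  have hv := c.v_ne_zero ha0 t (k + 1) h
  set a : ℕ → ℂ → ℂ := fun k t => c.u k * a0 + c.v k * t with ha
  have haa : ∀ k, AnalyticAt ℂ (a k) t := fun k => by simp only [ha]; fun_prop
  have h1 : ∀ y : ℂ, AnalyticAt ℂ (fun s => theta τ (a (k + 1) s + y)) t := fun y =>
    (analyticAt_theta τ _).fun_comp_of_eq ((haa _).add analyticAt_const) rfl
  have hD : AnalyticAt ℂ (fun s => theta τ (a (k + 1) s)) t :=
    (analyticAt_theta τ _).fun_comp_of_eq (haa _) rfl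
  have hN : AnalyticAt ℂ (fun s => theta τ (a (k + 1) s + x (k + 1)) / theta τ (x (k + 1)) *
      kron τ (a k s) (x (k + 2)) - theta τ (a (k + 1) s + x (k + 3)) / theta τ (x (k + 3)) *
      kron τ (a (k + 2) s) (x (k + 2))) t :=
    (((h1 _).div analyticAt_const (hθ _)).mul (analyticAt_kron_comp (haa _) _ (hθ _) hk)).sub
      (((h1 _).div analyticAt_const (hθ _)).mul (analyticAt_kron_comp (haa _) _ (hθ _) hk2))
  have hd : deriv (fun s => theta τ (a (k + 1) s)) t ≠ 0 := by
    have e1 : HasDerivAt (a (k + 1)) (c.v (k + 1)) t := by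
      have := ((hasDerivAt_id' t).const_mul (c.v (k + 1) : ℂ)).const_add (c.u (k + 1) * a0 : ℂ)
      rwa [mul_one] at this
    have e2 := (differentiable_theta τ (a (k + 1) t)).hasDerivAt.comp t e1
    rw [show (fun s => theta τ (a (k + 1) s)) = theta τ ∘ a (k + 1) from rfl, e2.deriv]
    refine mul_ne_zero (deriv_theta_lattice_ne_zero τ ((theta_eq_zero_iff τ _).1 h)) ?_
    exact_mod_cast hv
  -- At a_{k+1} = m + nτ, each quotient θ(a_{k+1} + x_j)/θ(x_j) is C e^{-2πinx_j}. Moving from a_k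
  -- to a_{k+2} = a_k - p_k(m + nτ) multiplies F by e^{2πinp_k x_{k+2}}, which is compensated by
  -- x_{k+3} = x_{k+1} + p_k x_{k+2}.
  have hN0 : theta τ (a (k + 1) t + x (k + 1)) / theta τ (x (k + 1)) *
      kron τ (a k t) (x (k + 2)) - theta τ (a (k + 1) t + x (k + 3)) / theta τ (x (k + 3)) *
      kron τ (a (k + 2) t) (x (k + 2)) = 0 := by
    obtain ⟨m, n, hmn⟩ := (theta_eq_zero_iff τ _).1 h
    obtain ⟨C, hC, hCz⟩ := exists_theta_add_lattice τ m n
    have e1 : a (k + 2) t = a k t + (((-c.p k * m : ℤ) : ℂ) + ((-c.p k * n : ℤ) : ℂ) * τ) := by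
      simp only [ha]
      rw [c.u_add_two, c.v_add_two]
      push_cast
      linear_combination (-(c.p k : ℂ)) * hmn
    have e2 : x (k + 3) = x (k + 1) + c.p k * x (k + 2) := by
      rw [hx (k + 1), c.q_succ]; simp
    have e3 : ∀ j, theta τ (a (k + 1) t + x j) / theta τ (x j) =
        C * cexp (-(2 * Real.pi * I * n * x j)) := by
      intro j
      rw [show a (k + 1) t = m + n * τ from hmn, add_comm, hCz, mul_div_assoc, div_self (hθ j),
        mul_one]
    have e4 : cexp (-(2 * Real.pi * I * n * x (k + 1))) = cexp (-(2 * Real.pi * I * n * x (k + 3))) *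
        cexp (-(2 * Real.pi * I * ((-c.p k * n : ℤ) : ℂ)) * x (k + 2)) := by
      rw [← Complex.exp_add, e2]
      congr 1
      push_cast
      ring
    rw [e3, e3, e1, kron_add_lattice, e4]
    ring
  obtain ⟨g, hg, hfg⟩ :=
    (HasAnalyticExt.div_of_simple_zero hN hD hN0 h hd).const_mul ((-1) ^ k)
  refine ⟨g, hg, EventuallyEq.trans (Eventually.of_forall fun s => ?_) hfg⟩
  simp only [ellTerm, kron, pow_succ, ha, div_eq_mul_inv, mul_inv]
  ring

theorem sum_ellTerm (hx : ∀ k, x (k + 2) = x k - c.q k • x (k + 1))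
    (hθ : ∀ k, theta τ (x k) ≠ 0) (ha0 : theta τ a0 ≠ 0) {t : ℂ}
    (h : ∀ k, theta τ (c.u k * a0 + c.v k * t) ≠ 0) :
    ∑ k ∈ Finset.range N, c.ellTerm a0 τ x k t = 0 := by
  classical
  set f : ℂ → ℂ := fun t => ∑ k ∈ Finset.range N, c.ellTerm a0 τ x k t with hf
  have hext : ∀ t, HasAnalyticExt f t := by
    intro t
    set bad : ℕ → Prop := fun k => theta τ (c.u k * a0 + c.v k * t) = 0 with hbad
    -- The sum is cyclic, so a term whose second factor has its pole at t can be moved next to its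
    -- predecessor, whose first factor has the same pole. What is left over is regular at t.
    have hsplit : ∀ s, f s = ∑ k ∈ Finset.range N,
        (((if bad (k + 1) then c.ellTerm a0 τ x k s + c.ellTerm a0 τ x (k + 1) s else 0) : ℂ) +
          if bad k ∨ bad (k + 1) then 0 else c.ellTerm a0 τ x k s) := by
      intro s
      have e1 : ∑ k ∈ Finset.range N, (if bad k then c.ellTerm a0 τ x k s else 0) =
          ∑ k ∈ Finset.range N, (if bad (k + 1) then c.ellTerm a0 τ x (k + 1) s else 0) := by
        rw [sum_range_shift (f := fun k => if bad k then c.ellTerm a0 τ x k s else 0)]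
        have e2 := c.ellTerm_period (τ := τ) a0 hx 0 s
        have e3 : bad N = bad 0 := by
          have hu := c.u_period 0
          have hv := c.v_period 0
          rw [zero_add] at hu hv
          simp only [hbad, hu, hv]
        rw [zero_add] at e2
        simp only [e2, e3]
      have e4 : ∀ k, c.ellTerm a0 τ x k s = (if bad k then c.ellTerm a0 τ x k s else 0) +
          ((if bad (k + 1) then c.ellTerm a0 τ x k s else 0) +
            if bad k ∨ bad (k + 1) then 0 else c.ellTerm a0 τ x k s) := by
        intro k
        by_cases h1 : bad k
        · have h2 : ¬ bad (k + 1) := c.theta_ne_zero_or ha0 t k h1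
          simp [h1, h2]
        · by_cases h2 : bad (k + 1) <;> simp [h1, h2]
      rw [hf]
      dsimp only
      rw [Finset.sum_congr rfl fun k _ => e4 k, Finset.sum_add_distrib, e1,
        ← Finset.sum_add_distrib]
      refine Finset.sum_congr rfl fun k _ => ?_
      split_ifs <;> ring
    rw [funext hsplit]
    refine HasAnalyticExt.sum _ fun k _ => HasAnalyticExt.add ?_ ?_
    · by_cases h1 : bad (k + 1)
      · simpa only [h1, if_true] using c.hasAnalyticExt_ellTerm_add a0 hx hθ ha0 h1
      · simpa only [h1, if_false] using hasAnalyticExt_of_analyticAt analyticAt_const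
    · by_cases h1 : bad k ∨ bad (k + 1)
      · simpa only [h1, if_true] using hasAnalyticExt_of_analyticAt analyticAt_const
      · simp only [h1, if_false]
        push Not at h1
        exact hasAnalyticExt_of_analyticAt (c.analyticAt_ellTerm a0 hθ h1.1 h1.2)
  have hf1 : ∀ t, f (t + 1) = f t := by
    intro t
    refine Finset.sum_congr rfl fun k _ => ?_
    have e : ∀ k y, kron τ (c.u k * a0 + c.v k * (t + 1)) y =
        kron τ (c.u k * a0 + c.v k * t) y := by
      intro k y
      have := kron_add_lattice τ (c.v k) 0 (c.u k * a0 + c.v k * t) y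
      simp only [Int.cast_zero, zero_mul, mul_zero, add_zero, neg_zero, Complex.exp_zero,
        one_mul] at this
      rw [← this]
      ring_nf
    simp only [ellTerm, e]
  have hfτ : ∀ t, f (t + τ) = cexp (-(2 * Real.pi * I * x 1)) * f t := by
    intro t
    rw [hf, Finset.mul_sum]
    refine Finset.sum_congr rfl fun k _ => ?_
    have e : ∀ k y, kron τ (c.u k * a0 + c.v k * (t + τ)) y =
        cexp (-(2 * Real.pi * I * c.v k) * y) * kron τ (c.u k * a0 + c.v k * t) y := by
      intro k y
      rw [← kron_add_lattice τ 0 (c.v k) (c.u k * a0 + c.v k * t) y]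
      push_cast
      ring_nf
    -- This combination of x's is the same for every k, so all terms have the same multiplier
    -- e^{-2πix_1} under t ↦ t + τ.
    have hM : ∀ k, (c.v (k + 1) : ℂ) * x (k + 1) + c.v k * x (k + 2) = x 1 := by
      intro k
      induction k with
      | zero => simp [c.v_one, c.v_zero]
      | succ k ih =>
        rw [← ih, c.v_add_two, hx (k + 1), c.q_succ]
        push_cast
        simp only [neg_smul, zsmul_eq_mul]
        ring
    simp only [ellTerm, e]
    rw [show -(2 * Real.pi * I * x 1) = -(2 * Real.pi * I * c.v (k + 1)) * x (k + 1) +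
      -(2 * Real.pi * I * c.v k) * x (k + 2) by rw [← hM k]; ring, Complex.exp_add]
    ring
  obtain ⟨g, hg, hfg⟩ := exists_differentiable_of_hasAnalyticExt hext
  have htr : ∀ r t : ℂ, Tendsto (fun s => s + r) (𝓝[≠] t) (𝓝[≠] (t + r)) := by
    intro r t
    refine tendsto_nhdsWithin_iff.2 ⟨?_, ?_⟩
    · exact ((continuous_id.add continuous_const).tendsto t).mono_left nhdsWithin_le_nhds
    · filter_upwards [self_mem_nhdsWithin] with s hs h
      exact hs (add_right_cancel h)
  have hg1 : ∀ t, g (t + 1) = g t := fun t => by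
    refine eq_of_eventuallyEq_nhdsNE (f := fun s => g (s + 1))
      (hg.continuous.comp (continuous_id.add continuous_const)).continuousAt
      hg.continuous.continuousAt ?_
    filter_upwards [hfg t, (htr 1 t).eventually (hfg (t + 1))] with s h1 h2
    rw [← h1, ← h2, hf1]
  have hgτ : ∀ t, g (t + τ) = cexp (-(2 * Real.pi * I * x 1)) * g t := fun t => by
    refine eq_of_eventuallyEq_nhdsNE (f := fun s => g (s + τ))
      (g := fun s => cexp (-(2 * Real.pi * I * x 1)) * g s)
      (hg.continuous.comp (continuous_id.add continuous_const)).continuousAt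
      (continuous_const.mul hg.continuous).continuousAt ?_
    filter_upwards [hfg t, (htr τ t).eventually (hfg (t + τ))] with s h1 h2
    rw [← h1, ← h2, hfτ]
  have hfc : ContinuousAt f t :=
    (Finset.analyticAt_fun_sum _ fun k _ =>
      c.analyticAt_ellTerm a0 hθ (h k) (h (k + 1))).continuousAt
  have hx1 : x 1 ∉ lattice τ := fun h => hθ 1 ((theta_eq_zero_iff τ _).2 h)
  exact (eq_of_eventuallyEq_nhdsNE hfc hg.continuous.continuousAt (hfg t)).trans
    (eq_zero_of_quasiPeriodic hg hx1 hg1 hgτ t)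

end RootChain

end KZB

namespace KZB

open Complex Filter Topology
open Finset.HasAntidiagonal (antidiagonal)

variable {τ : ℍ}

/-! ### Passage from F to the Taylor coefficients of k -/

namespace RootChain

variable {N : ℕ} (c : RootChain N)

/-- A second solution y of the recursion, with Wronskian y_k x_{k+1} - y_{k+1} x_k = (-1)^k, turns
each summand into y_k/x_k - y_{k+1}/x_{k+1}. The sum then telescopes over a period. -/
theorem sum_one_div_mul {x : ℕ → ℂ} (hx : ∀ k, x (k + 2) = x k - c.q k • x (k + 1))
    (h0 : ∀ k, x k ≠ 0) : ∑ k ∈ Finset.range N, (-1) ^ k * (1 / (x k * x (k + 1))) = 0 := by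
  set y : ℕ → ℂ := fun k => c.v' k * (-(x 0)⁻¹) with hy
  have hy2 : ∀ k, y (k + 2) = y k - c.q k • y (k + 1) := by
    intro k
    simp only [hy, c.v'_add_two, zsmul_eq_mul]
    push_cast
    ring
  have hw : ∀ k, y k * x (k + 1) - y (k + 1) * x k = (-1) ^ k := by
    intro k
    induction k with
    | zero => simp [hy, c.v'_zero, c.v'_one, h0]
    | succ k ih =>
      rw [hy2, hx, pow_succ, ← ih]
      simp only [zsmul_eq_mul]
      ring
  have h1 : ∀ k, (-1) ^ k * (1 / (x k * x (k + 1))) = y k / x k - y (k + 1) / x (k + 1) := by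
    intro k
    rw [← hw k, div_sub_div _ _ (h0 k) (h0 (k + 1)), mul_one_div]
    ring
  rw [Finset.sum_congr rfl fun k _ => h1 k, Finset.sum_sub_distrib,
    sum_range_shift (f := fun k => y k / x k), sub_self]
  have e1 := c.period' hx 0
  have e2 := c.period' hy2 0
  rw [zero_add] at e1 e2
  simp only [e1, e2]

/-- Substituting k = F - 1/x produces three sums that vanish separately: the elliptic identity in
FF, a telescoping sum of terms linear in F, and the rational sum of `sum_one_div_mul`. -/
theorem sum_kFun {a x : ℕ → ℂ} (ha : ∀ k, a (k + 2) = a k - c.p k • a (k + 1))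
    (haθ : ∀ k, theta τ (a k) ≠ 0)
    (hx : ∀ k, x (k + 2) = x k - c.q k • x (k + 1)) (hθ : ∀ k, theta τ (x k) ≠ 0) :
    ∑ k ∈ Finset.range N, (-1) ^ k *
      ((kFun τ (a k) (x k) - kFun τ (a k) (x (k + 2))) / x (k + 1) -
        kFun τ (a (k + 1)) (x (k + 1)) * kFun τ (a k) (x (k + 2))) = 0 := by
  have h0 : ∀ k, x k ≠ 0 := fun k h => hθ k (by rw [h, theta_zero])
  have ha' : ∀ k, (c.u k : ℂ) * a 0 + c.v k * a 1 = a k := fun k => by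
    rw [c.eq_of_add_two ha k]; simp only [zsmul_eq_mul]
  have h1 := c.sum_ellTerm (a 0) hx hθ (haθ 0) (t := a 1) fun k => by rw [ha']; exact haθ k
  have h2 := c.sum_one_div_mul hx h0
  -- The terms linear in F combine to (-1)^k (G_k + G_{k+1}), which telescopes because the period is
  -- even.
  set G : ℕ → ℂ := fun k => kron τ (a k) (x k) / x (k + 1) with hG
  have h3 : ∑ k ∈ Finset.range N, ((-1) ^ k * G k + (-1) ^ k * G (k + 1)) = 0 := by
    have e : ∑ k ∈ Finset.range N, (-1) ^ (k + 1) * G (k + 1) =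
        ∑ k ∈ Finset.range N, (-1) ^ k * G k := by
      refine sum_range_shift (f := fun k => (-1) ^ k * G k) ?_
      have e1 := c.period' hx 0
      have e2 := c.period ha 0
      have e3 := c.period' hx 1
      rw [zero_add] at e1 e2
      rw [add_comm] at e3
      simp only [hG, e1, e2, e3, c.even.neg_one_pow, pow_zero]
    rw [Finset.sum_add_distrib, ← e, ← Finset.sum_add_distrib]
    exact Finset.sum_eq_zero fun k _ => by rw [pow_succ]; ring
  have h4 : ∀ k, (-1) ^ k *
      ((kFun τ (a k) (x k) - kFun τ (a k) (x (k + 2))) / x (k + 1) -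
        kFun τ (a (k + 1)) (x (k + 1)) * kFun τ (a k) (x (k + 2))) =
      ((-1) ^ k * G k + (-1) ^ k * G (k + 1)) - (-1) ^ k * (1 / (x k * x (k + 1))) -
        c.ellTerm (a 0) τ x k (a 1) := by
    intro k
    rw [ellTerm, ha', ha', kFun_of_ne _ (h0 k), kFun_of_ne _ (h0 (k + 1)),
      kFun_of_ne _ (h0 (k + 2))]
    simp only [hG]
    have e0 := h0 k
    have e1 := h0 (k + 1)
    have e2 := h0 (k + 2)
    generalize kron τ (a k) (x k) = A
    generalize kron τ (a k) (x (k + 2)) = B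
    generalize kron τ (a (k + 1)) (x (k + 1)) = D
    field_simp
    ring
  rw [Finset.sum_congr rfl fun k _ => h4 k, Finset.sum_sub_distrib, Finset.sum_sub_distrib, h1, h2,
    h3]
  ring

theorem eventually_theta_ne_zero {X : ℂ} (hX : X ≠ 0) : ∀ᶠ s in 𝓝[≠] 0, theta τ (s * X) ≠ 0 := by
  have h : ∀ᶠ x in 𝓝 (0 : ℂ), thetaQuot τ x ≠ 0 :=
    (differentiable_thetaQuot τ).continuous.continuousAt.eventually_ne (by simp [thetaQuot_zero])
  have ht : Tendsto (fun s : ℂ => s * X) (𝓝[≠] 0) (𝓝 0) := by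
    have : Tendsto (fun s : ℂ => s * X) (𝓝 0) (𝓝 (0 * X)) :=
      (continuous_id.mul continuous_const).tendsto 0
    rw [zero_mul] at this
    exact this.mono_left nhdsWithin_le_nhds
  filter_upwards [ht.eventually h, self_mem_nhdsWithin] with s hs hs0
  rw [← mul_thetaQuot]
  exact mul_ne_zero (mul_ne_zero hs0 hX) hs

/-- Put x_k = sX_k in `sum_kFun` and compare coefficients in s. -/
theorem sum_kCoeff_div {a X : ℕ → ℂ} (ha : ∀ k, a (k + 2) = a k - c.p k • a (k + 1))
    (haθ : ∀ k, theta τ (a k) ≠ 0)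
    (hX : ∀ k, X (k + 2) = X k - c.q k • X (k + 1)) (h0 : ∀ k, X k ≠ 0) (n : ℕ) :
    ∑ k ∈ Finset.range N, (-1) ^ k *
      (kCoeff τ (a k) (n + 1) * ((X k ^ (n + 1) - X (k + 2) ^ (n + 1)) / X (k + 1)) -
        ∑ p ∈ antidiagonal n, (kCoeff τ (a (k + 1)) p.1 * kCoeff τ (a k) p.2) *
          (X (k + 1) ^ p.1 * X (k + 2) ^ p.2)) = 0 := by
  rcases Nat.eq_zero_or_pos N with hN | hN
  · subst hN; simp
  -- The identity is multiplied by s, which makes it analytic at s = 0; this is why the coefficient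
  -- of index n + 1 is the one compared.
  set g : ℂ → ℂ := fun s => ∑ k ∈ Finset.range N, (-1) ^ k *
      ((X (k + 1))⁻¹ * (kFun τ (a k) (X k * s) - kFun τ (a k) (X (k + 2) * s)) -
        s * (kFun τ (a (k + 1)) (X (k + 1) * s) * kFun τ (a k) (X (k + 2) * s))) with hg
  have hK : ∀ k j, AnalyticAt ℂ (fun s => kFun τ (a k) (X j * s)) 0 := fun k j =>
    AnalyticAt.fun_comp_of_eq (analyticAt_kFun (haθ k)) (by fun_prop) (by simp)
  have hT1 : ∀ k, AnalyticAt ℂ (fun s => (X (k + 1))⁻¹ *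
      (kFun τ (a k) (X k * s) - kFun τ (a k) (X (k + 2) * s))) 0 := fun k =>
    analyticAt_const.fun_mul ((hK _ _).fun_sub (hK _ _))
  have hT2 : ∀ k, AnalyticAt ℂ (fun s =>
      kFun τ (a (k + 1)) (X (k + 1) * s) * kFun τ (a k) (X (k + 2) * s)) 0 := fun k =>
    (hK _ _).fun_mul (hK _ _)
  have hT3 : ∀ k, AnalyticAt ℂ (fun s => s *
      (kFun τ (a (k + 1)) (X (k + 1) * s) * kFun τ (a k) (X (k + 2) * s))) 0 := fun k =>
    analyticAt_id.fun_mul (hT2 k)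
  have hga : AnalyticAt ℂ g 0 := Finset.analyticAt_fun_sum _ fun k _ =>
    analyticAt_const.fun_mul ((hT1 k).fun_sub (hT3 k))
  have hg0 : ∀ᶠ s in 𝓝[≠] 0, g s = 0 := by
    have h1 : ∀ᶠ s in 𝓝[≠] 0, ∀ k ∈ Finset.range N, theta τ (s * X k) ≠ 0 :=
      (eventually_all_finset _).2 fun k _ => eventually_theta_ne_zero (h0 k)
    filter_upwards [h1, self_mem_nhdsWithin] with s hs hs0
    set x : ℕ → ℂ := fun k => s * X k with hx
    have hx2 : ∀ k, x (k + 2) = x k - c.q k • x (k + 1) := by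
      intro k
      simp only [hx, hX, zsmul_eq_mul]
      ring
    have hθ : ∀ k, theta τ (x k) ≠ 0 := by
      intro k
      have hp : Function.Periodic x N := c.period' hx2
      rw [← hp.map_mod_nat]
      exact hs _ (Finset.mem_range.2 (Nat.mod_lt _ hN))
    have := c.sum_kFun ha haθ hx2 hθ
    have h2 : g s = s * ∑ k ∈ Finset.range N, (-1) ^ k *
      ((kFun τ (a k) (x k) - kFun τ (a k) (x (k + 2))) / x (k + 1) -
        kFun τ (a (k + 1)) (x (k + 1)) * kFun τ (a k) (x (k + 2))) := by
      rw [Finset.mul_sum]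
      refine Finset.sum_congr rfl fun k _ => ?_
      have hs0' : s ≠ 0 := hs0
      have := h0 (k + 1)
      simp only [hx, mul_comm s]
      field_simp
    rw [h2, this, mul_zero]
  have hg1 : ∀ᶠ s in 𝓝 0, g s = 0 := hga.frequently_zero_iff_eventually_zero.1 hg0.frequently
  have hg2 : taylorCoeff g (n + 1) = 0 := by
    rw [taylorCoeff_congr (g := fun _ => 0) hg1, taylorCoeff, iteratedDeriv_const]
    simp
  rw [← hg2, taylorCoeff_sum _ fun k _ =>
    analyticAt_const.fun_mul ((hT1 k).fun_sub (hT3 k))]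
  refine Finset.sum_congr rfl fun k _ => ?_
  rw [taylorCoeff_const_mul _ ((hT1 k).fun_sub (hT3 k)), taylorCoeff_sub (hT1 k) (hT3 k),
    taylorCoeff_const_mul _ ((hK _ _).fun_sub (hK _ _)), taylorCoeff_sub (hK _ _) (hK _ _),
    taylorCoeff_id_mul (hT2 k), taylorCoeff_mul (hK _ _) (hK _ _)]
  simp only [taylorCoeff_comp_mul _ (analyticAt_kFun (haθ _)), ← kCoeff_eq_taylorCoeff]
  congr 1
  congr 1
  · ring
  · exact Finset.sum_congr rfl fun p _ => by ring

/-- The identity between the coefficients of `k` attached to a chain of roots. -/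
theorem sum_kCoeff {a : ℕ → ℂ} (ha : ∀ k, a (k + 2) = a k - c.p k • a (k + 1))
    (haθ : ∀ k, theta τ (a k) ≠ 0) {R : Type*} [CommRing R] [Algebra ℂ R] {X : ℕ → R}
    (hX : ∀ k, X (k + 2) = X k - c.q k • X (k + 1)) (n : ℕ) :
    ∑ k ∈ Finset.range N, (-1 : ℂ) ^ k •
      ((kCoeff τ (a k) (n + 1) * c.q k) • (∑ p ∈ antidiagonal n, X k ^ p.1 * X (k + 2) ^ p.2) -
        ∑ p ∈ antidiagonal n, (kCoeff τ (a (k + 1)) p.1 * kCoeff τ (a k) p.2) •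
          (X (k + 1) ^ p.1 * X (k + 2) ^ p.2)) = 0 := by
  -- The identity is proved for the universal solution of the recursion, with two indeterminates as
  -- initial values, and then specialised. In R the elements X_k may be zero divisors, and no
  -- division by them is available.
  set Y : ℕ → MvPolynomial (Fin 2) ℂ := fun k =>
    c.u' k • MvPolynomial.X 0 + c.v' k • MvPolynomial.X 1 with hY
  have hY2 : ∀ k, Y (k + 2) = Y k - c.q k • Y (k + 1) := by
    intro k
    simp only [hY, c.u'_add_two, c.v'_add_two]
    module
  have hY0 : ∀ k, Y k ≠ 0 := by
    intro k h
    have hdet : ∀ k, c.u' k * c.v' (k + 1) - c.u' (k + 1) * c.v' k = (-1) ^ k := by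
      intro k
      induction k with
      | zero => simp [c.u'_zero, c.v'_zero, c.u'_one, c.v'_one]
      | succ k ih =>
        rw [c.u'_add_two, c.v'_add_two, pow_succ, ← ih]
        ring
    have e1 := congrArg (MvPolynomial.eval ![1, 0]) h
    have e2 := congrArg (MvPolynomial.eval ![0, 1]) h
    simp [hY] at e1 e2
    have := hdet k
    rw [e1, e2, zero_mul, mul_zero, sub_zero] at this
    exact pow_ne_zero k (by norm_num) this.symm
  have key : ∑ k ∈ Finset.range N, (-1 : ℂ) ^ k •
      ((kCoeff τ (a k) (n + 1) * c.q k) • (∑ p ∈ antidiagonal n, Y k ^ p.1 * Y (k + 2) ^ p.2) -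
        ∑ p ∈ antidiagonal n, (kCoeff τ (a (k + 1)) p.1 * kCoeff τ (a k) p.2) •
          (Y (k + 1) ^ p.1 * Y (k + 2) ^ p.2)) = 0 := by
    -- Multiplication by the product of the Y_k disposes of the points where some Y_k vanishes. At
    -- all other points the identity with denominators applies, since (Z_k^{n+1} -
    -- Z_{k+2}^{n+1})/Z_{k+1} is q_k times a geometric sum.
    refine (mul_eq_zero.1 (?_ : _ * ∏ k ∈ Finset.range N, Y k = 0)).resolve_right
      (Finset.prod_ne_zero_iff.2 fun k _ => hY0 k)
    refine MvPolynomial.funext fun z => ?_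
    set Z : ℕ → ℂ := fun k => MvPolynomial.eval z (Y k) with hZ
    have hZ2 : ∀ k, Z (k + 2) = Z k - c.q k • Z (k + 1) := by
      intro k
      simp only [hZ, hY2, map_sub, map_zsmul]
    rw [map_mul, map_prod, map_zero]
    by_cases hz : ∃ k ∈ Finset.range N, Z k = 0
    · rw [Finset.prod_eq_zero_iff.2 hz, mul_zero]
    · push Not at hz
      rw [mul_eq_zero]
      left
      rcases Nat.eq_zero_or_pos N with hN | hN
      · subst hN; simp
      have h0 : ∀ k, Z k ≠ 0 := fun k => by
        have hp : Function.Periodic Z N := c.period' hZ2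
        rw [← hp.map_mod_nat]
        exact hz _ (Finset.mem_range.2 (Nat.mod_lt _ hN))
      rw [map_sum, ← c.sum_kCoeff_div ha haθ hZ2 h0 n]
      refine Finset.sum_congr rfl fun k _ => ?_
      have e : (Z k ^ (n + 1) - Z (k + 2) ^ (n + 1)) / Z (k + 1) =
          c.q k * ∑ p ∈ antidiagonal n, Z k ^ p.1 * Z (k + 2) ^ p.2 := by
        rw [div_eq_iff (h0 _), Finset.Nat.sum_antidiagonal_eq_sum_range_succ
          (fun i j => Z k ^ i * Z (k + 2) ^ j)]
        have := (Commute.all (Z k) (Z (k + 2))).mul_geom_sum₂ (n + 1)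
        simp only [Nat.add_sub_cancel] at this
        rw [← this, hZ2 k, zsmul_eq_mul]
        ring
      simp only [MvPolynomial.smul_eval, map_sub, map_sum, map_mul, map_pow, e]
      ring
  have h := congrArg (MvPolynomial.aeval ![X 0, X 1]) key
  have hYX : ∀ k, MvPolynomial.aeval ![X 0, X 1] (Y k) = X k := by
    intro k
    rw [c.eq_of_add_two' hX k]
    simp [hY]
  simpa only [map_sum, map_smul, map_sub, map_mul, map_pow, hYX, map_zero] using h

end RootChain

end KZB

namespace KZB

variable {ι V H : Type*} [AddCommGroup V] [Module ℂ V] [AddCommGroup H] [Module ℂ H]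

/-! ### The Weyl group -/

section Weyl

variable (P : RootPairing ι ℂ V H)

theorem smul_pairing (g : P.weylGroup) (v : V) (u : H) :
    P.toLinearMap (g • v) (wAct P g u) = P.toLinearMap v u := by
  have h1 : ∀ (f : P.Aut) (v : V) (x : H),
      P.toLinearMap (f.toHom.weightMap v) x = P.toLinearMap v (f.toHom.coweightMap x) := fun f v x =>
    LinearMap.congr_fun (f.toHom.weight_coweight_transpose_apply P P x) v
  have h2 : (g : P.Aut).toHom.coweightMap (wAct P g u) = u := by
    have : ((g⁻¹ : P.weylGroup) : P.Aut) * (g : P.Aut) = 1 := by simp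
    have h3 := congrArg (fun a : P.Aut => a.toHom.coweightMap u) this
    exact h3
  conv_rhs => rw [← h2]
  exact h1 g v _

theorem wAct_mul (g h : P.weylGroup) (u : H) : wAct P (g * h) u = wAct P g (wAct P h u) := by
  rw [wAct, mul_inv_rev]
  rfl

theorem wAct_ofIdx (i : ι) (u : H) :
    wAct P (RootPairing.weylGroup.ofIdx P i) u = u - P.root' i u • P.coroot i := by
  have : (((RootPairing.weylGroup.ofIdx P i)⁻¹ : P.weylGroup) : P.Aut) =
      RootPairing.Equiv.reflection P i := RootPairing.Equiv.reflection_inv P i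
  rw [wAct, this]
  rfl

theorem ofIdx_smul (i : ι) (v : V) :
    RootPairing.weylGroup.ofIdx P i • v = v - P.coroot' i v • P.root i := rfl

theorem root_perm (g : P.weylGroup) (i : ι) : P.root (P.weylGroupToPerm g i) = g • P.root i :=
  (P.weylGroup_apply_root g i).symm

theorem root'_perm (g : P.weylGroup) (i : ι) (u : H) :
    P.root' (P.weylGroupToPerm g i) (wAct P g u) = P.root' i u := by
  rw [RootPairing.root', root_perm, smul_pairing]

theorem coroot_perm (g : P.weylGroup) (i : ι) :
    P.coroot (P.weylGroupToPerm g i) = wAct P g (P.coroot i) := by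
  rw [wAct, RootPairing.Hom.coroot_coweightMap_apply]
  rfl

theorem perm_ofIdx (i j : ι) :
    P.weylGroupToPerm (RootPairing.weylGroup.ofIdx P i) j = P.reflectionPerm i j := rfl

theorem weylGroup_ext {g h : P.weylGroup} (e : ∀ v : V, g • v = h • v) : g = h := by
  apply Subtype.ext
  apply RootPairing.Equiv.weightHom_injective P
  exact LinearEquiv.ext e

theorem wAct_linear_sub (g : P.weylGroup) (v : V) (i : ι) :
    P.coroot' (P.weylGroupToPerm g i) (g • v) = P.coroot' i v := by
  have := smul_pairing P g v (P.coroot i)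
  rw [← coroot_perm] at this
  exact this

theorem weyl_smul_sub (g : P.weylGroup) (v w : V) : g • (v - w) = g • v - g • w :=
  map_sub ((g : P.Aut).toHom.weightMap) v w

theorem weyl_smul_smul (g : P.weylGroup) (r : ℂ) (v : V) : g • (r • v) = r • g • v :=
  map_smul ((g : P.Aut).toHom.weightMap) r v

/-- The relation g s_α = s_{gα} g, tested on the faithful representation 𝔥*. -/
theorem mul_ofIdx (g : P.weylGroup) (i : ι) :
    g * RootPairing.weylGroup.ofIdx P i =
      RootPairing.weylGroup.ofIdx P (P.weylGroupToPerm g i) * g := by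
  refine weylGroup_ext P fun v => ?_
  rw [mul_smul, mul_smul, ofIdx_smul, ofIdx_smul, weyl_smul_sub, weyl_smul_smul, wAct_linear_sub,
    root_perm]

theorem root_neg (i : ι) : P.root (P.reflectionPerm i i) = -P.root i := by simp

theorem coroot_neg (i : ι) : P.coroot (P.reflectionPerm i i) = -P.coroot i := by simp

theorem root'_neg (i : ι) (u : H) : P.root' (P.reflectionPerm i i) u = -P.root' i u := by
  rw [RootPairing.root', root_neg, map_neg]
  rfl

theorem coroot'_neg (i : ι) (v : V) : P.coroot' (P.reflectionPerm i i) v = -P.coroot' i v := by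
  rw [RootPairing.coroot', coroot_neg, map_neg]
  rfl

theorem ofIdx_neg (i : ι) :
    RootPairing.weylGroup.ofIdx P (P.reflectionPerm i i) = RootPairing.weylGroup.ofIdx P i := by
  refine weylGroup_ext P fun v => ?_
  rw [ofIdx_smul, ofIdx_smul, coroot'_neg, root_neg, neg_smul_neg]

theorem ofIdx_mul_self (i : ι) :
    RootPairing.weylGroup.ofIdx P i * RootPairing.weylGroup.ofIdx P i = 1 := by
  refine weylGroup_ext P fun v => ?_
  rw [mul_smul, one_smul]
  exact P.reflection_same i v

theorem reflOf_neg (i : ι) : reflOf P (P.reflectionPerm i i) = reflOf P i :=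
  Subtype.ext (ofIdx_neg P i)

theorem eq_or_eq_neg_of_ofIdx_eq [P.IsReduced] {i j : ι}
    (h : RootPairing.weylGroup.ofIdx P i = RootPairing.weylGroup.ofIdx P j) :
    i = j ∨ i = P.reflectionPerm j j := by
  by_contra! hne
  have hlin := RootPairing.IsReduced.linearIndependent P hne.1
    (fun h' => hne.2 ((P.root_eq_neg_iff).1 h'))
  have h1 := congrArg (fun g : P.weylGroup => g • P.root i) h
  simp only [ofIdx_smul, RootPairing.root_coroot'_eq_pairing, RootPairing.pairing_same] at h1
  have h2 : (2 : ℂ) • P.root i + (-P.pairing i j) • P.root j = 0 := by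
    rw [neg_smul, ← sub_eq_add_neg, sub_eq_zero]
    exact sub_right_injective h1
  exact two_ne_zero (LinearIndependent.pair_iff.1 hlin _ _ h2).1

theorem reflClass_perm (g : P.weylGroup) (i : ι) :
    reflClass (reflOf P (P.weylGroupToPerm g i)) = reflClass (reflOf P i) := by
  refine Subtype.ext (ConjClasses.mk_eq_mk_iff_isConj.2 (IsConj.symm ?_))
  rw [isConj_iff]
  refine ⟨g, ?_⟩
  change g * RootPairing.weylGroup.ofIdx P i * g⁻¹ = RootPairing.weylGroup.ofIdx P _
  rw [mul_ofIdx, mul_inv_cancel_right]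

theorem reflOf_rootIdx (s : reflections P) : reflOf P (rootIdx s) = s :=
  Subtype.ext s.2.choose_spec

end Weyl

/-! ### Sums over positive roots -/

section Positive

variable {P : RootPairing ι ℂ V H} (b : P.Base)

theorem isPos_neg_iff (i : ι) : b.IsPos (P.reflectionPerm i i) ↔ ¬ b.IsPos i :=
  RootPairing.Base.IsPos.neg_iff_not b i

-- Replaces the positive system, which W does not preserve, by the set of all roots, on which sums
-- can be relabelled by W.
open Classical in
theorem sum_isPos_eq [Fintype ι] {M : Type*} [AddCommGroup M] [Module ℂ M] (f : ι → M)
    (hf : ∀ i, f (P.reflectionPerm i i) = f i) :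
    ∑ i with b.IsPos i, f i = (1 / 2 : ℂ) • ∑ i, f i := by
  have h1 : ∑ i with ¬ b.IsPos i, f i = ∑ i with b.IsPos i, f i := by
    have hinv : ∀ i, P.reflectionPerm (P.reflectionPerm i i) (P.reflectionPerm i i) = i := by
      intro i
      apply P.root.injective
      rw [root_neg, root_neg, neg_neg]
    refine Finset.sum_nbij' (fun i => P.reflectionPerm i i) (fun i => P.reflectionPerm i i)
      ?_ ?_ ?_ ?_ ?_
    · intro i hi
      simpa [isPos_neg_iff] using hi
    · intro i hi
      simpa [isPos_neg_iff] using hi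
    · exact fun i _ => hinv i
    · exact fun i _ => hinv i
    · exact fun i _ => (hf i).symm
  rw [← Finset.sum_filter_add_sum_filter_not Finset.univ (fun i => b.IsPos i), h1, ← two_smul ℂ,
    smul_smul]
  norm_num

open Classical in
/-- A sum over reflections is a sum over positive roots. -/
theorem finsum_reflections [Fintype ι] [P.IsReduced] {M : Type*} [AddCommGroup M] (f : ι → M)
    (hf : ∀ i, f (P.reflectionPerm i i) = f i) :
    ∑ᶠ s : reflections P, f (rootIdx s) = ∑ i with b.IsPos i, f i := by
  have hcase : ∀ i j : ι, reflOf P i = reflOf P j → i = j ∨ i = P.reflectionPerm j j :=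
    fun i j h => eq_or_eq_neg_of_ofIdx_eq P (congrArg Subtype.val h)
  have hbij : Function.Bijective fun i : {i // b.IsPos i} => reflOf P i.1 := by
    constructor
    · intro i j h
      rcases hcase _ _ h with h | h
      · exact Subtype.ext h
      · exact absurd i.2 (by rw [h, isPos_neg_iff]; exact not_not.2 j.2)
    · intro s
      by_cases h : b.IsPos (rootIdx s)
      · exact ⟨⟨rootIdx s, h⟩, reflOf_rootIdx P s⟩
      · refine ⟨⟨P.reflectionPerm (rootIdx s) (rootIdx s), (isPos_neg_iff b _).2 h⟩, ?_⟩
        dsimp only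
        rw [reflOf_neg, reflOf_rootIdx]
  rw [← finsum_eq_of_bijective _ hbij (f := fun i : {i // b.IsPos i} => f i.1), finsum_eq_sum_of_fintype,
    ← Finset.sum_subtype (Finset.univ.filter fun i => b.IsPos i) (by simp) f]
  -- The chosen root of the reflection s_α is α or -α, and f does not distinguish them.
  intro i
  rcases hcase _ _ (reflOf_rootIdx P (reflOf P i.1)) with h | h
  · rw [h]
  · rw [h, hf]

end Positive

/-! ### The normalised form -/

namespace NormalizedForm

variable {P : RootPairing ι ℂ V H} {θ : ι} (B : NormalizedForm P θ)

/-- Half the squared length of a coroot. -/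
noncomputable def len (i : ι) : ℂ := B.form (P.coroot i) (P.coroot i) / 2

/-- Apply invariance under s_α to the pair (α^∨, s_α v): the reflection negates α^∨, and expanding
s_α v gives 2(α^∨|v) = (α^∨|α^∨) α(v). -/
theorem form_coroot (i : ι) (v : H) : B.form (P.coroot i) v = B.len i * P.root' i v := by
  have h := B.invariant (RootPairing.weylGroup.ofIdx P i) (P.coroot i)
    (wAct P (RootPairing.weylGroup.ofIdx P i) v)
  rw [← wAct_mul, ofIdx_mul_self, wAct_ofIdx P i (P.coroot i), wAct_ofIdx] at h
  have h1 : wAct P 1 v = v := by rw [wAct, inv_one]; rfl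
  rw [h1] at h
  simp only [RootPairing.root'_coroot_eq_pairing, RootPairing.pairing_same, map_sub, map_smul,
    LinearMap.sub_apply, LinearMap.smul_apply, smul_eq_mul] at h
  rw [len]
  linear_combination (-1 / 2 : ℂ) * h

theorem coroot_ne_zero (i : ι) : P.coroot i ≠ 0 := P.flip.ne_zero i

theorem len_ne_zero (i : ι) : B.len i ≠ 0 := by
  intro h
  refine coroot_ne_zero (P := P) i (B.nondegenerate.1 _ fun v => ?_)
  rw [form_coroot, h, zero_mul]

theorem len_perm (g : P.weylGroup) (i : ι) : B.len (P.weylGroupToPerm g i) = B.len i := by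
  rw [len, coroot_perm, B.invariant, len]

variable [Finite ι] [P.IsRootSystem]

theorem iso_coroot (i : ι) : B.iso (P.coroot i) = B.len i • P.root i := by
  apply P.toPerfPair.injective
  refine LinearMap.ext fun u => ?_
  change P.toLinearMap _ u = P.toLinearMap _ u
  rw [iso_apply, form_coroot, map_smul]
  rfl

theorem two_div_normSq (i : ι) : 2 / B.normSq (P.root i) = B.len i := by
  have h : B.iso.symm (P.root i) = (B.len i)⁻¹ • P.coroot i := by
    rw [LinearEquiv.symm_apply_eq, map_smul, iso_coroot, inv_smul_smul₀ (B.len_ne_zero i)]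
  have h0 := B.len_ne_zero i
  rw [normSq, h]
  simp only [map_smul, LinearMap.smul_apply, smul_eq_mul, form_coroot,
    RootPairing.root'_coroot_eq_pairing, RootPairing.pairing_same]
  field_simp

theorem iso_wAct (g : P.weylGroup) (u : H) : B.iso (wAct P g u) = g • B.iso u := by
  apply P.toPerfPair.injective
  refine LinearMap.ext fun v => ?_
  obtain ⟨v, rfl⟩ : ∃ w, v = wAct P g w := ⟨wAct P g⁻¹ v, by
    rw [← wAct_mul, mul_inv_cancel, wAct, inv_one]; rfl⟩
  change P.toLinearMap _ _ = P.toLinearMap _ _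
  rw [iso_apply, smul_pairing, B.invariant, iso_apply]

theorem coroot'_iso (i : ι) (v : H) : P.coroot' i (B.iso v) = B.len i * P.root' i v := by
  rw [← form_coroot, B.symm]
  exact B.iso_apply v (P.coroot i)

theorem form_iso_symm (x : V) (u : H) : B.form (B.iso.symm x) u = P.toLinearMap x u := by
  rw [← iso_apply, LinearEquiv.apply_symm_apply]

end NormalizedForm

end KZB

namespace KZB

variable {ι V H : Type*} [AddCommGroup V] [Module ℂ V] [AddCommGroup H] [Module ℂ H]

/-! ### The dual Coxeter number -/

section DualCoxeter

variable {P : RootPairing ι ℂ V H}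

theorem root'_coreflection (i j : ι) (u : H) :
    P.root' i (P.coreflection j u) = P.root' (P.reflectionPerm j i) u := by
  rw [RootPairing.root', RootPairing.root', RootPairing.root_reflectionPerm,
    RootPairing.coreflection_apply, RootPairing.reflection_apply, map_sub, map_sub, map_smul,
    map_smul, LinearMap.sub_apply, LinearMap.smul_apply, smul_eq_mul, smul_eq_mul]
  exact congrArg _ (mul_comm _ _)

theorem exists_height_functional [P.IsRootSystem] (b : P.Base) :
    ∃ φ : V →ₗ[ℂ] ℂ, (∀ i ∈ b.support, φ (P.root i) = 1) ∧
    ∀ i, φ (P.root i) = b.height i := by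
  have h1 : ∀ i ∈ b.support, b.toWeightBasis.constr ℂ (fun _ => (1 : ℂ)) (P.root i) = 1 := by
    intro i hi
    have := b.toWeightBasis.constr_basis ℂ (fun _ => (1 : ℂ)) ⟨i, hi⟩
    rwa [RootPairing.Base.toWeightBasis_apply] at this
  refine ⟨b.toWeightBasis.constr ℂ fun _ => 1, h1, fun i => ?_⟩
  obtain ⟨f, -, -, hf⟩ := b.exists_root_eq_sum_int i
  rw [RootPairing.Base.height_eq_sum hf, hf, map_sum]
  push_cast
  refine Finset.sum_congr rfl fun j hj => ?_
  rw [map_zsmul, h1 j hj, zsmul_eq_mul, mul_one]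

/-- The height of θ - α counts the simple roots in it, hence is nonnegative and is zero only for θ =
α. -/
theorem IsHighestRoot.height_le [P.IsRootSystem] {b : P.Base} {θ : ι}
    (hθ : IsHighestRoot b θ) (i : ι) :
    b.height i ≤ b.height θ ∧ (b.height i = b.height θ → i = θ) := by
  obtain ⟨φ, h1, h2⟩ := exists_height_functional b
  have h3 : ∀ x ∈ AddSubmonoid.closure (P.root '' b.support),
      ∃ n : ℕ, φ x = n ∧ (n = 0 → x = 0) := by
    intro x hx
    induction hx using AddSubmonoid.closure_induction with
    | mem x hx =>
      obtain ⟨i, hi, rfl⟩ := hx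
      exact ⟨1, by rw [h1 i hi, Nat.cast_one], fun h => absurd h one_ne_zero⟩
    | zero => exact ⟨0, by simp, fun _ => rfl⟩
    | add x y _ _ hx hy =>
      obtain ⟨m, hm, hm'⟩ := hx
      obtain ⟨n, hn, hn'⟩ := hy
      refine ⟨m + n, by rw [map_add, hm, hn, Nat.cast_add], fun h => ?_⟩
      rw [hm' (by omega), hn' (by omega), add_zero]
  obtain ⟨n, hn, hn'⟩ := h3 _ (hθ i)
  rw [map_sub, h2, h2] at hn
  have hn2 : b.height θ - b.height i = n := by exact_mod_cast hn
  refine ⟨by omega, fun h => ?_⟩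
  have := hn' (by omega)
  exact (P.root.injective (sub_eq_zero.1 this)).symm

theorem IsHighestRoot.isPos [P.IsRootSystem] {b : P.Base} {θ : ι}
    (hθ : IsHighestRoot b θ) : b.IsPos θ := by
  by_contra h
  have h1 := (hθ.height_le (P.reflectionPerm θ θ)).1
  have h2 : b.height (P.reflectionPerm θ θ) = -b.height θ := b.height_reflectionPerm_self θ
  have h3 := b.height_ne_zero θ
  rw [RootPairing.Base.isPos_iff] at h
  omega

/-- With m = ⟨α, θ^∨⟩, the root s_θ α has height ht(α) - m ht(θ), and no root exceeds ht(θ) in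
absolute height. As 0 < ht(α) < ht(θ), both m ≥ 2 and m ≤ -1 are impossible. -/
theorem IsHighestRoot.pairing_eq [P.IsCrystallographic] [P.IsRootSystem] {b : P.Base} {θ : ι}
    (hθ : IsHighestRoot b θ) {i : ι} (hi : b.IsPos i) (hne : i ≠ θ) :
    P.pairingIn ℤ i θ = 0 ∨ P.pairingIn ℤ i θ = 1 := by
  have hpos := hθ.isPos
  rw [RootPairing.Base.isPos_iff] at hpos hi
  have hk : P.root (P.reflectionPerm θ i) = P.root i + (-P.pairingIn ℤ i θ) • P.root θ := by
    rw [RootPairing.root_reflectionPerm, RootPairing.reflection_apply_root,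
      ← P.algebraMap_pairingIn ℤ i θ]
    simp [sub_eq_add_neg, Int.cast_smul_eq_zsmul]
  have h1 := b.height_add_zsmul hk
  have h2 := (hθ.height_le (P.reflectionPerm θ i)).1
  have h3 := (hθ.height_le
    (P.reflectionPerm (P.reflectionPerm θ i) (P.reflectionPerm θ i))).1
  have h4 : b.height (P.reflectionPerm (P.reflectionPerm θ i) (P.reflectionPerm θ i)) =
    -b.height (P.reflectionPerm θ i) := b.height_reflectionPerm_self _
  have h5 := hθ.height_le i
  have h6 : b.height i < b.height θ := lt_of_le_of_ne h5.1 fun h => hne (h5.2 h)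
  rw [h4] at h3
  rw [h1] at h2 h3
  simp only [smul_eq_mul] at h2 h3
  have h7 : P.pairingIn ℤ i θ < 2 := by
    by_contra! h
    nlinarith
  have h8 : -1 < P.pairingIn ℤ i θ := by
    by_contra! h
    nlinarith
  omega

variable [Fintype ι] [P.IsCrystallographic] [P.IsReduced] {b : P.Base} {θ : ι}

-- The simple reflection s_j permutes the positive roots other than α_j and negates their pairings
-- with α_j^∨. Only α_j itself contributes, with the value 2.
open Classical in
theorem sum_pairing_simple {j : ι} (hj : j ∈ b.support) :
    ∑ i with b.IsPos i, P.pairing i j = 2 := by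
  have hmem : j ∈ Finset.univ.filter fun i => b.IsPos i := by
    simpa using RootPairing.Base.isPos_of_mem_support hj
  rw [← Finset.add_sum_erase _ _ hmem, RootPairing.pairing_same]
  have : ∑ i ∈ (Finset.univ.filter fun i => b.IsPos i).erase j, P.pairing i j =
      -∑ i ∈ (Finset.univ.filter fun i => b.IsPos i).erase j, P.pairing i j := by
    rw [← Finset.sum_neg_distrib]
    have hmap : ∀ i ∈ (Finset.univ.filter fun i => b.IsPos i).erase j,
        P.reflectionPerm j i ∈ (Finset.univ.filter fun i => b.IsPos i).erase j := by
      intro i hi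
      simp only [Finset.mem_erase, Finset.mem_filter, Finset.mem_univ, true_and] at hi ⊢
      refine ⟨fun h => ?_, hi.2.reflectionPerm hj hi.1⟩
      have h1 : i = P.reflectionPerm j j := by
        have := P.reflectionPerm_self j i
        rw [h] at this
        exact this.symm
      have h2 := hi.2
      rw [h1, isPos_neg_iff] at h2
      exact h2 (RootPairing.Base.isPos_of_mem_support hj)
    refine Finset.sum_nbij' (P.reflectionPerm j) (P.reflectionPerm j) hmap hmap ?_ ?_ ?_
    · exact fun i _ => P.reflectionPerm_self j i
    · exact fun i _ => P.reflectionPerm_self j i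
    · intro i _
      rw [← P.pairing_reflectionPerm, RootPairing.pairing_reflectionPerm_self_right, neg_neg]
  rw [self_eq_neg.1 this, add_zero]

-- The sum of the positive roots pairs to 2 with each simple coroot; extend linearly to α_j^∨.
open Classical in
theorem sum_pairing_eq_height (j : ι) :
    ∑ i with b.IsPos i, P.pairing i j = 2 * b.flip.height j := by
  obtain ⟨f, -, -, hf⟩ := b.flip.exists_root_eq_sum_int j
  rw [RootPairing.Base.height_eq_sum hf]
  have h1 : ∀ i, P.pairing i j = ∑ k ∈ b.support, (f k : ℂ) * P.pairing i k := by
    intro i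
    have h2 : P.coroot j = ∑ k ∈ b.support, f k • P.coroot k := hf
    rw [← P.root'_coroot_eq_pairing, h2, map_sum]
    refine Finset.sum_congr rfl fun k _ => ?_
    rw [map_zsmul, zsmul_eq_mul, P.root'_coroot_eq_pairing]
  rw [Finset.sum_congr rfl fun i _ => h1 i, Finset.sum_comm]
  push_cast
  rw [Finset.mul_sum]
  refine Finset.sum_congr rfl fun k hk => ?_
  rw [← Finset.mul_sum, sum_pairing_simple (b := b) (show k ∈ b.support from hk), mul_comm]

variable [P.IsRootSystem]

-- For α ≠ θ the pairing is 0 or 1 and equals its square. The root θ contributes 4 instead of 2, so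
-- the total exceeds 2 ht(θ^∨) by 2.
open Classical in
theorem IsHighestRoot.sum_pairing_sq (hθ : IsHighestRoot b θ) :
    ∑ i with b.IsPos i, P.pairing i θ ^ 2 = 2 * dualCoxeter b θ := by
  have hmem : θ ∈ Finset.univ.filter fun i => b.IsPos i := by simpa using hθ.isPos
  have h1 : ∀ i ∈ (Finset.univ.filter fun i => b.IsPos i).erase θ,
      P.pairing i θ ^ 2 = P.pairing i θ := by
    intro i hi
    simp only [Finset.mem_erase, Finset.mem_filter, Finset.mem_univ, true_and] at hi
    rw [← P.algebraMap_pairingIn ℤ i θ]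
    rcases hθ.pairing_eq hi.2 hi.1 with h | h <;> simp [h]
  have h2 := sum_pairing_eq_height (b := b) θ
  rw [← Finset.add_sum_erase _ _ hmem] at h2 ⊢
  rw [Finset.sum_congr rfl h1]
  rw [RootPairing.pairing_same] at *
  rw [dualCoxeter]
  push_cast
  linear_combination h2

theorem IsHighestRoot.dualCoxeter_ne_zero (hθ : IsHighestRoot b θ) :
    (dualCoxeter b θ : ℂ) ≠ 0 := by
  classical
  intro h
  have h1 := hθ.sum_pairing_sq
  rw [h, mul_zero] at h1
  have h2 : ∑ i with b.IsPos i, P.pairingIn ℤ i θ ^ 2 = 0 := by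
    have : ((∑ i with b.IsPos i, P.pairingIn ℤ i θ ^ 2 : ℤ) : ℂ) = 0 := by
      push_cast
      rw [← h1]
      refine Finset.sum_congr rfl fun i _ => ?_
      rw [← P.algebraMap_pairingIn ℤ i θ]
      simp
    exact_mod_cast this
  have h3 := (Finset.sum_eq_zero_iff_of_nonneg fun i _ => sq_nonneg _).1 h2 θ
    (by simpa using hθ.isPos)
  simp at h3

open Classical in
/-- `∑_{γ > 0} γ(u) γ(v) = h^∨ (u|v)`. -/
theorem sum_root'_mul_root' [P.IsIrreducible] (hθ : IsHighestRoot b θ) (B : NormalizedForm P θ)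
    (u v : H) :
    ∑ i with b.IsPos i, P.root' i u * P.root' i v = dualCoxeter b θ * B.form u v := by
  -- The operator that represents the W-invariant form ∑_α α(u)α(v), over all roots, with respect to
  -- (·|·). It commutes with W, and the goal is to show that it is the scalar 2h^∨.
  set A : H →ₗ[ℂ] H := ∑ i, (P.root' i).smulRight (B.iso.symm (P.root i)) with hA
  have hAu : ∀ u, A u = ∑ i, P.root' i u • B.iso.symm (P.root i) := fun u => by simp [hA]
  have hform : ∀ u v, B.form (A u) v = ∑ i, P.root' i u * P.root' i v := by
    intro u v
    rw [hAu, map_sum, LinearMap.sum_apply]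
    refine Finset.sum_congr rfl fun i _ => ?_
    rw [map_smul, LinearMap.smul_apply, B.form_iso_symm, smul_eq_mul]
  have hiso : ∀ i j, B.iso.symm (P.root (P.reflectionPerm j i)) =
      P.coreflection j (B.iso.symm (P.root i)) := by
    intro i j
    have h := B.iso_wAct (RootPairing.weylGroup.ofIdx P j) (B.iso.symm (P.root i))
    rw [LinearEquiv.apply_symm_apply, ← root_perm, perm_ofIdx, wAct_ofIdx] at h
    rw [← h, LinearEquiv.symm_apply_apply]
    rfl
  have hcomm : ∀ j u, A (P.coreflection j u) = P.coreflection j (A u) := by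
    intro j u
    rw [hAu, hAu, map_sum, ← Equiv.sum_comp (P.reflectionPerm j)]
    refine Finset.sum_congr rfl fun i _ => ?_
    rw [root'_coreflection, RootPairing.reflectionPerm_self, map_smul, hiso]
  set lam : ℂ := 2 * dualCoxeter b θ with hlam
  have hsq : ∑ i, P.root' i (P.coroot θ) * P.root' i (P.coroot θ) = 2 * lam := by
    have h1 := sum_isPos_eq b (fun i => P.root' i (P.coroot θ) * P.root' i (P.coroot θ))
      (fun i => by rw [root'_neg, neg_mul_neg])
    have h2 := hθ.sum_pairing_sq
    simp only [RootPairing.root'_coroot_eq_pairing, ← sq] at h1 ⊢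
    rw [h2, smul_eq_mul] at h1
    linear_combination (-2 : ℂ) * h1
  -- A commutes with s_θ, so Aθ^∨ lies in the (-1)-eigenspace, which is the line through θ^∨. The
  -- eigenvalue follows by pairing with θ^∨, for which (θ^∨|θ^∨) = 2.
  have hAθ : A (P.coroot θ) = lam • P.coroot θ := by
    have h1 := hcomm θ (P.coroot θ)
    rw [RootPairing.coreflection_apply_self, map_neg, RootPairing.coreflection_apply] at h1
    have h2 : A (P.coroot θ) = (P.root' θ (A (P.coroot θ)) / 2) • P.coroot θ := by
      have h3 : (2 : ℂ) • A (P.coroot θ) = P.root' θ (A (P.coroot θ)) • P.coroot θ := by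
        rw [two_smul]
        have := sub_eq_iff_eq_add.1 h1.symm
        nth_rewrite 1 [this]
        abel
      rw [div_eq_inv_mul, ← smul_smul, ← h3, smul_smul]
      norm_num
    have h4 := hform (P.coroot θ) (P.coroot θ)
    rw [hsq, h2, map_smul, LinearMap.smul_apply, B.normalized, smul_eq_mul,
      div_mul_cancel₀ _ two_ne_zero] at h4
    rw [h2, h4, mul_div_cancel_left₀ _ two_ne_zero]
  -- The eigenspace is W-stable and contains θ^∨; irreducibility makes it the whole of 𝔥.
  have htop : LinearMap.ker (A - lam • LinearMap.id) = ⊤ := by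
    refine RootPairing.IsIrreducible.eq_top_of_invtSubmodule_coreflection (P := P) _ ?_ ?_
    · intro j x hx
      simp only [LinearMap.mem_ker, LinearMap.sub_apply, LinearMap.smul_apply, LinearMap.id_apply,
        Submodule.mem_comap, LinearEquiv.coe_coe, sub_eq_zero] at hx ⊢
      rw [hcomm, hx, map_smul]
    · intro h
      have : P.coroot θ ∈ LinearMap.ker (A - lam • LinearMap.id) := by
        simp [hAθ]
      rw [h, Submodule.mem_bot] at this
      exact NormalizedForm.coroot_ne_zero θ this
  have hAu' : A u = lam • u := by
    have : u ∈ LinearMap.ker (A - lam • LinearMap.id) := htop ▸ Submodule.mem_top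
    simpa [sub_eq_zero] using this
  rw [sum_isPos_eq b (fun i => P.root' i u * P.root' i v)
    (fun i => by rw [root'_neg, root'_neg, neg_mul_neg]), ← hform, hAu', map_smul,
    LinearMap.smul_apply, hlam, smul_eq_mul, smul_eq_mul]
  ring

end DualCoxeter

/-! ### Chains of roots -/

section Chain

variable (P : RootPairing ι ℂ V H)

/-- The permutation `(α, β) ↦ (β, s_β α)` of pairs of roots. -/
def pairPerm : Equiv.Perm (ι × ι) where
  toFun x := (x.2, P.reflectionPerm x.2 x.1)
  invFun x := (P.reflectionPerm x.1 x.2, x.1)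
  left_inv x := by simp
  right_inv x := by simp

/-- The sequence of roots `α₀, α₁, …` with `α_{k+2} = s_{α_{k+1}} α_k`. -/
def chainIdx (x : ι × ι) (k : ℕ) : ι := ((pairPerm P ^ k) x).1

theorem pairPerm_pow (x : ι × ι) (k : ℕ) :
    (pairPerm P ^ k) x = (chainIdx P x k, chainIdx P x (k + 1)) := by
  rw [chainIdx, chainIdx, pow_succ', Equiv.Perm.mul_apply]
  rfl

theorem chainIdx_add_two (x : ι × ι) (k : ℕ) :
    chainIdx P x (k + 2) = P.reflectionPerm (chainIdx P x (k + 1)) (chainIdx P x k) := by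
  have h := pairPerm_pow P x (k + 1)
  rw [pow_succ', Equiv.Perm.mul_apply, pairPerm_pow] at h
  exact (congrArg Prod.snd h).symm

/-- Twice the order of `pairPerm`, an even period of all chains. -/
noncomputable def chainPeriod : ℕ := 2 * orderOf (pairPerm P)

theorem pairPerm_pow_period : pairPerm P ^ chainPeriod P = 1 := by
  rw [chainPeriod, mul_comm, pow_mul, pow_orderOf_eq_one, one_pow]

theorem chainIdx_period (x : ι × ι) (k : ℕ) :
    chainIdx P x (k + chainPeriod P) = chainIdx P x k := by
  rw [chainIdx, pow_add, pairPerm_pow_period, mul_one, chainIdx]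

theorem chainPeriod_pos [Finite ι] : 0 < chainPeriod P :=
  Nat.mul_pos two_pos (orderOf_pos _)

theorem even_chainPeriod : Even (chainPeriod P) :=
  ⟨orderOf (pairPerm P), by rw [chainPeriod, two_mul]⟩

/-- The `2`-form `α ∧ β`. -/
def wedge (u v : H) (x : ι × ι) : ℂ :=
  P.root' x.1 u * P.root' x.2 v - P.root' x.1 v * P.root' x.2 u

/-- β ∧ s_β α = β ∧ α, as s_β α differs from α by a multiple of β. This sign gives the alternating
sums over orbits. -/
theorem wedge_pairPerm (u v : H) (x : ι × ι) : wedge P u v (pairPerm P x) = -wedge P u v x := by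
  have h : ∀ u, P.root' (P.reflectionPerm x.2 x.1) u =
      P.root' x.1 u - P.pairing x.1 x.2 * P.root' x.2 u := by
    intro u
    rw [RootPairing.root', RootPairing.root_reflectionPerm, RootPairing.reflection_apply_root,
      map_sub, map_smul]
    rfl
  change P.root' x.2 u * P.root' (P.reflectionPerm x.2 x.1) v -
    P.root' x.2 v * P.root' (P.reflectionPerm x.2 x.1) u = _
  rw [h, h, wedge]
  ring

theorem wedge_pairPerm_pow (u v : H) (x : ι × ι) (k : ℕ) :
    wedge P u v ((pairPerm P ^ k) x) = (-1) ^ k * wedge P u v x := by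
  induction k with
  | zero => simp
  | succ k ih => rw [pow_succ', Equiv.Perm.mul_apply, wedge_pairPerm, ih, pow_succ]; ring

/-- In a reduced system, dependent roots are equal or opposite. Only independent pairs, which start
a genuine chain, need the elliptic identity. -/
theorem wedge_eq_zero [P.IsReduced] (u v : H) (x : ι × ι)
    (hx : ¬ LinearIndependent ℂ ![P.root x.1, P.root x.2]) : wedge P u v x = 0 := by
  rcases RootPairing.IsReduced.eq_or_eq_neg (P := P) x.1 x.2 hx with h | h
  · rw [wedge, RootPairing.root', RootPairing.root', h]
    ring
  · rw [wedge, RootPairing.root', RootPairing.root', h, map_neg, LinearMap.neg_apply,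
      LinearMap.neg_apply]
    ring

/-- The solution of `a_{k+2} = a_k - c_k a_{k+1}` with initial values `s`, `t`. -/
def linRec (c : ℕ → ℤ) (s t : ℤ) : ℕ → ℤ
  | 0 => s
  | 1 => t
  | k + 2 => linRec c s t k - c k * linRec c s t (k + 1)

theorem eq_linRec {M : Type*} [AddCommGroup M] (c : ℕ → ℤ) {a : ℕ → M}
    (ha : ∀ k, a (k + 2) = a k - c k • a (k + 1)) (k : ℕ) :
    a k = linRec c 1 0 k • a 0 + linRec c 0 1 k • a 1 := by
  induction k using Nat.twoStepInduction with
  | zero => simp [linRec]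
  | one => simp [linRec]
  | more k h1 h2 =>
    rw [ha, linRec, linRec]
    conv_lhs => rw [h1, h2]
    module

/-- By independence of a_0 and a_1, periodicity of the vectors passes to their integral coordinates.
-/
theorem linRec_period {M : Type*} [AddCommGroup M] [Module ℂ M] (c : ℕ → ℤ) {a : ℕ → M}
    (ha : ∀ k, a (k + 2) = a k - c k • a (k + 1)) (hlin : LinearIndependent ℂ ![a 0, a 1]) {N : ℕ}
    (hN : ∀ k, a (k + N) = a k) (k : ℕ) :
    linRec c 1 0 (k + N) = linRec c 1 0 k ∧ linRec c 0 1 (k + N) = linRec c 0 1 k := by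
  have h := hN k
  rw [eq_linRec c ha (k + N), eq_linRec c ha k] at h
  have h1 : ((linRec c 1 0 (k + N) - linRec c 1 0 k : ℤ) : ℂ) • a 0 +
      ((linRec c 0 1 (k + N) - linRec c 0 1 k : ℤ) : ℂ) • a 1 = 0 := by
    rw [Int.cast_smul_eq_zsmul, Int.cast_smul_eq_zsmul]
    rw [← sub_eq_zero] at h
    rw [← h]
    module
  obtain ⟨e1, e2⟩ := LinearIndependent.pair_iff.1 hlin _ _ h1
  exact ⟨sub_eq_zero.1 (by exact_mod_cast e1), sub_eq_zero.1 (by exact_mod_cast e2)⟩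

variable {P} in
/-- The summand of the curvature attached to a pair of roots, as an element of an algebra in which
`X α` plays the role of `π(α^∨)`. -/
noncomputable def pairTerm {R : Type*} [Ring R] [Algebra ℂ R] (τ : ℍ) (z : H) (X : ι → R)
    (n : ℕ) (x : ι × ι) : R :=
  (kCoeff τ (P.root' x.1 z) (n + 1) * P.pairing x.2 x.1) •
      (∑ p ∈ Finset.HasAntidiagonal.antidiagonal n,
        X x.1 ^ p.1 * X (P.reflectionPerm x.2 x.1) ^ p.2) -
    ∑ p ∈ Finset.HasAntidiagonal.antidiagonal n,
      (kCoeff τ (P.root' x.2 z) p.1 * kCoeff τ (P.root' x.1 z) p.2) •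
        (X x.2 ^ p.1 * X (P.reflectionPerm x.2 x.1) ^ p.2)

variable {P} in
theorem map_pairTerm {R S : Type*} [Ring R] [Algebra ℂ R] [Ring S] [Algebra ℂ S] (f : R →ₐ[ℂ] S)
    (τ : ℍ) (z : H) (X : ι → R) (n : ℕ) (x : ι × ι) :
    f (pairTerm (P := P) τ z X n x) = pairTerm (P := P) τ z (fun i => f (X i)) n x := by
  simp only [pairTerm, map_sub, map_smul, map_sum, map_mul, map_pow]

variable [P.IsCrystallographic]

theorem root_chainIdx_add_two (x : ι × ι) (k : ℕ) :
    P.root (chainIdx P x (k + 2)) = P.root (chainIdx P x k) -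
      P.pairingIn ℤ (chainIdx P x k) (chainIdx P x (k + 1)) • P.root (chainIdx P x (k + 1)) := by
  rw [chainIdx_add_two, RootPairing.root_reflectionPerm, RootPairing.reflection_apply_root,
    ← P.algebraMap_pairingIn ℤ]
  simp [Int.cast_smul_eq_zsmul]

theorem coroot_chainIdx_add_two (x : ι × ι) (k : ℕ) :
    P.coroot (chainIdx P x (k + 2)) = P.coroot (chainIdx P x k) -
      P.pairingIn ℤ (chainIdx P x (k + 1)) (chainIdx P x k) • P.coroot (chainIdx P x (k + 1)) := by
  rw [chainIdx_add_two, RootPairing.coroot_reflectionPerm, RootPairing.coreflection_apply_coroot,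
    ← P.algebraMap_pairingIn ℤ]
  simp [Int.cast_smul_eq_zsmul]

/-- The pairings of consecutive roots of a chain. -/
noncomputable def chainPairing (x : ι × ι) (k : ℕ) : ℤ :=
  P.pairingIn ℤ (chainIdx P x k) (chainIdx P x (k + 1))

/-- The pairings of consecutive roots of a chain, in reverse order. -/
noncomputable def chainCopairing (x : ι × ι) (k : ℕ) : ℤ :=
  P.pairingIn ℤ (chainIdx P x (k + 1)) (chainIdx P x k)

/-- α_{k+2} = s_{α_{k+1}} α_k, and the reflection negates the pairing with α_{k+1}^∨. -/
theorem chainCopairing_succ (x : ι × ι) (k : ℕ) :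
    chainCopairing P x (k + 1) = -chainPairing P x k := by
  have h : (P.pairingIn ℤ (chainIdx P x (k + 2)) (chainIdx P x (k + 1)) : ℂ) =
      -P.pairingIn ℤ (chainIdx P x k) (chainIdx P x (k + 1)) := by
    have := P.pairing_reflectionPerm (chainIdx P x (k + 1)) (chainIdx P x k)
      (chainIdx P x (k + 1))
    rw [RootPairing.pairing_reflectionPerm_self_right, ← chainIdx_add_two,
      ← P.algebraMap_pairingIn ℤ, ← P.algebraMap_pairingIn ℤ] at this
    simpa using this.symm
  exact_mod_cast h

theorem linRec_chainPairing_period (x : ι × ι)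
    (hx : LinearIndependent ℂ ![P.root x.1, P.root x.2]) (k : ℕ) :
    linRec (chainPairing P x) 1 0 (k + chainPeriod P) = linRec (chainPairing P x) 1 0 k ∧
      linRec (chainPairing P x) 0 1 (k + chainPeriod P) = linRec (chainPairing P x) 0 1 k :=
  linRec_period (chainPairing P x) (a := fun k => P.root (chainIdx P x k))
    (root_chainIdx_add_two P x) hx (fun k => congrArg P.root (chainIdx_period P x k)) k

theorem linRec_chainCopairing_period (x : ι × ι)
    (hx : LinearIndependent ℂ ![P.coroot x.1, P.coroot x.2]) (k : ℕ) :
    linRec (chainCopairing P x) 1 0 (k + chainPeriod P) = linRec (chainCopairing P x) 1 0 k ∧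
      linRec (chainCopairing P x) 0 1 (k + chainPeriod P) = linRec (chainCopairing P x) 0 1 k :=
  linRec_period (chainCopairing P x) (a := fun k => P.coroot (chainIdx P x k))
    (coroot_chainIdx_add_two P x) hx (fun k => congrArg P.coroot (chainIdx_period P x k)) k

/-- The chain of roots starting with a pair of linearly independent roots. -/
noncomputable def rootChain (x : ι × ι) (hx : LinearIndependent ℂ ![P.root x.1, P.root x.2])
    (hx' : LinearIndependent ℂ ![P.coroot x.1, P.coroot x.2]) : RootChain (chainPeriod P) where
  p := chainPairing P x
  q := chainCopairing P x
  u := linRec (chainPairing P x) 1 0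
  v := linRec (chainPairing P x) 0 1
  u' := linRec (chainCopairing P x) 1 0
  v' := linRec (chainCopairing P x) 0 1
  even := even_chainPeriod P
  q_succ := chainCopairing_succ P x
  u_zero := rfl
  u_one := rfl
  v_zero := rfl
  v_one := rfl
  u_add_two _ := rfl
  v_add_two _ := rfl
  u_period k := (linRec_chainPairing_period P x hx k).1
  v_period k := (linRec_chainPairing_period P x hx k).2
  u'_zero := rfl
  u'_one := rfl
  v'_zero := rfl
  v'_one := rfl
  u'_add_two _ := rfl
  v'_add_two _ := rfl
  u'_period k := (linRec_chainCopairing_period P x hx' k).1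
  v'_period k := (linRec_chainCopairing_period P x hx' k).2

variable {P}

/-- The identity `RootChain.sum_kCoeff` for the orbit of a pair: a_k are the values at z of the
roots of the chain, X_k the images of their coroots, and the powers of -1 come from the wedge. -/
theorem sum_pairTerm [Finite ι] [P.IsReduced] {R : Type*} [CommRing R] [Algebra ℂ R] {τ : ℍ} {z : H}
    (hz : z ∈ regular P τ) {X : ι → R}
    (hX : ∀ i j, X (P.reflectionPerm i j) = X j - P.pairing i j • X i) (n : ℕ) (u v : H)
    (x : ι × ι) :
    ∑ k ∈ Finset.range (chainPeriod P), wedge P u v ((pairPerm P ^ k) x) •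
      pairTerm (P := P) τ z X n ((pairPerm P ^ k) x) = 0 := by
  by_cases hx : LinearIndependent ℂ ![P.root x.1, P.root x.2]
  · have hx' : LinearIndependent ℂ ![P.coroot x.1, P.coroot x.2] := by
      rw [RootPairing.IsReduced.linearIndependent_iff] at hx
      have : P.flip.IsReduced := inferInstance
      refine RootPairing.IsReduced.linearIndependent P.flip hx.1 fun h => hx.2 ?_
      exact P.root_eq_neg_iff.2 (P.coroot_eq_neg_iff.1 h)
    set c := rootChain P x hx hx' with hc
    have ha : ∀ k, P.root' (chainIdx P x (k + 2)) z = P.root' (chainIdx P x k) z -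
        c.p k • P.root' (chainIdx P x (k + 1)) z := by
      intro k
      rw [RootPairing.root', root_chainIdx_add_two, map_sub, map_zsmul]
      rfl
    have hXc : ∀ k, X (chainIdx P x (k + 2)) = X (chainIdx P x k) -
        c.q k • X (chainIdx P x (k + 1)) := by
      intro k
      rw [chainIdx_add_two, hX, ← P.algebraMap_pairingIn ℤ, ← Int.cast_smul_eq_zsmul ℂ]
      rfl
    have h := c.sum_kCoeff (τ := τ) (X := fun k => X (chainIdx P x k)) ha
      (fun k h => hz _ ((theta_eq_zero_iff τ _).1 h)) hXc n
    have h2 : wedge P u v x • _ = wedge P u v x • _ := congrArg (wedge P u v x • ·) h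
    rw [smul_zero, Finset.smul_sum] at h2
    rw [← h2]
    refine Finset.sum_congr rfl fun k _ => ?_
    rw [wedge_pairPerm_pow, pairPerm_pow, pairTerm, smul_smul, mul_comm]
    simp only [← chainIdx_add_two]
    rw [← P.algebraMap_pairingIn ℤ]
    rfl
  · refine Finset.sum_eq_zero fun k _ => ?_
    rw [wedge_pairPerm_pow, wedge_eq_zero P u v x hx, mul_zero, zero_smul]

open scoped IsMulCommutative in
theorem sum_pairTerm_of_commute [Finite ι] [P.IsReduced] {A : Type*} [Ring A]
    [Algebra ℂ A] {τ : ℍ} {z : H} (hz : z ∈ regular P τ) {X : ι → A}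
    (hcomm : ∀ i j, X i * X j = X j * X i)
    (hX : ∀ i j, X (P.reflectionPerm i j) = X j - P.pairing i j • X i) (n : ℕ) (u v : H)
    (x : ι × ι) :
    ∑ k ∈ Finset.range (chainPeriod P), wedge P u v ((pairPerm P ^ k) x) •
      pairTerm (P := P) τ z X n ((pairPerm P ^ k) x) = 0 := by
  have hc : ∀ a ∈ Set.range X, ∀ b ∈ Set.range X, a * b = b * a := by
    rintro _ ⟨i, rfl⟩ _ ⟨j, rfl⟩
    exact hcomm i j
  -- The elements X i commute, so the commutative case applies inside the subalgebra they generate.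
  have := Algebra.isMulCommutative_adjoin ℂ hc
  set X' : ι → Algebra.adjoin ℂ (Set.range X) :=
    fun i => ⟨X i, Algebra.subset_adjoin ⟨i, rfl⟩⟩ with hX'
  have h := congrArg (Algebra.adjoin ℂ (Set.range X)).val
    (sum_pairTerm hz (X := X') (fun i j => Subtype.ext (hX i j)) n u v x)
  simp only [map_sum, map_smul, map_zero, map_pairTerm] at h
  exact h

end Chain

end KZB

open Finset.HasAntidiagonal (antidiagonal)

namespace KZB

/-! ### Components in a degree completion -/

section Components

variable {A : Type*} [Ring A]

theorem coeff_monomial_mul (k n : ℕ) (a : A) (f : PowerSeries A) :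
    PowerSeries.coeff (n + k) (PowerSeries.monomial k a * f) = a * PowerSeries.coeff n f := by
  rw [PowerSeries.coeff_mul, Finset.sum_eq_single (k, n)]
  · rw [PowerSeries.coeff_monomial_same]
  · rintro ⟨i, j⟩ hp hne
    rw [PowerSeries.coeff_monomial, if_neg, zero_mul]
    rintro rfl
    rw [Finset.HasAntidiagonal.mem_antidiagonal] at hp
    exact hne (by rw [show j = n by omega])
  · intro h
    exact absurd (Finset.HasAntidiagonal.mem_antidiagonal.2 (Nat.add_comm k n)) h

theorem coeff_monomial_mul_of_lt {k n : ℕ} (h : n < k) (a : A) (f : PowerSeries A) :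
    PowerSeries.coeff n (PowerSeries.monomial k a * f) = 0 := by
  rw [PowerSeries.coeff_mul]
  refine Finset.sum_eq_zero fun p hp => ?_
  rw [Finset.HasAntidiagonal.mem_antidiagonal] at hp
  rw [PowerSeries.coeff_monomial, if_neg (by omega), zero_mul]

theorem coeff_mul_monomial (k n : ℕ) (a : A) (f : PowerSeries A) :
    PowerSeries.coeff (n + k) (f * PowerSeries.monomial k a) = PowerSeries.coeff n f * a := by
  rw [PowerSeries.coeff_mul, Finset.sum_eq_single (n, k)]
  · rw [PowerSeries.coeff_monomial_same]
  · rintro ⟨i, j⟩ hp hne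
    rw [PowerSeries.coeff_monomial, if_neg, mul_zero]
    rintro rfl
    rw [Finset.HasAntidiagonal.mem_antidiagonal] at hp
    exact hne (by rw [show i = n by omega])
  · intro h
    exact absurd (Finset.HasAntidiagonal.mem_antidiagonal.2 (show n + k = n + k from rfl)) h

theorem coeff_mul_monomial_of_lt {k n : ℕ} (h : n < k) (a : A) (f : PowerSeries A) :
    PowerSeries.coeff n (f * PowerSeries.monomial k a) = 0 := by
  rw [PowerSeries.coeff_mul]
  refine Finset.sum_eq_zero fun p hp => ?_
  rw [Finset.HasAntidiagonal.mem_antidiagonal] at hp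
  rw [PowerSeries.coeff_monomial, if_neg (by omega), mul_zero]

variable [Algebra ℂ A]

/-- The commutator map of an associative algebra. -/
def adL (a : A) : A →ₗ[ℂ] A := LinearMap.mulLeft ℂ a - LinearMap.mulRight ℂ a

theorem adL_apply (a b : A) : adL a b = a * b - b * a := rfl

variable {𝒜 : ℕ → Submodule ℂ A} [SetLike.GradedMonoid 𝒜]

theorem component_ext {f g : Completion 𝒜} (h : ∀ n, component n f = component n g) : f = g :=
  Subtype.ext (PowerSeries.ext h)

/-- The degree `n` component as a linear map. -/
noncomputable def componentL (n : ℕ) : Completion 𝒜 →ₗ[ℂ] A where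
  toFun := component n
  map_add' f g := map_add (PowerSeries.coeff n) f.1 g.1
  map_smul' r f := PowerSeries.coeff_smul n f.1 r

theorem componentL_apply (n : ℕ) (f : Completion 𝒜) : componentL n f = component n f := rfl

theorem component_mul (n : ℕ) (f g : Completion 𝒜) :
    component n (f * g) = ∑ p ∈ antidiagonal n, component p.1 f * component p.2 g :=
  PowerSeries.coeff_mul n f.1 g.1

theorem component_homog (n k : ℕ) (a : A) (ha : a ∈ 𝒜 k) :
    component n (homog 𝒜 k a ha) = if n = k then a else 0 :=
  PowerSeries.coeff_monomial n k a

theorem component_homog_mul (k n : ℕ) (a : A) (ha : a ∈ 𝒜 k) (f : Completion 𝒜) :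
    component (n + k) (homog 𝒜 k a ha * f) = a * component n f :=
  coeff_monomial_mul k n a f.1

theorem component_homog_mul_of_lt {k n : ℕ} (h : n < k) (a : A) (ha : a ∈ 𝒜 k)
    (f : Completion 𝒜) : component n (homog 𝒜 k a ha * f) = 0 :=
  coeff_monomial_mul_of_lt h a f.1

theorem component_mul_homog (k n : ℕ) (a : A) (ha : a ∈ 𝒜 k) (f : Completion 𝒜) :
    component (n + k) (f * homog 𝒜 k a ha) = component n f * a :=
  coeff_mul_monomial k n a f.1

/-- An X concentrated in degree 1 makes ad X raise degrees by one. The condition is on the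
underlying power series so that scalar multiples of generators are covered too. -/
theorem component_iterate_ad {X : Completion 𝒜} {a : A} (hX : X.1 = PowerSeries.monomial 1 a)
    (f : Completion 𝒜) (m n : ℕ) :
    component (n + m) ((fun Y => X * Y - Y * X)^[m] f) = (adL a)^[m] (component n f) ∧
      ∀ k < m, component k ((fun Y => X * Y - Y * X)^[m] f) = 0 := by
  induction m generalizing n with
  | zero => exact ⟨rfl, fun k hk => absurd hk (Nat.not_lt_zero k)⟩
  | succ m ih =>
    rw [Function.iterate_succ_apply', Function.iterate_succ_apply']
    have h : ∀ k, component (k + 1) (X * (fun Y => X * Y - Y * X)^[m] f -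
        (fun Y => X * Y - Y * X)^[m] f * X) =
        adL a (component k ((fun Y => X * Y - Y * X)^[m] f)) := by
      intro k
      change PowerSeries.coeff (k + 1) (X.1 * _ - _ * X.1) = _
      rw [hX, map_sub, coeff_monomial_mul, coeff_mul_monomial]
      rfl
    refine ⟨?_, fun k hk => ?_⟩
    · rw [← add_assoc, h, (ih n).1]
    · cases k with
      | zero =>
        change PowerSeries.coeff 0 (X.1 * _ - _ * X.1) = _
        rw [hX, map_sub, coeff_monomial_mul_of_lt Nat.one_pos,
          coeff_mul_monomial_of_lt Nat.one_pos, sub_zero]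
      | succ k => rw [h, (ih 0).2 k (by omega), map_zero]

theorem component_adSeries {X : Completion 𝒜} {a : A} (hX : X.1 = PowerSeries.monomial 1 a)
    (κ : ℕ → ℂ) (f : Completion 𝒜) (n : ℕ) :
    component n (adSeries κ X f) =
      ∑ p ∈ antidiagonal n, κ p.1 • (adL a)^[p.1] (component p.2 f) := by
  have h0 : component n (adSeries κ X f) = ∑ m ∈ Finset.range (n + 1),
      κ m • component n ((fun Y => X * Y - Y * X)^[m] f) := by
    simp only [component, adSeries, PowerSeries.coeff_mk]
  rw [Finset.Nat.sum_antidiagonal_eq_sum_range_succ_mk, h0]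
  refine Finset.sum_congr rfl fun m hm => ?_
  rw [Finset.mem_range] at hm
  have h := (component_iterate_ad hX f m (n - m)).1
  rw [Nat.sub_add_cancel (by omega)] at h
  rw [h]

end Components

/-! ### Relations in the rational Cherednik algebra -/

namespace RCA

variable {ι V H : Type*} [AddCommGroup V] [Module ℂ V] [AddCommGroup H] [Module ℂ H]
  (P : RootPairing ι ℂ V H)

/-- The quotient map of the presentation of the rational Cherednik algebra. -/
noncomputable def mk : RCAFree P →ₐ[ℂ] RCA P := RingQuot.mkAlgHom ℂ (RCARel P)

theorem mk_fa (a : RCAGen P) : mk P (fa a) = of P a := rfl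

variable {P} in
theorem mk_eq {x y : RCAFree P} (h : RCARel P x y) : mk P x = mk P y := RingQuot.mkAlgHom_rel ℂ h

/-- The elements of `𝔥*` in the rational Cherednik algebra. -/
noncomputable def xL : V →ₗ[ℂ] RCA P where
  toFun v := of P (.x v)
  map_add' v v' := by
    have h := mk_eq (P := P) (.x_add v v')
    simp only [map_add, mk_fa] at h
    exact h
  map_smul' r v := by
    have h := mk_eq (P := P) (.x_smul r v)
    simp only [map_smul, mk_fa] at h
    exact h

/-- The elements of `𝔥` in the rational Cherednik algebra. -/
noncomputable def yL : H →ₗ[ℂ] RCA P where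
  toFun u := of P (.y u)
  map_add' u u' := by
    have h := mk_eq (P := P) (.y_add u u')
    simp only [map_add, mk_fa] at h
    exact h
  map_smul' r u := by
    have h := mk_eq (P := P) (.y_smul r u)
    simp only [map_smul, mk_fa] at h
    exact h

/-- The Weyl group in the rational Cherednik algebra. -/
noncomputable def wM : P.weylGroup →* RCA P where
  toFun g := of P (.w g)
  map_one' := by
    have h := mk_eq (P := P) .w_one
    simp only [map_one, mk_fa] at h
    exact h
  map_mul' g h := by
    have h := mk_eq (P := P) (.w_mul g h)
    simp only [map_mul, mk_fa] at h
    exact h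

variable {P}

theorem wM_mul_xL (g : P.weylGroup) (v : V) : wM P g * xL P v = xL P (g • v) * wM P g := by
  have h := mk_eq (P := P) (.w_x g v)
  simp only [map_mul, mk_fa] at h
  exact h

theorem wM_mul_yL (g : P.weylGroup) (u : H) : wM P g * yL P u = yL P (wAct P g u) * wM P g := by
  have h := mk_eq (P := P) (.w_y g u)
  simp only [map_mul, mk_fa] at h
  exact h

theorem commute_xL (v v' : V) : Commute (xL P v) (xL P v') := by
  have h := mk_eq (P := P) (.xx v v')
  simp only [map_mul, map_sub, map_zero, mk_fa] at h
  exact sub_eq_zero.1 h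

theorem commute_yL (u u' : H) : Commute (yL P u) (yL P u') := by
  have h := mk_eq (P := P) (.yy u u')
  simp only [map_mul, map_sub, map_zero, mk_fa] at h
  exact sub_eq_zero.1 h

theorem induction_on {p : RCA P → Prop} (a : RCA P) (alg : ∀ r : ℂ, p (algebraMap ℂ _ r))
    (gen : ∀ g, p (of P g)) (mul : ∀ a b, p a → p b → p (a * b))
    (add : ∀ a b, p a → p b → p (a + b)) : p a := by
  obtain ⟨a, rfl⟩ := RingQuot.mkAlgHom_surjective ℂ (RCARel P) a
  induction a using FreeAlgebra.induction with
  | grade0 r => rw [AlgHom.commutes]; exact alg r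
  | grade1 g => exact gen g
  | mul a b ha hb => rw [map_mul]; exact mul _ _ ha hb
  | add a b ha hb => rw [map_add]; exact add _ _ ha hb

theorem commute_of_commute_gen {z : RCA P} (h : ∀ g, Commute z (of P g)) (a : RCA P) :
    Commute z a :=
  induction_on a (fun r => (Algebra.commutes r z).symm) h (fun _ _ ha hb => ha.mul_right hb)
    fun _ _ ha hb => ha.add_right hb

theorem commute_hbar (a : RCA P) : Commute (of P .hbar) a :=
  commute_of_commute_gen (fun g => by
    have h := mk_eq (P := P) (.hbar_comm g)
    simp only [map_mul, mk_fa] at h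
    exact h) a

theorem commute_c (C : ReflClass P) (a : RCA P) : Commute (of P (.c C)) a :=
  commute_of_commute_gen (fun g => by
    have h := mk_eq (P := P) (.c_comm C g)
    simp only [map_mul, mk_fa] at h
    exact h) a

/-- The reflection `s_α` in the rational Cherednik algebra. -/
noncomputable def refl (i : ι) : RCA P := wM P (RootPairing.weylGroup.ofIdx P i)

theorem wM_mul_refl (g : P.weylGroup) (i : ι) :
    wM P g * refl i = refl (P.weylGroupToPerm g i) * wM P g := by
  rw [refl, refl, ← map_mul, ← map_mul, mul_ofIdx]

theorem refl_mul_refl (i j : ι) : (refl i : RCA P) * refl j = refl (P.reflectionPerm i j) * refl i :=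
  wM_mul_refl (RootPairing.weylGroup.ofIdx P i) j

theorem refl_neg (i : ι) : (refl (P.reflectionPerm i i) : RCA P) = refl i := by
  rw [refl, refl, ofIdx_neg]

theorem refl_mul_yL (i : ι) (u : H) :
    refl i * yL P u = yL P (u - P.root' i u • P.coroot i) * refl i := by
  rw [refl, wM_mul_yL, wAct_ofIdx]

theorem refl_mul_xL (i : ι) (v : V) :
    refl i * xL P v = xL P (v - P.coroot' i v • P.root i) * refl i := by
  rw [refl, wM_mul_xL, ofIdx_smul]

/-- The commutation relation of `𝔥` and `𝔥*`. -/
theorem yL_mul_xL_sub [Fintype ι] [P.IsReduced] (b : P.Base) [DecidablePred b.IsPos] (u : H) (v : V) :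
    yL P u * xL P v - xL P v * yL P u = P.toLinearMap v u • of P .hbar -
      ∑ i with b.IsPos i, (P.root' i u * P.coroot' i v) •
        (of P (.c (reflClass (reflOf P i))) * refl i) := by
  have h := mk_eq (P := P) (.yx u v)
  have h1 : ∀ s : reflections P, (P.root' (rootIdx s) u * P.coroot' (rootIdx s) v) •
      (fa (.c (reflClass s)) * fa (.w s.1) : RCAFree P) =
      (fun i => (P.root' i u * P.coroot' i v) •
        (fa (.c (reflClass (reflOf P i))) * fa (.w (reflOf P i).1) : RCAFree P)) (rootIdx s) := by
    intro s
    dsimp only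
    rw [reflOf_rootIdx]
  rw [finsum_congr h1, finsum_reflections b fun i => (P.root' i u * P.coroot' i v) •
    (fa (.c (reflClass (reflOf P i))) * fa (.w (reflOf P i).1) : RCAFree P)] at h
  · simp only [map_mul, map_sub, map_smul, map_sum, mk_fa] at h
    convert h <;> rfl
  · intro i
    rw [reflOf_neg, root'_neg, coroot'_neg, neg_mul_neg]

end RCA

end KZB

open Finset.HasAntidiagonal (antidiagonal)

namespace KZB

variable {ι V H : Type*} [AddCommGroup V] [Module ℂ V] [AddCommGroup H] [Module ℂ H]

/-! ### Elements of the rational Cherednik algebra attached to roots -/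

namespace NormalizedForm

variable {P : RootPairing ι ℂ V H} {θ : ι} (B : NormalizedForm P θ)

/-- The element `2c_α/(α|α)` of the rational Cherednik algebra. -/
noncomputable def par (i : ι) : RCA P := B.len i • RCA.of P (.c (reflClass (reflOf P i)))

theorem commute_par (i : ι) (a : RCA P) : Commute (B.par i) a :=
  (RCA.commute_c _ a).smul_left _

theorem par_perm (g : P.weylGroup) (i : ι) : B.par (P.weylGroupToPerm g i) = B.par i := by
  rw [par, len_perm, reflClass_perm, par]

theorem par_reflectionPerm (i j : ι) : B.par (P.reflectionPerm i j) = B.par j :=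
  B.par_perm (RootPairing.weylGroup.ofIdx P i) j

variable [Finite ι] [P.IsRootSystem]

/-- The element `π(α^∨)` of the rational Cherednik algebra. -/
noncomputable def xr (i : ι) : RCA P := RCA.xL P (B.iso (P.coroot i))

theorem xr_reflectionPerm (i j : ι) :
    B.xr (P.reflectionPerm i j) = B.xr j - P.pairing i j • B.xr i := by
  rw [xr, RootPairing.coroot_reflectionPerm, RootPairing.coreflection_apply_coroot, map_sub,
    map_sub, map_smul, map_smul]
  rfl

theorem xr_neg (i : ι) : B.xr (P.reflectionPerm i i) = -B.xr i := by
  rw [xr, coroot_neg, map_neg, map_neg, xr]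

theorem commute_xr (i j : ι) : Commute (B.xr i) (B.xr j) := RCA.commute_xL _ _

theorem wM_mul_xr_pow (g : P.weylGroup) (i : ι) (n : ℕ) :
    RCA.wM P g * B.xr i ^ n = B.xr (P.weylGroupToPerm g i) ^ n * RCA.wM P g := by
  have h : SemiconjBy (RCA.wM P g) (B.xr i) (B.xr (P.weylGroupToPerm g i)) := by
    rw [SemiconjBy, xr, xr, RCA.wM_mul_xL, coroot_perm, iso_wAct]
  exact (h.pow_right n).eq

theorem refl_mul_xr_pow (i j : ι) (n : ℕ) :
    RCA.refl i * B.xr j ^ n = B.xr (P.reflectionPerm i j) ^ n * RCA.refl i :=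
  B.wM_mul_xr_pow (RootPairing.weylGroup.ofIdx P i) j n

/-- The element `(2c_α/(α|α)) π(α^∨)ⁿ s_α`. -/
noncomputable def rootTerm (i : ι) (n : ℕ) : RCA P := B.par i * (B.xr i ^ n * RCA.refl i)

theorem rootTerm_neg (i : ι) (n : ℕ) :
    B.rootTerm (P.reflectionPerm i i) n = (-1 : ℂ) ^ n • B.rootTerm i n := by
  rw [rootTerm, par_reflectionPerm, xr_neg, RCA.refl_neg, ← neg_one_smul ℂ, smul_pow,
    smul_mul_assoc, mul_smul_comm, rootTerm]

theorem wM_mul_rootTerm (g : P.weylGroup) (i : ι) (n : ℕ) :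
    RCA.wM P g * B.rootTerm i n = B.rootTerm (P.weylGroupToPerm g i) n * RCA.wM P g := by
  rw [rootTerm, rootTerm, ← mul_assoc, ← (B.commute_par i _).eq, mul_assoc, ← mul_assoc (RCA.wM P g),
    wM_mul_xr_pow, mul_assoc, RCA.wM_mul_refl, par_perm, mul_assoc, mul_assoc]

/-- [π(μ), s_α] = (π(μ) - s_α π(μ)) s_α = α(μ) π(α^∨) s_α, and the powers of π(α^∨) commute with
π(μ). -/
theorem adL_xr_pow_mul_refl (μ : H) (i : ι) (n : ℕ) :
    adL (RCA.xL P (B.iso μ)) (B.xr i ^ n * RCA.refl i) =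
      P.root' i μ • (B.xr i ^ (n + 1) * RCA.refl i) := by
  have h : RCA.refl i * RCA.xL P (B.iso μ) =
      RCA.xL P (B.iso μ) * RCA.refl i - P.root' i μ • (B.xr i * RCA.refl i) := by
    rw [RCA.refl_mul_xL, map_sub, map_smul, coroot'_iso, xr, iso_coroot, map_smul, sub_mul,
      smul_mul_assoc, smul_mul_assoc, smul_smul, mul_comm (B.len i)]
  have h1 : RCA.xL P (B.iso μ) * B.xr i ^ n = B.xr i ^ n * RCA.xL P (B.iso μ) :=
    ((RCA.commute_xL _ _).pow_right n).eq
  rw [adL_apply, ← mul_assoc, h1, mul_assoc, mul_assoc, ← mul_sub, h, sub_sub_cancel,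
    mul_smul_comm, pow_succ, mul_assoc]

theorem adL_rootTerm (μ : H) (i : ι) (n : ℕ) :
    adL (RCA.xL P (B.iso μ)) (B.rootTerm i n) = P.root' i μ • B.rootTerm i (n + 1) := by
  rw [rootTerm, adL_apply, ← mul_assoc, ← (B.commute_par i _).eq, mul_assoc, mul_assoc, ← mul_sub,
    ← adL_apply, adL_xr_pow_mul_refl, mul_smul_comm, rootTerm]

theorem adL_iterate_rootTerm (μ : H) (i : ι) (n m : ℕ) :
    (adL (RCA.xL P (B.iso μ)))^[m] (B.rootTerm i n) = P.root' i μ ^ m • B.rootTerm i (n + m) := by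
  induction m with
  | zero => simp
  | succ m ih =>
    rw [Function.iterate_succ_apply', ih, map_smul, adL_rootTerm, smul_smul, pow_succ, add_assoc]

/-- The case μ = α^∨/2, where α(μ) = 1; this is the reason for the factor 1/2 in the connection. -/
theorem adL_half_iterate_refl (i : ι) (m : ℕ) :
    (adL ((1 / 2 : ℂ) • B.xr i))^[m] (RCA.refl i) = B.xr i ^ m * RCA.refl i := by
  have h : (1 / 2 : ℂ) • B.xr i = RCA.xL P (B.iso ((1 / 2 : ℂ) • P.coroot i)) := by
    rw [map_smul, map_smul, xr]
  induction m with
  | zero => simp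
  | succ m ih =>
    rw [Function.iterate_succ_apply', ih, h, adL_xr_pow_mul_refl, map_smul,
      RootPairing.root'_coroot_eq_pairing, RootPairing.pairing_same, smul_eq_mul,
      one_div_mul_cancel two_ne_zero, one_smul]

theorem yL_mul_rootTerm_zero (u : H) (i : ι) :
    RCA.yL P u * B.rootTerm i 0 - B.rootTerm i 0 * RCA.yL P u =
      P.root' i u • (B.par i * (RCA.yL P (P.coroot i) * RCA.refl i)) := by
  rw [rootTerm, pow_zero, one_mul, ← mul_assoc, ← (B.commute_par i _).eq, mul_assoc, mul_assoc,
    RCA.refl_mul_yL, map_sub, map_smul, sub_mul, mul_sub, sub_sub_cancel, smul_mul_assoc,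
    mul_smul_comm]

end NormalizedForm

section Fintype

variable [Fintype ι] {P : RootPairing ι ℂ V H} {θ : ι} (B : NormalizedForm P θ) [P.IsRootSystem]

open Classical in
theorem yL_mul_xL_iso_sub [P.IsReduced] (b : P.Base) (u μ : H) :
    RCA.yL P u * RCA.xL P (B.iso μ) - RCA.xL P (B.iso μ) * RCA.yL P u =
      B.form μ u • RCA.of P .hbar -
        ∑ i with b.IsPos i, (P.root' i u * P.root' i μ) • B.rootTerm i 0 := by
  rw [RCA.yL_mul_xL_sub b, B.iso_apply]
  refine congrArg₂ _ rfl (Finset.sum_congr rfl fun i _ => ?_)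
  rw [B.coroot'_iso, NormalizedForm.rootTerm, NormalizedForm.par, pow_zero, one_mul,
    smul_mul_assoc, smul_smul]
  congr 1
  ring

theorem yL_mul_xr_sub [P.IsReduced] (b : P.Base) (u : H) (i : ι) :
    RCA.yL P u * B.xr i - B.xr i * RCA.yL P u = (B.len i * P.root' i u) • RCA.of P .hbar -
      (1 / 2 : ℂ) • ∑ j, (P.root' j u * P.pairing j i) • B.rootTerm j 0 := by
  classical
  rw [NormalizedForm.xr, yL_mul_xL_iso_sub B b, B.form_coroot, sum_isPos_eq b]
  · simp only [RootPairing.root'_coroot_eq_pairing]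
  · intro j
    rw [root'_neg, root'_neg, neg_mul_neg, B.rootTerm_neg, pow_zero, one_smul]

theorem yL_mul_xr_pow_sub [P.IsReduced] (b : P.Base) (u : H) (i : ι) (n : ℕ) :
    RCA.yL P u * B.xr i ^ n - B.xr i ^ n * RCA.yL P u =
      ∑ k ∈ Finset.range n, B.xr i ^ k * ((B.len i * P.root' i u) • RCA.of P .hbar -
        (1 / 2 : ℂ) • ∑ j, (P.root' j u * P.pairing j i) • B.rootTerm j 0) *
          B.xr i ^ (n - 1 - k) := by
  rw [← yL_mul_xr_sub B b]
  induction n with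
  | zero => simp
  | succ n ih =>
    rw [Finset.sum_range_succ, Nat.add_sub_cancel, Nat.sub_self, pow_zero, mul_one]
    have h : ∀ k ∈ Finset.range n, B.xr i ^ k * (RCA.yL P u * B.xr i - B.xr i * RCA.yL P u) *
        B.xr i ^ (n - k) = B.xr i ^ k * (RCA.yL P u * B.xr i - B.xr i * RCA.yL P u) *
        B.xr i ^ (n - 1 - k) * B.xr i := by
      intro k hk
      rw [Finset.mem_range] at hk
      rw [mul_assoc _ (B.xr i ^ (n - 1 - k)), ← pow_succ]
      congr 2
      omega
    rw [Finset.sum_congr rfl h, ← Finset.sum_mul, ← ih, pow_succ]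
    noncomm_ring

end Fintype

end KZB

open Finset.HasAntidiagonal (antidiagonal)

namespace KZB

variable {ι V H : Type*} [AddCommGroup V] [Module ℂ V] [AddCommGroup H] [Module ℂ H]
  {P : RootPairing ι ℂ V H}

/-! ### Components of the connection form -/

theorem component_of (a : RCAGen P) (n : ℕ) :
    component n (RCAHat.of P a) = if n = a.deg then RCA.of P a else 0 :=
  component_homog n _ _ _

theorem component_c_mul_of_lt (C : ReflClass P) (f : RCAHat P) {n : ℕ} (h : n < 2) :
    component n (RCAHat.of P (.c C) * f) = 0 :=
  component_homog_mul_of_lt h _ _ _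

/-- The element `∑ uⁱ duᵢ (u) = u` of the completion. -/
theorem sum_coord_smul_y {κ : Type*} [Fintype κ] (e : Module.Basis κ ℂ H) (u : H) :
    (∑ j, (e.coord j).smulRight (RCAHat.of P (.y (e j)))) u = RCAHat.of P (.y u) := by
  refine component_ext fun n => ?_
  rw [← componentL_apply, LinearMap.sum_apply, map_sum]
  simp only [LinearMap.smulRight_apply, map_smul, componentL_apply, component_of]
  change ∑ j, e.coord j u • (if n = 1 then RCA.yL P (e j) else 0) = if n = 1 then RCA.yL P u else 0
  split_ifs
  · simp only [← map_smul, ← map_sum]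
    exact congrArg _ (e.sum_repr u)
  · simp

variable [Fintype ι] [P.IsRootSystem] {θ : ι} (b : P.Base) (B : NormalizedForm P θ)

/-- The part of the connection form that involves the roots, for arbitrary coefficients. -/
noncomputable def rootForm [DecidablePred b.IsPos] (κ : ι → ℕ → ℂ) (φ : ι → ℂ) : H →ₗ[ℂ] RCAHat P :=
  ∑ i with b.IsPos i, (P.root' i).smulRight
      ((2 / B.normSq (P.root i)) • (RCAHat.of P (.c (reflClass (reflOf P i))) *
        adSeries (κ i) ((1 / 2 : ℂ) • RCAHat.of P (.x (B.iso (P.coroot i))))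
          (RCAHat.of P (.w (reflOf P i).1)))) -
    ∑ i with b.IsPos i, (P.root' i).smulRight
      ((1 / (dualCoxeter b θ : ℂ) * φ i) • RCAHat.of P .hbar)

theorem component_adSeries_refl (κ : ℕ → ℂ) (i : ι) (n : ℕ) :
    component n (adSeries κ ((1 / 2 : ℂ) • RCAHat.of P (.x (B.iso (P.coroot i))))
      (RCAHat.of P (.w (reflOf P i).1))) = κ n • (B.xr i ^ n * RCA.refl i) := by
  rw [component_adSeries (a := (1 / 2 : ℂ) • B.xr i), Finset.sum_eq_single (n, 0)]
  · rw [component_of, if_pos (show (n, 0).2 = (RCAGen.w (reflOf P i).1 : RCAGen P).deg from rfl)]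
    exact congrArg _ (B.adL_half_iterate_refl i n)
  · rintro ⟨p, q⟩ hp hne
    rw [Finset.HasAntidiagonal.mem_antidiagonal] at hp
    rw [component_of, if_neg, iterate_map_zero, smul_zero]
    rintro (rfl : q = 0)
    exact hne (by rw [← hp]; rfl)
  · intro h
    exact absurd (Finset.HasAntidiagonal.mem_antidiagonal.2 (Nat.add_zero n)) h
  · refine PowerSeries.ext fun k => ?_
    change PowerSeries.coeff k ((1 / 2 : ℂ) • PowerSeries.monomial 1 (B.xr i)) = _
    rw [PowerSeries.coeff_smul, PowerSeries.coeff_monomial, PowerSeries.coeff_monomial]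
    split_ifs
    · rfl
    · rw [smul_zero]

theorem component_c_mul_adSeries (κ : ℕ → ℂ) (i : ι) (n : ℕ) :
    component (n + 2) ((2 / B.normSq (P.root i)) • (RCAHat.of P (.c (reflClass (reflOf P i))) *
        adSeries κ ((1 / 2 : ℂ) • RCAHat.of P (.x (B.iso (P.coroot i))))
          (RCAHat.of P (.w (reflOf P i).1)))) = κ n • B.rootTerm i n := by
  rw [← componentL_apply, map_smul, componentL_apply]
  refine (congrArg _ (component_homog_mul 2 n _ _ _)).trans ?_
  rw [component_adSeries_refl, B.two_div_normSq, NormalizedForm.rootTerm, NormalizedForm.par,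
    mul_smul_comm, smul_mul_assoc, smul_comm]

variable [DecidablePred b.IsPos]

theorem component_rootForm_of_lt (κ : ι → ℕ → ℂ) (φ : ι → ℂ) (u : H) {n : ℕ} (h : n < 2) :
    component n (rootForm b B κ φ u) = 0 := by
  rw [← componentL_apply, rootForm]
  simp only [LinearMap.sub_apply, LinearMap.sum_apply, LinearMap.smulRight_apply, map_sub, map_sum,
    map_smul, componentL_apply, component_c_mul_of_lt _ _ h, component_of]
  rw [if_neg (show ¬ n = (RCAGen.hbar : RCAGen P).deg from h.ne)]
  simp

theorem component_rootForm_add_two (κ : ι → ℕ → ℂ) (φ : ι → ℂ) (u : H) (n : ℕ) :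
    component (n + 2) (rootForm b B κ φ u) =
      ∑ i with b.IsPos i, (P.root' i u * κ i n) • B.rootTerm i n -
        if n = 0 then (1 / (dualCoxeter b θ : ℂ) * ∑ i with b.IsPos i, P.root' i u * φ i) •
          RCA.of P .hbar else 0 := by
  rw [← componentL_apply, rootForm, LinearMap.sub_apply, LinearMap.sum_apply, LinearMap.sum_apply,
    map_sub, map_sum, map_sum]
  refine congrArg₂ _ (Finset.sum_congr rfl fun i _ => ?_) ?_
  · rw [LinearMap.smulRight_apply, map_smul, componentL_apply, component_c_mul_adSeries, smul_smul]
  · simp only [LinearMap.smulRight_apply, map_smul, componentL_apply, component_of]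
    split_ifs with h1 h2 h2
    · rw [Finset.mul_sum, Finset.sum_smul]
      refine Finset.sum_congr rfl fun i _ => ?_
      rw [smul_smul]
      congr 1
      ring
    · exact absurd (Nat.add_eq_right.1 h1) h2
    · exact absurd (Nat.add_eq_right.2 h2) h1
    · simp

theorem rcaForm_apply {κ : Type*} [Fintype κ] (e : Module.Basis κ ℂ H) (τ : ℍ) (z u : H) : rcaForm b B e τ z u =
    rootForm b B (fun i => kCoeff τ (P.root' i z))
      (fun i => deriv (theta τ) (P.root' i z) / theta τ (P.root' i z)) u + RCAHat.of P (.y u) := by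
  rw [← sum_coord_smul_y e u, ← LinearMap.add_apply]
  congr 1
  unfold rcaForm rootForm
  congr!

end KZB

open Finset.HasAntidiagonal (antidiagonal)

namespace KZB

variable {ι V H : Type*} [AddCommGroup V] [Module ℂ V] [AddCommGroup H] [Module ℂ H]
  {P : RootPairing ι ℂ V H}

theorem regular_theta_ne_zero {τ : ℍ} {z : H} (hz : z ∈ regular P τ) (i : ι) :
    theta τ (P.root' i z) ≠ 0 :=
  fun h => hz i ((theta_eq_zero_iff τ _).1 h)

theorem wAct_mem_regular {τ : ℍ} {z : H} (hz : z ∈ regular P τ) (g : P.weylGroup) :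
    wAct P g z ∈ regular P τ := by
  intro i
  obtain ⟨j, rfl⟩ := (P.weylGroupToPerm g).surjective i
  rw [root'_perm]
  exact hz j

theorem component_conj (g : P.weylGroup) (f : RCAHat P) (n : ℕ) :
    component n (RCAHat.of P (.w g) * f * RCAHat.of P (.w g⁻¹)) =
      RCA.wM P g * component n f * RCA.wM P g⁻¹ :=
  (component_mul_homog 0 n _ _ _).trans (congrArg (· * _) (component_homog_mul 0 n _ _ _))

theorem root'_mul_kCoeff_zero_neg {τ : ℍ} {z : H} (hz : z ∈ regular P τ) (u : H) (i : ι) :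
    P.root' (P.reflectionPerm i i) u * kCoeff τ (P.root' (P.reflectionPerm i i) z) 0 =
      P.root' i u * kCoeff τ (P.root' i z) 0 := by
  rw [root'_neg, root'_neg, kCoeff_neg (regular_theta_ne_zero hz i)]
  ring

theorem adL_iterate_hbar (a : RCA P) (r : ℂ) {m : ℕ} (hm : m ≠ 0) :
    (adL a)^[m] (r • RCA.of P .hbar) = 0 := by
  obtain ⟨m, rfl⟩ := Nat.exists_eq_succ_of_ne_zero hm
  rw [Function.iterate_succ_apply, map_smul, adL_apply, ((RCA.commute_hbar a).eq), sub_self,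
    smul_zero, iterate_map_zero]

/-! ### Equivariance -/

section Equivariance

variable [Fintype ι] [P.IsRootSystem] {θ : ι} (b : P.Base) (B : NormalizedForm P θ)

/-- The signs from α(u), k_n(-z) = (-1)^{n+1} k_n(z) and π(-α^∨)^n cancel, so the sum over positive
roots may be symmetrised. -/
theorem kCoeff_rootTerm_neg {τ : ℍ} {z : H} (hz : z ∈ regular P τ) (u : H) (n : ℕ) (i : ι) :
    (P.root' (P.reflectionPerm i i) u * kCoeff τ (P.root' (P.reflectionPerm i i) z) n) •
      B.rootTerm (P.reflectionPerm i i) n =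
    (P.root' i u * kCoeff τ (P.root' i z) n) • B.rootTerm i n := by
  rw [root'_neg, root'_neg, kCoeff_neg (regular_theta_ne_zero hz i), B.rootTerm_neg, smul_smul]
  congr 1
  have : ((-1 : ℂ) ^ n) * (-1) ^ n = 1 := by rw [← mul_pow]; simp
  rw [pow_succ]
  linear_combination (P.root' i u * kCoeff τ (P.root' i z) n) * this

open Classical in
/-- The components of the connection form, as sums over all roots. -/
theorem component_rcaForm_add_two {κ : Type*} [Fintype κ] (e : Module.Basis κ ℂ H) {τ : ℍ} {z : H}
    (hz : z ∈ regular P τ) (u : H) (n : ℕ) :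
    component (n + 2) (rcaForm b B e τ z u) =
      (1 / 2 : ℂ) • ∑ i, (P.root' i u * kCoeff τ (P.root' i z) n) • B.rootTerm i n -
        if n = 0 then (1 / (dualCoxeter b θ : ℂ) *
          ((1 / 2 : ℂ) • ∑ i, P.root' i u * kCoeff τ (P.root' i z) 0)) • RCA.of P .hbar
        else 0 := by
  rw [rcaForm_apply, ← componentL_apply, map_add, componentL_apply, componentL_apply,
    component_of, if_neg (show ¬ n + 2 = (RCAGen.y u : RCAGen P).deg from by simp [RCAGen.deg]),
    add_zero, component_rootForm_add_two]
  simp only [← kCoeff_zero (regular_theta_ne_zero hz _)]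
  rw [sum_isPos_eq b _ (kCoeff_rootTerm_neg B hz u n),
    sum_isPos_eq b _ (root'_mul_kCoeff_zero_neg hz u)]

open Classical in
theorem component_rcaForm_of_lt {κ : Type*} [Fintype κ] (e : Module.Basis κ ℂ H) (τ : ℍ) (z u : H)
    {n : ℕ} (hn : n < 2) :
    component n (rcaForm b B e τ z u) = if n = 1 then RCA.yL P u else 0 := by
  rw [rcaForm_apply, ← componentL_apply, map_add, componentL_apply, componentL_apply,
    component_of, component_rootForm_of_lt b B _ _ _ hn, zero_add]
  rfl

/-- Conjugation by w permutes the summands of the sum over all roots, in the same way as moving z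
and u by w does; ħ is central. -/
theorem isWEquivariantOn_rcaForm {κ : Type*} [Fintype κ] (e : Module.Basis κ ℂ H) (τ : ℍ) :
    IsWEquivariantOn (regular P τ) (rcaForm b B e τ) := by
  intro g z hz u
  have hg : RCA.wM P g * RCA.wM P g⁻¹ = 1 := by rw [← map_mul, mul_inv_cancel, map_one]
  refine component_ext fun n => ?_
  rw [component_conj]
  rcases lt_or_ge n 2 with hn | hn
  · rw [component_rcaForm_of_lt b B e τ _ _ hn, component_rcaForm_of_lt b B e τ _ _ hn]
    split_ifs
    · rw [RCA.wM_mul_yL, mul_assoc, hg, mul_one]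
    · rw [mul_zero, zero_mul]
  · obtain ⟨n, rfl⟩ := Nat.exists_eq_add_of_le' hn
    rw [component_rcaForm_add_two b B e hz, component_rcaForm_add_two b B e (wAct_mem_regular hz g)]
    rw [← Equiv.sum_comp (P.weylGroupToPerm g), ← Equiv.sum_comp (P.weylGroupToPerm g)
      (fun i => P.root' i (wAct P g u) * kCoeff τ (P.root' i (wAct P g z)) 0)]
    simp only [root'_perm]
    rw [mul_sub, sub_mul, mul_smul_comm (1 / 2 : ℂ) (RCA.wM P g), smul_mul_assoc, Finset.mul_sum, Finset.sum_mul]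
    congr 1
    · congr 1
      refine Finset.sum_congr rfl fun i _ => ?_
      rw [mul_smul_comm, smul_mul_assoc, B.wM_mul_rootTerm, mul_assoc, hg, mul_one]
    · split_ifs
      · rw [mul_smul_comm _ (RCA.wM P g), ← (RCA.commute_hbar _).eq, smul_mul_assoc, mul_assoc, hg, mul_one]
      · rw [mul_zero, zero_mul]

end Equivariance

/-! ### Descent to the torus -/

section Descent

variable [Fintype ι] [P.IsRootSystem] {θ : ι} (b : P.Base) (B : NormalizedForm P θ)
  {κ : Type*} [Fintype κ] (e : Module.Basis κ ℂ H)

theorem rcaForm_add_coweight {τ : ℍ} {z : H} (hz : z ∈ regular P τ) {μ : H}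
    (hμ : IsCoweight P μ) (u : H) : rcaForm b B e τ (z + μ) u = rcaForm b B e τ z u := by
  classical
  have h1 : ∀ i, kCoeff τ (P.root' i (z + μ)) = kCoeff τ (P.root' i z) := by
    intro i
    funext j
    obtain ⟨m, hm⟩ := hμ i
    rw [map_add, hm, kCoeff_add_int (regular_theta_ne_zero hz i)]
  have h2 : ∀ i, theta τ (P.root' i (z + μ)) ≠ 0 := by
    intro i
    obtain ⟨m, hm⟩ := hμ i
    have := theta_add_lattice_ne_zero (regular_theta_ne_zero hz i) m 0
    rwa [Int.cast_zero, zero_mul, add_zero, ← hm, ← map_add] at this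
  rw [rcaForm_apply, rcaForm_apply]
  simp only [← kCoeff_zero (h2 _), ← kCoeff_zero (regular_theta_ne_zero hz _), h1]

open Classical in
theorem adL_iterate_sum_rootTerm (μ : H) (f : ι → ℂ) (n m : ℕ) :
    (adL (RCA.xL P (B.iso μ)))^[m] (∑ i with b.IsPos i, f i • B.rootTerm i n) =
      ∑ i with b.IsPos i, (f i * P.root' i μ ^ m) • B.rootTerm i (n + m) := by
  rw [← Module.End.pow_apply, map_sum]
  refine Finset.sum_congr rfl fun i _ => ?_
  rw [map_smul, Module.End.pow_apply, B.adL_iterate_rootTerm, smul_smul]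

-- The first bracket is the commutator [π(μ), u]; each further one multiplies the summand of α by
-- α(μ)π(α^∨) and kills ħ. These terms become the inhomogeneous part of the transformation law of k.
open Classical in
theorem adL_iterate_yL [P.IsReduced] (μ u : H) (m : ℕ) :
    (adL (RCA.xL P (B.iso μ)))^[m + 1] (RCA.yL P u) =
      ∑ i with b.IsPos i, (P.root' i u * P.root' i μ ^ (m + 1)) • B.rootTerm i m -
        if m = 0 then B.form μ u • RCA.of P .hbar else 0 := by
  have h : adL (RCA.xL P (B.iso μ)) (RCA.yL P u) =
      ∑ i with b.IsPos i, (P.root' i u * P.root' i μ) • B.rootTerm i 0 -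
        B.form μ u • RCA.of P .hbar := by
    rw [adL_apply, ← neg_sub, yL_mul_xL_iso_sub B b, neg_sub]
  rw [Function.iterate_succ_apply, h, iterate_map_sub, adL_iterate_sum_rootTerm, zero_add]
  congr 1
  · refine Finset.sum_congr rfl fun i _ => ?_
    rw [pow_succ', mul_assoc]
  · split_ifs with hm
    · rw [hm, Function.iterate_zero_apply]
    · exact adL_iterate_hbar _ _ hm

open Classical in
theorem adL_iterate_component_rootForm (c : ι → ℕ → ℂ) (φ : ι → ℂ) (μ u : H) (n m : ℕ) :
    (adL (RCA.xL P (B.iso μ)))^[m] (component (n + 2) (rootForm b B c φ u)) =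
      ∑ i with b.IsPos i, (P.root' i u * c i n * P.root' i μ ^ m) • B.rootTerm i (n + m) -
        if n = 0 ∧ m = 0 then (1 / (dualCoxeter b θ : ℂ) *
          ∑ i with b.IsPos i, P.root' i u * φ i) • RCA.of P .hbar else 0 := by
  rw [component_rootForm_add_two, iterate_map_sub, adL_iterate_sum_rootTerm]
  congr 1
  by_cases hn : n = 0
  · by_cases hm : m = 0
    · rw [if_pos hn, if_pos ⟨hn, hm⟩, hm, Function.iterate_zero_apply]
    · rw [if_pos hn, if_neg fun h => hm h.2]
      exact adL_iterate_hbar _ _ hm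
  · rw [if_neg hn, if_neg fun h => hn h.1, iterate_map_zero]

theorem rcaForm_add_tau_smul_coweight [P.IsCrystallographic] [P.IsReduced] [P.IsIrreducible]
    (hθ : IsHighestRoot b θ) {τ : ℍ} {z : H}
    (hz : z ∈ regular P τ) {μ : H} (hμ : IsCoweight P μ) (u : H) :
    rcaForm b B e τ (z + (τ : ℂ) • μ) u =
      adSeries (fun m => (-2 * Real.pi * Complex.I) ^ m / (m.factorial : ℂ))
        (RCAHat.of P (.x (B.iso μ))) (rcaForm b B e τ z u) := by
  classical
  set c : ℕ → ℂ := fun m => (-2 * Real.pi * Complex.I) ^ m / (m.factorial : ℂ) with hc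
  have h1 : ∀ i j, kCoeff τ (P.root' i (z + (τ : ℂ) • μ)) j =
      c (j + 1) * P.root' i μ ^ (j + 1) +
        ∑ p ∈ antidiagonal j, c p.1 * P.root' i μ ^ p.1 * kCoeff τ (P.root' i z) p.2 := by
    intro i j
    obtain ⟨m, hm⟩ := hμ i
    have h0 : ∀ k, (-(2 * Real.pi * Complex.I * m)) ^ k / (k.factorial : ℂ) =
        c k * (m : ℂ) ^ k := by
      intro k
      rw [hc, div_mul_eq_mul_div, ← mul_pow]
      congr 2
      ring
    rw [map_add, map_smul, hm, smul_eq_mul, mul_comm (τ : ℂ),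
      kCoeff_add_int_mul_tau (regular_theta_ne_zero hz i), h0]
    simp only [h0]
  have h2 : ∀ i, theta τ (P.root' i (z + (τ : ℂ) • μ)) ≠ 0 := by
    intro i
    obtain ⟨m, hm⟩ := hμ i
    have := theta_add_lattice_ne_zero (regular_theta_ne_zero hz i) 0 m
    rwa [Int.cast_zero, zero_add, ← hm, mul_comm, ← smul_eq_mul, ← map_smul, ← map_add] at this
  have hX : (RCAHat.of P (.x (B.iso μ))).1 = PowerSeries.monomial 1 (RCA.xL P (B.iso μ)) := rfl
  refine component_ext fun n => ?_
  rw [component_adSeries hX]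
  rcases lt_or_ge n 2 with hn | hn
  · rw [component_rcaForm_of_lt b B e _ _ _ hn]
    have : n = 0 ∨ n = 1 := by omega
    rcases this with rfl | rfl
    · simp [component_rcaForm_of_lt b B e]
    · rw [Finset.Nat.sum_antidiagonal_succ']
      simp [component_rcaForm_of_lt b B e, hc]
  obtain ⟨n, rfl⟩ := Nat.exists_eq_add_of_le' hn
  -- The contributions of the components of ω of degrees 0 and 1 are split off: the former vanishes,
  -- and the latter is y(u) with n + 1 brackets.
  rw [Finset.Nat.sum_antidiagonal_succ', Finset.Nat.sum_antidiagonal_succ']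
  dsimp only
  have hy : ∀ z k, component (k + 1 + 1) (rcaForm b B e τ z u) =
      component (k + 2) (rootForm b B (fun i => kCoeff τ (P.root' i z))
        (fun i => deriv (theta τ) (P.root' i z) / theta τ (P.root' i z)) u) := by
    intro z k
    rw [rcaForm_apply, ← componentL_apply, map_add, componentL_apply, componentL_apply,
      component_of, if_neg (by simp [RCAGen.deg]), add_zero]
  rw [component_rcaForm_of_lt b B e _ _ _ Nat.two_pos,
    component_rcaForm_of_lt b B e _ _ _ (show 0 + 1 < 2 by omega), if_neg zero_ne_one, if_pos rfl, iterate_map_zero, smul_zero, zero_add, adL_iterate_yL b B]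
  simp only [hy, adL_iterate_component_rootForm]
  have hsum : ∀ i, ∑ p ∈ antidiagonal n, c p.1 • (P.root' i u * kCoeff τ (P.root' i z) p.2 *
      P.root' i μ ^ p.1) • B.rootTerm i (p.2 + p.1) = 
      (P.root' i u * ∑ p ∈ antidiagonal n, c p.1 * P.root' i μ ^ p.1 * kCoeff τ (P.root' i z) p.2) •
        B.rootTerm i n := by
    intro i
    rw [Finset.mul_sum, Finset.sum_smul]
    refine Finset.sum_congr rfl fun p hp => ?_
    rw [Finset.HasAntidiagonal.mem_antidiagonal] at hp
    rw [add_comm p.2, hp, smul_smul]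
    congr 1
    ring
  have hphi : ∀ φ : ℂ, ∑ p ∈ antidiagonal n, c p.1 • (if p.2 = 0 ∧ p.1 = 0 then
      φ • RCA.of P .hbar else 0) = if n = 0 then φ • RCA.of P .hbar else 0 := by
    intro φ
    split_ifs with hn
    · subst hn
      simp [hc]
    · refine Finset.sum_eq_zero fun p hp => ?_
      rw [Finset.HasAntidiagonal.mem_antidiagonal] at hp
      rw [if_neg (by omega), smul_zero]
  simp only [smul_sub, Finset.sum_sub_distrib, Finset.smul_sum]
  rw [Finset.sum_comm, Finset.sum_congr rfl fun i _ => hsum i, hphi, component_rootForm_add_two]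
  simp only [← kCoeff_zero (h2 _), ← kCoeff_zero (regular_theta_ne_zero hz _), h1]
  have hA : ∑ i with b.IsPos i, (P.root' i u * (c (n + 1) * P.root' i μ ^ (n + 1) +
      ∑ p ∈ antidiagonal n, c p.1 * P.root' i μ ^ p.1 * kCoeff τ (P.root' i z) p.2)) •
        B.rootTerm i n =
      ∑ i with b.IsPos i, c (n + 1) • (P.root' i u * P.root' i μ ^ (n + 1)) • B.rootTerm i n +
      ∑ i with b.IsPos i, (P.root' i u * ∑ p ∈ antidiagonal n,
        c p.1 * P.root' i μ ^ p.1 * kCoeff τ (P.root' i z) p.2) • B.rootTerm i n := by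
    rw [← Finset.sum_add_distrib]
    refine Finset.sum_congr rfl fun i _ => ?_
    rw [smul_smul, ← add_smul]
    congr 1
    ring
  -- The quadratic identity turns (1/h^∨) ∑ α(u)α(μ) into (μ|u), the coefficient of ħ in the
  -- commutator of π(μ) and u. The normalisation by h^∨ is forced here.
  have hB : (1 / (dualCoxeter b θ : ℂ)) * ∑ i with b.IsPos i, P.root' i u *
      (c (0 + 1) * P.root' i μ ^ (0 + 1) + ∑ p ∈ antidiagonal 0,
        c p.1 * P.root' i μ ^ p.1 * kCoeff τ (P.root' i z) p.2) =
      c (0 + 1) * B.form μ u +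
        1 / (dualCoxeter b θ : ℂ) * ∑ i with b.IsPos i, P.root' i u * kCoeff τ (P.root' i z) 0 := by
    have h0 := sum_root'_mul_root' hθ B μ u
    have h3 := hθ.dualCoxeter_ne_zero
    have h4 : B.form μ u = 1 / (dualCoxeter b θ : ℂ) *
      ∑ i with b.IsPos i, P.root' i μ * P.root' i u := by
      rw [h0]
      field_simp
    rw [h4, mul_left_comm, ← mul_add]
    congr 1
    rw [Finset.mul_sum, ← Finset.sum_add_distrib]
    refine Finset.sum_congr rfl fun i _ => ?_
    simp [hc]
    ring
  rw [hA, hB]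
  split_ifs with hn
  · subst hn
    rw [add_smul, ← smul_smul]
    abel
  · simp

theorem descendsToTorus_rcaForm [P.IsCrystallographic] [P.IsReduced] [P.IsIrreducible]
    (hθ : IsHighestRoot b θ) (τ : ℍ) : DescendsToTorus B τ (rcaForm b B e τ) :=
  fun _ hz _ hμ u =>
    ⟨rcaForm_add_coweight b B e hz hμ u, rcaForm_add_tau_smul_coweight b B e hθ hz hμ u⟩

end Descent

end KZB

open Finset.HasAntidiagonal (antidiagonal)

namespace KZB

variable {ι V H : Type*} [AddCommGroup V] [Module ℂ V] [AddCommGroup H] [Module ℂ H]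
  {P : RootPairing ι ℂ V H}

/-! ### Derivatives of the connection form -/

theorem hasDerivAt_comp_root' {f : ℂ → ℂ} {z : H} {i : ι}
    (hf : DifferentiableAt ℂ f (P.root' i z)) (u : H) :
    HasDerivAt (fun s : ℂ => f (P.root' i (z + s • u)))
      (P.root' i u * deriv f (P.root' i z)) 0 := by
  have h1 : HasDerivAt (fun s : ℂ => P.root' i (z + s • u)) (P.root' i u) 0 := by
    have := ((hasDerivAt_id (0 : ℂ)).mul_const (P.root' i u)).const_add (P.root' i z)
    simpa using this
  have h2 := HasDerivAt.comp_of_eq 0 hf.hasDerivAt h1 (by simp)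
  rw [mul_comm]
  exact h2

variable [Fintype ι] [P.IsRootSystem] {θ : ι} (b : P.Base) (B : NormalizedForm P θ)
  {κ : Type*} [Fintype κ] (e : Module.Basis κ ℂ H)

/-- The derivative of the connection form evaluated at a vector. -/
noncomputable def derivForm [DecidablePred b.IsPos] (τ : ℍ) (z u : H) : H →ₗ[ℂ] RCAHat P :=
  rootForm b B (fun i n => P.root' i u * deriv (fun w => kCoeff τ w n) (P.root' i z))
    (fun i => P.root' i u * deriv (fun w => deriv (theta τ) w / theta τ w) (P.root' i z))

theorem hasDirDeriv_rcaForm [DecidablePred b.IsPos] {τ : ℍ} {z : H} (hz : z ∈ regular P τ)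
    (u v : H) :
    HasDirDeriv (fun z' => rcaForm b B e τ z' v) (derivForm b B τ z u v) u z := by
  intro n l
  rcases lt_or_ge n 2 with hn | hn
  · simp only [component_rcaForm_of_lt b B e _ _ _ hn]
    rw [derivForm, component_rootForm_of_lt b B _ _ _ hn, map_zero]
    exact hasDerivAt_const _ _
  obtain ⟨n, rfl⟩ := Nat.exists_eq_add_of_le' hn
  have hy : component (n + 2) (RCAHat.of P (.y v)) = 0 := by
    rw [component_of, if_neg (by simp [RCAGen.deg])]
  have h : ∀ z', component (n + 2) (rcaForm b B e τ z' v) =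
      component (n + 2) (rootForm b B (fun i => kCoeff τ (P.root' i z'))
        (fun i => deriv (theta τ) (P.root' i z') / theta τ (P.root' i z')) v) := by
    intro z'
    rw [rcaForm_apply, ← componentL_apply, map_add, componentL_apply, componentL_apply, hy,
      add_zero]
  simp only [h, derivForm, component_rootForm_add_two, map_sub, map_sum, map_smul, smul_eq_mul]
  refine HasDerivAt.fun_sub (HasDerivAt.fun_sum fun i _ => ?_) ?_
  · exact ((hasDerivAt_comp_root' (differentiableAt_kCoeff (regular_theta_ne_zero hz i) n)
      u).const_mul _).mul_const _
  · split_ifs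
    · simp only [map_smul, smul_eq_mul]
      refine ((HasDerivAt.fun_sum fun i _ => ?_).const_mul _).mul_const _
      refine (hasDerivAt_comp_root' (f := fun w => deriv (theta τ) w / theta τ w) ?_ u).const_mul _
      exact (((differentiable_theta τ).deriv) _).div (differentiable_theta τ _)
        (regular_theta_ne_zero hz i)
    · simp only [map_zero]
      exact hasDerivAt_const _ _

/-- Each summand is a function of α(z) times dα, so its derivative contains the symmetric factor
α(u)α(v). Thus dω = 0. -/
theorem derivForm_comm [DecidablePred b.IsPos] (τ : ℍ) (z u v : H) :
    derivForm b B τ z u v = derivForm b B τ z v u := by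
  refine component_ext fun n => ?_
  rcases lt_or_ge n 2 with hn | hn
  · rw [derivForm, derivForm, component_rootForm_of_lt b B _ _ _ hn,
      component_rootForm_of_lt b B _ _ _ hn]
  obtain ⟨n, rfl⟩ := Nat.exists_eq_add_of_le' hn
  simp only [derivForm, component_rootForm_add_two, mul_left_comm (P.root' _ v)]

/-! ### The curvature -/

section Curvature

/-- The part of the degree `n + 2` component of the connection form without `ħ`. -/
noncomputable def rootSum (k : ι → ℕ → ℂ) (n : ℕ) (u : H) : RCA P :=
  (1 / 2 : ℂ) • ∑ i, (P.root' i u * k i n) • B.rootTerm i n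

/-- [u, s_α] is α(u) times an element independent of u, so the bracket of u with the summand α(v)s_α
is symmetric in u and v. -/
theorem yL_mul_rootSum_zero (k : ι → ℕ → ℂ) (u v : H) :
    (RCA.yL P u * rootSum B k 0 v - rootSum B k 0 v * RCA.yL P u) -
      (RCA.yL P v * rootSum B k 0 u - rootSum B k 0 u * RCA.yL P v) = 0 := by
  have h : ∀ u v, RCA.yL P u * rootSum B k 0 v - rootSum B k 0 v * RCA.yL P u =
      (1 / 2 : ℂ) • ∑ i, (P.root' i u * P.root' i v * k i 0) •
        (B.par i * (RCA.yL P (P.coroot i) * RCA.refl i)) := by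
    intro u v
    rw [rootSum, mul_smul_comm, smul_mul_assoc, ← smul_sub, Finset.mul_sum, Finset.sum_mul,
      ← Finset.sum_sub_distrib]
    congr 1
    refine Finset.sum_congr rfl fun i _ => ?_
    rw [mul_smul_comm, smul_mul_assoc, ← smul_sub, B.yL_mul_rootTerm_zero, smul_smul]
    congr 1
    ring
  rw [h, h, sub_eq_zero]
  simp only [mul_comm (P.root' _ u)]

theorem rootTerm_mul_rootTerm (j i : ι) (p q : ℕ) :
    B.rootTerm j p * B.rootTerm i q = B.par i * B.par j *
      ((B.xr j ^ p * B.xr (P.reflectionPerm j i) ^ q) * (RCA.refl j * RCA.refl i)) := by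
  rw [NormalizedForm.rootTerm, NormalizedForm.rootTerm, ← mul_assoc, ← (B.commute_par i _).eq,
    mul_assoc (B.par i), mul_assoc (B.par i), mul_assoc (B.par j)]
  congr 2
  rw [mul_assoc, ← mul_assoc (RCA.refl j), B.refl_mul_xr_pow]
  simp only [mul_assoc]

/-- `∑_{p + q = n} π(α^∨)^p π(s_β α^∨)^q s_β s_α`, multiplied by the parameters. -/
noncomputable def crossTerm (n : ℕ) (i j : ι) : RCA P := B.par i * B.par j *
  ((∑ p ∈ antidiagonal n, B.xr i ^ p.1 * B.xr (P.reflectionPerm j i) ^ p.2) *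
    (RCA.refl j * RCA.refl i))

/-- All contributions proportional to α(u) are collected in Q: they come from [u, s_α] and from the
ħ part of [u, π(α^∨)]. Only the rest, where a reflection s_β is inserted among the factors π(α^∨),
survives antisymmetrisation. -/
theorem exists_yL_mul_rootTerm [P.IsReduced] (b : P.Base) (i : ι) (n : ℕ) : ∃ Q : RCA P, ∀ u,
    RCA.yL P u * B.rootTerm i (n + 1) - B.rootTerm i (n + 1) * RCA.yL P u =
      P.root' i u • Q - (1 / 2 : ℂ) • ∑ j, (P.root' j u * P.pairing j i) • crossTerm B n i j := by
  refine ⟨B.par i * (B.xr i ^ (n + 1) * (RCA.yL P (P.coroot i) * RCA.refl i)) +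
    B.par i * ((∑ k ∈ Finset.range (n + 1), B.xr i ^ k * (B.len i • RCA.of P .hbar) *
      B.xr i ^ (n - k)) * RCA.refl i), fun u => ?_⟩
  have h1 : RCA.yL P u * B.rootTerm i (n + 1) - B.rootTerm i (n + 1) * RCA.yL P u =
      B.par i * ((RCA.yL P u * B.xr i ^ (n + 1) - B.xr i ^ (n + 1) * RCA.yL P u) * RCA.refl i) +
      B.par i * (B.xr i ^ (n + 1) * (RCA.yL P u * RCA.refl i - RCA.refl i * RCA.yL P u)) := by
    rw [NormalizedForm.rootTerm, ← mul_assoc, ← (B.commute_par i _).eq]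
    noncomm_ring
  have h2 : RCA.yL P u * RCA.refl i - RCA.refl i * RCA.yL P u =
      P.root' i u • (RCA.yL P (P.coroot i) * RCA.refl i) := by
    rw [RCA.refl_mul_yL, map_sub, map_smul, sub_mul, sub_sub_cancel, smul_mul_assoc]
  have h3 : ∀ j, ∑ k ∈ Finset.range (n + 1), B.par i * (B.xr i ^ k * B.rootTerm j 0 *
      B.xr i ^ (n - k) * RCA.refl i) = crossTerm B n i j := by
    intro j
    rw [crossTerm, Finset.Nat.sum_antidiagonal_eq_sum_range_succ_mk, Finset.sum_mul, Finset.mul_sum]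
    refine Finset.sum_congr rfl fun k _ => ?_
    rw [NormalizedForm.rootTerm, pow_zero, one_mul, mul_assoc (B.par i), ← mul_assoc (B.xr i ^ k),
      ← (B.commute_par j _).eq]
    congr 1
    simp only [mul_assoc]
    congr 2
    rw [← mul_assoc, B.refl_mul_xr_pow, mul_assoc]
  rw [h1, h2, yL_mul_xr_pow_sub B b, Nat.add_sub_cancel, smul_add, mul_smul_comm, mul_smul_comm,
    add_comm, add_sub_assoc]
  congr 1
  simp only [mul_sub, sub_mul, Finset.sum_sub_distrib]
  congr 1
  · rw [← mul_smul_comm, ← smul_mul_assoc, Finset.smul_sum]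
    congr 2
    refine Finset.sum_congr rfl fun k _ => ?_
    rw [← smul_mul_assoc, ← mul_smul_comm, smul_smul, mul_comm (B.len i)]
  · simp only [← h3, Finset.smul_sum, Finset.mul_sum, Finset.sum_mul, mul_smul_comm, smul_mul_assoc]
    rw [Finset.sum_comm]

/-- The terms with Q carry α(u)α(v) and cancel. The coefficient α(v)β(u) antisymmetrises, with its
sign, to α ∧ β. -/
theorem yL_mul_rootSum_succ [P.IsReduced] (b : P.Base) (k : ι → ℕ → ℂ) (n : ℕ) (u v : H) :
    (RCA.yL P u * rootSum B k (n + 1) v - rootSum B k (n + 1) v * RCA.yL P u) -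
      (RCA.yL P v * rootSum B k (n + 1) u - rootSum B k (n + 1) u * RCA.yL P v) =
    (1 / 4 : ℂ) • ∑ x : ι × ι, wedge P u v x •
      ((k x.1 (n + 1) * P.pairing x.2 x.1) • crossTerm B n x.1 x.2) := by
  choose Q hQ using fun i => exists_yL_mul_rootTerm B b i n
  have h : ∀ u v, RCA.yL P u * rootSum B k (n + 1) v - rootSum B k (n + 1) v * RCA.yL P u =
      (1 / 2 : ℂ) • ∑ i, (P.root' i u * P.root' i v * k i (n + 1)) • Q i -
        (1 / 4 : ℂ) • ∑ x : ι × ι, (P.root' x.1 v * P.root' x.2 u) •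
          ((k x.1 (n + 1) * P.pairing x.2 x.1) • crossTerm B n x.1 x.2) := by
    intro u v
    rw [rootSum, mul_smul_comm, smul_mul_assoc, ← smul_sub, Finset.mul_sum, Finset.sum_mul,
      ← Finset.sum_sub_distrib, Fintype.sum_prod_type, show (1 / 4 : ℂ) = 1 / 2 * (1 / 2) by norm_num,
      ← smul_smul, ← smul_sub]
    congr 1
    rw [Finset.smul_sum, ← Finset.sum_sub_distrib]
    refine Finset.sum_congr rfl fun i _ => ?_
    rw [mul_smul_comm, smul_mul_assoc, ← smul_sub, hQ, smul_sub, smul_smul, smul_comm _ (1 / 2 : ℂ),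
      Finset.smul_sum]
    congr 1
    · congr 1
      ring
    · congr 1
      refine Finset.sum_congr rfl fun j _ => ?_
      rw [smul_smul, smul_smul]
      congr 1
      ring
  rw [h, h]
  simp only [mul_comm (P.root' _ v) (P.root' _ u)]
  rw [sub_sub_sub_cancel_left, ← smul_sub, ← Finset.sum_sub_distrib]
  congr 1
  refine Finset.sum_congr rfl fun x _ => ?_
  rw [← sub_smul, wedge]
  congr 1
  ring

/-- The left factor is labelled β and the right one α, so that the group element is s_β s_α as in
`crossTerm`. This labelling produces the minus sign in front of α ∧ β. -/
theorem sum_antidiagonal_rootSum (k : ι → ℕ → ℂ) (n : ℕ) (u v : H) :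
    ∑ p ∈ antidiagonal n, (rootSum B k p.1 u * rootSum B k p.2 v -
      rootSum B k p.1 v * rootSum B k p.2 u) =
    -((1 / 4 : ℂ) • ∑ x : ι × ι, wedge P u v x • (B.par x.1 * B.par x.2 *
      ((∑ p ∈ antidiagonal n, (k x.2 p.1 * k x.1 p.2) •
        (B.xr x.2 ^ p.1 * B.xr (P.reflectionPerm x.2 x.1) ^ p.2)) *
          (RCA.refl x.2 * RCA.refl x.1)))) := by
  have h : ∀ u v, ∀ p q, rootSum B k p u * rootSum B k q v =
      (1 / 4 : ℂ) • ∑ x : ι × ι, (P.root' x.2 u * P.root' x.1 v) • (B.par x.1 * B.par x.2 *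
        (((k x.2 p * k x.1 q) • (B.xr x.2 ^ p * B.xr (P.reflectionPerm x.2 x.1) ^ q)) *
          (RCA.refl x.2 * RCA.refl x.1))) := by
    intro u v p q
    rw [rootSum, rootSum, smul_mul_smul_comm, Finset.sum_mul_sum, Fintype.sum_prod_type,
      Finset.sum_comm, show (1 / 2 : ℂ) * (1 / 2) = 1 / 4 by norm_num]
    congr 1
    refine Finset.sum_congr rfl fun i _ => Finset.sum_congr rfl fun j _ => ?_
    rw [smul_mul_smul_comm, rootTerm_mul_rootTerm, smul_mul_assoc, mul_smul_comm, smul_smul]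
    congr 1
    ring
  simp only [h, ← smul_sub, ← Finset.sum_sub_distrib, ← sub_smul]
  rw [← Finset.smul_sum, Finset.sum_comm, ← smul_neg, ← Finset.sum_neg_distrib]
  congr 1
  refine Finset.sum_congr rfl fun x _ => ?_
  rw [← Finset.smul_sum, Finset.sum_mul, Finset.mul_sum, ← neg_smul, wedge]
  congr 1
  ring

/-- Parameters and s_β s_α are constant along the orbits of `pairPerm`, so `sum_pairTerm_of_commute`
kills each orbit sum. Summing these over all starting pairs counts every pair `chainPeriod P` times,
a nonzero number. -/
theorem sum_wedge_smul_pairTerm [P.IsCrystallographic] [P.IsReduced] {τ : ℍ} {z : H}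
    (hz : z ∈ regular P τ) (n : ℕ) (u v : H) :
    ∑ x : ι × ι, wedge P u v x • (B.par x.1 * B.par x.2 *
      (pairTerm (P := P) τ z B.xr n x * (RCA.refl x.2 * RCA.refl x.1))) = 0 := by
  set T : ι × ι → RCA P := fun x => wedge P u v x • (B.par x.1 * B.par x.2 *
      (pairTerm (P := P) τ z B.xr n x * (RCA.refl x.2 * RCA.refl x.1))) with hT
  have hpar : ∀ k x, B.par ((pairPerm P ^ k) x).1 * B.par ((pairPerm P ^ k) x).2 =
      B.par x.1 * B.par x.2 := by
    intro k x
    induction k with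
    | zero => rfl
    | succ k ih =>
      rw [pow_succ', Equiv.Perm.mul_apply, ← ih]
      change B.par ((pairPerm P ^ k) x).2 * B.par (P.reflectionPerm _ ((pairPerm P ^ k) x).1) = _
      rw [B.par_reflectionPerm, (B.commute_par _ _).eq]
  have hrefl : ∀ k x, (RCA.refl ((pairPerm P ^ k) x).2 * RCA.refl ((pairPerm P ^ k) x).1 : RCA P) =
      RCA.refl x.2 * RCA.refl x.1 := by
    intro k x
    induction k with
    | zero => rfl
    | succ k ih =>
      rw [pow_succ', Equiv.Perm.mul_apply, ← ih]
      exact (RCA.refl_mul_refl _ _).symm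
  have h1 : ∀ x, ∑ k ∈ Finset.range (chainPeriod P), T ((pairPerm P ^ k) x) = 0 := by
    intro x
    have h := sum_pairTerm_of_commute hz (fun i j => (B.commute_xr i j).eq) B.xr_reflectionPerm
      n u v x
    have h2 := congrArg (fun a => B.par x.1 * B.par x.2 * (a * (RCA.refl x.2 * RCA.refl x.1))) h
    simp only [Finset.sum_mul, Finset.mul_sum, zero_mul, mul_zero, smul_mul_assoc,
      mul_smul_comm] at h2
    rw [← h2]
    refine Finset.sum_congr rfl fun k _ => ?_
    rw [hT]
    dsimp only
    rw [hpar, hrefl]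
  have h2 : ∑ x, ∑ k ∈ Finset.range (chainPeriod P), T ((pairPerm P ^ k) x) =
      (chainPeriod P : ℂ) • ∑ x, T x := by
    rw [Finset.sum_comm, Finset.sum_congr rfl fun k _ => Equiv.sum_comp (pairPerm P ^ k) T,
      Finset.sum_const, Finset.card_range, Nat.cast_smul_eq_nsmul]
  rw [Finset.sum_congr rfl fun x _ => h1 x, Finset.sum_const_zero] at h2
  exact (smul_eq_zero.1 h2.symm).resolve_left (Nat.cast_ne_zero.2 (chainPeriod_pos P).ne')

theorem curvature_rootSum [P.IsCrystallographic] [P.IsReduced] (b : P.Base) {τ : ℍ} {z : H}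
    (hz : z ∈ regular P τ) (n : ℕ) (u v : H) :
    let k : ι → ℕ → ℂ := fun i => kCoeff τ (P.root' i z)
    (RCA.yL P u * rootSum B k (n + 1) v - rootSum B k (n + 1) v * RCA.yL P u) -
      (RCA.yL P v * rootSum B k (n + 1) u - rootSum B k (n + 1) u * RCA.yL P v) +
    ∑ p ∈ antidiagonal n, (rootSum B k p.1 u * rootSum B k p.2 v -
      rootSum B k p.1 v * rootSum B k p.2 u) = 0 := by
  intro k
  rw [yL_mul_rootSum_succ B b, sum_antidiagonal_rootSum, ← sub_eq_add_neg, ← smul_sub,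
    ← Finset.sum_sub_distrib]
  have h := sum_wedge_smul_pairTerm B hz n u v
  rw [← smul_zero (1 / 4 : ℂ), ← h]
  congr 1
  refine Finset.sum_congr rfl fun x _ => ?_
  rw [← smul_sub, crossTerm, ← mul_smul_comm, ← smul_mul_assoc, ← mul_sub, ← sub_mul]
  rfl

theorem isFlatOn_rcaForm [P.IsCrystallographic] [P.IsReduced] (τ : ℍ) :
    IsFlatOn (regular P τ) (rcaForm b B e τ) := by
  classical
  intro z hz u v
  refine ⟨derivForm b B τ z u v, derivForm b B τ z v u, hasDirDeriv_rcaForm b B e hz u v,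
    hasDirDeriv_rcaForm b B e hz v u, ?_⟩
  rw [derivForm_comm, sub_self, zero_add]
  set k : ι → ℕ → ℂ := fun i => kCoeff τ (P.root' i z) with hk
  set W : H → ℕ → RCA P := fun u n => component n (rcaForm b B e τ z u) with hW
  have hW0 : ∀ u, W u 0 = 0 := fun u => component_rcaForm_of_lt b B e τ z u Nat.two_pos
  have hW1 : ∀ u, W u 1 = RCA.yL P u := fun u => component_rcaForm_of_lt b B e τ z u Nat.one_lt_two
  have hW2 : ∀ n, ∃ r : H → ℂ, ∀ u, W u (n + 2) = rootSum B k n u - r u • RCA.of P .hbar := by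
    intro n
    refine ⟨fun u => if n = 0 then (1 / (dualCoxeter b θ : ℂ) *
          ((1 / 2 : ℂ) • ∑ i, P.root' i u * kCoeff τ (P.root' i z) 0)) else 0, fun u => ?_⟩
    rw [hW]
    dsimp only
    rw [component_rcaForm_add_two b B e hz, ite_smul, zero_smul, rootSum]
  choose r hr using hW2
  -- ħ is central, so its terms are carried along explicitly and disappear when the products are
  -- antisymmetrised.
  have hh : ∀ (a c : RCA P) (r s : ℂ), (a - r • RCA.of P .hbar) * (c - s • RCA.of P .hbar) =
      a * c - s • (a * RCA.of P .hbar) - r • (c * RCA.of P .hbar) +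
        (r * s) • (RCA.of P .hbar * RCA.of P .hbar) := by
    intro a c r s
    rw [sub_mul, mul_sub, mul_sub, mul_smul_comm, smul_mul_assoc, smul_mul_smul_comm,
      (RCA.commute_hbar c).eq]
    abel
  have hsymm : ∀ f : ℕ × ℕ → RCA P, ∀ n, ∑ p ∈ antidiagonal n, f p.swap =
      ∑ p ∈ antidiagonal n, f p := fun f n => Finset.Nat.sum_antidiagonal_swap
  refine component_ext fun N => ?_
  rw [← componentL_apply, map_sub, componentL_apply, componentL_apply, component_mul, component_mul,
    ← Finset.sum_sub_distrib]
  change ∑ p ∈ antidiagonal N, (W u p.1 * W v p.2 - W v p.1 * W u p.2) = 0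
  have hy : ∀ n, W u 1 * W v (n + 2) - W v 1 * W u (n + 2) +
      (W u (n + 2) * W v 1 - W v (n + 2) * W u 1) =
      (RCA.yL P u * rootSum B k n v - rootSum B k n v * RCA.yL P u) -
      (RCA.yL P v * rootSum B k n u - rootSum B k n u * RCA.yL P v) := by
    intro n
    rw [hW1, hW1, hr, hr, mul_sub, mul_sub, sub_mul, sub_mul, smul_mul_assoc, smul_mul_assoc,
      (RCA.commute_hbar _).eq, (RCA.commute_hbar _).eq, mul_smul_comm, mul_smul_comm]
    abel
  -- Degree 2 is [u, v] = 0, degree 3 is the symmetric case `yL_mul_rootSum_zero`, and from degree 4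
  -- on the brackets with y meet the products of two root sums in `curvature_rootSum`.
  match N with
  | 0 => simp [hW0]
  | 1 => simp [Finset.Nat.sum_antidiagonal_succ, hW0]
  | 2 => simp [Finset.Nat.sum_antidiagonal_succ, hW0, hW1, (RCA.commute_yL u v).eq]
  | 3 =>
    have h := hy 0
    rw [yL_mul_rootSum_zero] at h
    simp only [Finset.Nat.sum_antidiagonal_succ, hW0, zero_mul, mul_zero, sub_zero, zero_add,
      add_zero, Finset.Nat.antidiagonal_zero, Finset.sum_singleton]
    simpa only [zero_add] using h
  | n + 4 =>
    have h := hy (n + 1)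
    rw [Finset.Nat.sum_antidiagonal_succ, Finset.Nat.sum_antidiagonal_succ,
      Finset.Nat.sum_antidiagonal_succ', Finset.Nat.sum_antidiagonal_succ']
    simp only [hW0, zero_mul, mul_zero, sub_zero, zero_add]
    have hA : ∑ p ∈ antidiagonal n, (W u (p.1 + 1 + 1) * W v (p.2 + 1 + 1) -
        W v (p.1 + 1 + 1) * W u (p.2 + 1 + 1)) =
        ∑ p ∈ antidiagonal n, (rootSum B k p.1 u * rootSum B k p.2 v -
          rootSum B k p.1 v * rootSum B k p.2 u) := by
      have h1 : ∀ u v, ∑ p ∈ antidiagonal n, W u (p.1 + 1 + 1) * W v (p.2 + 1 + 1) =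
          ∑ p ∈ antidiagonal n, rootSum B k p.1 u * rootSum B k p.2 v -
          ∑ p ∈ antidiagonal n, r p.2 v • (rootSum B k p.1 u * RCA.of P .hbar) -
          ∑ p ∈ antidiagonal n, r p.2 u • (rootSum B k p.1 v * RCA.of P .hbar) +
          ∑ p ∈ antidiagonal n, (r p.1 u * r p.2 v) • (RCA.of P .hbar * RCA.of P .hbar) := by
        intro u v
        rw [← hsymm fun p => r p.2 u • (rootSum B k p.1 v * RCA.of P .hbar),
          ← Finset.sum_sub_distrib, ← Finset.sum_sub_distrib, ← Finset.sum_add_distrib]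
        refine Finset.sum_congr rfl fun p _ => ?_
        rw [hr, hr, hh]
        rfl
      have h2 := hsymm (fun p => (r p.1 u * r p.2 v) • (RCA.of P .hbar * RCA.of P .hbar)) n
      simp only [Prod.fst_swap, Prod.snd_swap] at h2
      rw [Finset.sum_sub_distrib, Finset.sum_sub_distrib, h1, h1, ← h2]
      simp only [mul_comm (r _ v)]
      abel
    rw [hA, ← curvature_rootSum B b hz n u v, ← h]
    abel

end Curvature

end KZB

namespace KZB

variable {ι V H : Type*} [AddCommGroup V] [Module ℂ V] [AddCommGroup H] [Module ℂ H]

/-! ### The universal property of `A_ell` -/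

section Lift

variable [Fintype ι] {P : RootPairing ι ℂ V H} {b : P.Base} {L : Type*} [LieRing L] [LieAlgebra ℂ L]

/-- A homomorphism from the free Lie algebra that kills the relators factors through `A_ell`. -/
noncomputable def Aell.lift (f : AellFree ι H →ₗ⁅ℂ⁆ L) (hf : ∀ a, AellRelator P b a → f a = 0) :
    Aell P b →ₗ⁅ℂ⁆ L :=
  have h : aellIdeal P b ≤ f.ker := LieSubmodule.lieSpan_le.2 fun a ha => f.mem_ker.2 (hf a ha)
  { (aellIdeal P b).toSubmodule.liftQ (f : AellFree ι H →ₗ[ℂ] L) fun a ha => f.mem_ker.1 (h ha) with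
    map_lie' := by
      intro x y
      obtain ⟨x, rfl⟩ := LieSubmodule.Quotient.surjective_mk' (aellIdeal P b) x
      obtain ⟨y, rfl⟩ := LieSubmodule.Quotient.surjective_mk' (aellIdeal P b) y
      exact f.map_lie x y }

end Lift

/-! ### The homomorphism to the rational Cherednik algebra -/

section Xi

theorem IsRootSubsystem.reflectionPerm_mem_iff {P : RootPairing ι ℂ V H}
    [P.IsCrystallographic] {Ψ : Set ι}
    (hΨ : IsRootSubsystem P Ψ) {i : ι} (hi : i ∈ Ψ) (j : ι) : P.reflectionPerm i j ∈ Ψ ↔ j ∈ Ψ := by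
  have h : ∀ j ∈ Ψ, P.reflectionPerm i j ∈ Ψ := by
    intro j hj
    rw [← hΨ]
    have : P.root (P.reflectionPerm i j) = P.root j - P.pairingIn ℤ j i • P.root i := by
      rw [RootPairing.root_reflectionPerm, RootPairing.reflection_apply_root,
        ← P.algebraMap_pairingIn ℤ]
      simp [Int.cast_smul_eq_zsmul]
    rw [this]
    exact sub_mem (AddSubgroup.subset_closure (Set.mem_image_of_mem _ hj))
      (zsmul_mem (AddSubgroup.subset_closure (Set.mem_image_of_mem _ hi)) _)
  refine ⟨fun hj => ?_, h j⟩
  have := h _ hj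
  rwa [RootPairing.reflectionPerm_self] at this

theorem IsRootSubsystem.neg_mem_iff {P : RootPairing ι ℂ V H} {Ψ : Set ι} (hΨ : IsRootSubsystem P Ψ) (j : ι) :
    P.reflectionPerm j j ∈ Ψ ↔ j ∈ Ψ := by
  rw [← hΨ, ← hΨ j, root_neg, _root_.neg_mem_iff]

theorem of_mem_rcaDeg {P : RootPairing ι ℂ V H} (a : RCAGen P) : RCA.of P a ∈ rcaDeg P a.deg :=
  Submodule.subset_span ⟨[a], by simp, by simp⟩

variable [Fintype ι] {P : RootPairing ι ℂ V H} [P.IsRootSystem] {θ : ι} (b : P.Base)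
  (B : NormalizedForm P θ)

/-- The image of `t_α`. -/
noncomputable def tImage (i : ι) : RCA P :=
  (1 / (dualCoxeter b θ : ℂ)) • RCA.of P .hbar - B.rootTerm i 0

/-- The images of the generators of `A_ell`. -/
noncomputable def genImage : AellGen ι H → RCA P
  | .t i => tImage b B i
  | .x u => RCA.xL P (B.iso u)
  | .y u => RCA.yL P u

theorem tImage_neg (i : ι) : tImage b B (P.reflectionPerm i i) = tImage b B i := by
  rw [tImage, B.rootTerm_neg, pow_zero, one_smul, tImage]

theorem commute_tImage {i : ι} {a : RCA P} (h : Commute (RCA.refl i) a) :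
    Commute (tImage b B i) a := by
  refine ((RCA.commute_hbar a).smul_left _).sub_left ?_
  rw [NormalizedForm.rootTerm, pow_zero, one_mul]
  exact (B.commute_par i a).mul_left h

theorem refl_mul_tImage (i j : ι) :
    RCA.refl i * tImage b B j = tImage b B (P.reflectionPerm i j) * RCA.refl i := by
  have h := B.wM_mul_rootTerm (RootPairing.weylGroup.ofIdx P i) j 0
  rw [tImage, tImage, mul_sub, sub_mul, smul_mul_assoc, mul_smul_comm, (RCA.commute_hbar _).eq]
  exact congrArg _ h

-- The sum is half the sum over all of Ψ, and conjugation by s_α with α ∈ Ψ permutes Ψ. The ħ part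
-- of t_α is central.
open Classical in
theorem commute_tImage_sum [P.IsCrystallographic] {Ψ : Set ι} (hΨ : IsRootSubsystem P Ψ) {i : ι}
    (hi : i ∈ Ψ) : Commute (tImage b B i) (∑ j with j ∈ Ψ ∧ b.IsPos j, tImage b B j) := by
  have h : ∑ j with j ∈ Ψ ∧ b.IsPos j, tImage b B j =
      (1 / 2 : ℂ) • ∑ j, if j ∈ Ψ then tImage b B j else 0 := by
    rw [← sum_isPos_eq b]
    · rw [← Finset.sum_filter, Finset.filter_filter]
      exact Finset.sum_congr (Finset.filter_congr fun _ _ => and_comm) fun _ _ => rfl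
    · intro j
      simp only [hΨ.neg_mem_iff, tImage_neg]
  rw [h]
  refine commute_tImage b B (Commute.smul_right ?_ _)
  rw [Commute, SemiconjBy, Finset.mul_sum, Finset.sum_mul, ← Equiv.sum_comp (P.reflectionPerm i)
    fun j => (if j ∈ Ψ then tImage b B j else 0) * RCA.refl i]
  refine Finset.sum_congr rfl fun j _ => ?_
  simp only [hΨ.reflectionPerm_mem_iff hi]
  split_ifs
  · exact refl_mul_tImage b B i j
  · rw [mul_zero, zero_mul]

theorem tImage_mem_rcaDeg (i : ι) : tImage b B i ∈ rcaDeg P 2 := by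
  have hbar : RCA.of P .hbar ∈ rcaDeg P 2 := of_mem_rcaDeg .hbar
  have hc : RCA.of P (.c (reflClass (reflOf P i))) ∈ rcaDeg P 2 := of_mem_rcaDeg (.c _)
  have hw : (RCA.refl i : RCA P) ∈ rcaDeg P 0 :=
    of_mem_rcaDeg (.w (RootPairing.weylGroup.ofIdx P i))
  have h := SetLike.mul_mem_graded hc hw
  rw [add_zero] at h
  refine Submodule.sub_mem _ (Submodule.smul_mem _ _ hbar) ?_
  rw [NormalizedForm.rootTerm, pow_zero, one_mul, NormalizedForm.par, smul_mul_assoc]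
  exact Submodule.smul_mem _ _ h

/-- The generators of the rational Cherednik algebra satisfy the relations of `A_ell`. -/
theorem lift_genImage_relator [P.IsCrystallographic] [P.IsReduced] [P.IsIrreducible]
    (hθ : IsHighestRoot b θ) (a : AellFree ι H) (ha : AellRelator P b a) :
    FreeLieAlgebra.lift ℂ (genImage b B) a = 0 := by
  classical
  have hof : ∀ g, FreeLieAlgebra.lift ℂ (genImage b B) (fr g) = genImage b B g := fun g =>
    FreeLieAlgebra.lift_of_apply (genImage b B) g
  have hcomm : ∀ {x y : RCA P}, Commute x y → ⁅x, y⁆ = 0 := fun h => sub_eq_zero.2 h.eq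
  cases ha with
  | t_neg i j h =>
    rw [map_sub, hof, hof, sub_eq_zero]
    have : j = P.reflectionPerm i i := P.root.injective (by rw [h, root_neg])
    rw [this]
    exact tImage_neg b B i
  | x_add u v => simp only [map_sub, map_add, hof, genImage, sub_self]
  | x_smul r u => simp only [map_sub, map_smul, hof, genImage, sub_self]
  | y_add u v => simp only [map_sub, map_add, hof, genImage, sub_self]
  | y_smul r u => simp only [map_sub, map_smul, hof, genImage, sub_self]
  | tt Ψ hΨ i hi =>
    rw [LieHom.map_lie, map_sum]
    simp only [hof, genImage]
    refine hcomm ?_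
    convert commute_tImage_sum b B hΨ hi
  | xx u v =>
    rw [LieHom.map_lie, hof, hof]
    exact hcomm (RCA.commute_xL _ _)
  | yy u v =>
    rw [LieHom.map_lie, hof, hof]
    exact hcomm (RCA.commute_yL _ _)
  | yx u v =>
    rw [map_sub, LieHom.map_lie, map_sum]
    simp only [map_smul, hof, genImage]
    -- The reflection parts agree term by term; the ħ parts agree because ∑_{γ>0} γ(u)γ(v)/h^∨ =
    -- (u|v).
    rw [LieRing.of_associative_ring_bracket, yL_mul_xL_iso_sub B b, sub_eq_zero]
    simp only [tImage, smul_sub, Finset.sum_sub_distrib, ← Finset.sum_smul, smul_smul,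
      ← Finset.sum_mul]
    congr 1
    · rw [sum_root'_mul_root' hθ B v u]
      congr 1
      have := hθ.dualCoxeter_ne_zero
      field_simp
    · refine Finset.sum_congr ?_ fun i _ => ?_
      · ext
        simp
      · rw [mul_comm]
  | tx i u h =>
    rw [LieHom.map_lie, hof, hof]
    refine hcomm (commute_tImage b B ?_)
    change RCA.refl i * RCA.xL P (B.iso u) = RCA.xL P (B.iso u) * RCA.refl i
    rw [RCA.refl_mul_xL, B.coroot'_iso, h, mul_zero, zero_smul, sub_zero]
  | ty i u h =>
    rw [LieHom.map_lie, hof, hof]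
    refine hcomm (commute_tImage b B ?_)
    change RCA.refl i * RCA.yL P u = RCA.yL P u * RCA.refl i
    rw [RCA.refl_mul_yL, h, zero_smul, sub_zero]

variable [P.IsCrystallographic] [P.IsReduced] [P.IsIrreducible] (hθ : IsHighestRoot b θ)

/-- The homomorphism from `A_ell` to the rational Cherednik algebra. -/
noncomputable def xi : Aell P b →ₗ⁅ℂ⁆ RCA P :=
  Aell.lift (FreeLieAlgebra.lift ℂ (genImage b B)) (lift_genImage_relator b B hθ)

theorem xi_t (i : ι) : xi b B hθ (Aell.t P b i) = tImage b B i :=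
  FreeLieAlgebra.lift_of_apply (genImage b B) (.t i)

theorem xi_x (u : H) : xi b B hθ (Aell.x P b u) = RCA.xL P (B.iso u) :=
  FreeLieAlgebra.lift_of_apply (genImage b B) (.x u)

theorem xi_y (u : H) : xi b B hθ (Aell.y P b u) = RCA.yL P u :=
  FreeLieAlgebra.lift_of_apply (genImage b B) (.y u)

theorem xi_mem_rcaDeg_of_monomial {n : ℕ} {a : Aell P b} (ha : AellMonomial P b n a) :
    xi b B hθ a ∈ rcaDeg P n := by
  induction ha with
  | t i =>
    rw [xi_t]
    exact tImage_mem_rcaDeg b B i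
  | x u =>
    rw [xi_x]
    exact of_mem_rcaDeg (.x (B.iso u))
  | y u =>
    rw [xi_y]
    exact of_mem_rcaDeg (.y u)
  | @bracket m n a a' _ _ ih ih' =>
    rw [LieHom.map_lie, LieRing.of_associative_ring_bracket]
    refine Submodule.sub_mem _ (SetLike.GradedMul.mul_mem ih ih') ?_
    rw [add_comm]
    exact SetLike.GradedMul.mul_mem ih' ih

theorem xi_mem_rcaDeg (n : ℕ) (a : Aell P b) (ha : a ∈ aellDeg P b n) :
    xi b B hθ a ∈ rcaDeg P n := by
  have h : aellDeg P b n ≤ (rcaDeg P n).comap (xi b B hθ : Aell P b →ₗ[ℂ] RCA P) :=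
    Submodule.span_le.2 fun a ha => xi_mem_rcaDeg_of_monomial b B hθ ha
  exact h ha

/-- The bracket acts on s_α as in the definition of the connection and kills the central ħ. Thus ħ
enters only with k_0, which is how θ'/θ appears in the image. -/
theorem xi_iterate_ad (i : ι) (n : ℕ) :
    xi b B hθ ((fun Y => ⁅Aell.x P b ((1 / 2 : ℂ) • P.coroot i), Y⁆)^[n] (Aell.t P b i)) =
      (if n = 0 then (1 / (dualCoxeter b θ : ℂ)) • RCA.of P .hbar else 0) - B.rootTerm i n := by
  have h : ∀ a, xi b B hθ ((fun Y => ⁅Aell.x P b ((1 / 2 : ℂ) • P.coroot i), Y⁆)^[n] a) =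
      (adL (RCA.xL P (B.iso ((1 / 2 : ℂ) • P.coroot i))))^[n] (xi b B hθ a) := by
    intro a
    induction n with
    | zero => rfl
    | succ n ih =>
      rw [Function.iterate_succ_apply', Function.iterate_succ_apply', LieHom.map_lie, ih, xi_x]
      rfl
  have h1 : P.root' i ((1 / 2 : ℂ) • P.coroot i) = 1 := by
    rw [map_smul, RootPairing.root'_coroot_eq_pairing, RootPairing.pairing_same, smul_eq_mul,
      one_div_mul_cancel two_ne_zero]
  rw [h, xi_t, tImage, iterate_map_sub, B.adL_iterate_rootTerm, h1, one_pow, one_smul, zero_add]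
  split_ifs with hn
  · rw [hn, Function.iterate_zero_apply]
  · rw [adL_iterate_hbar _ _ hn]

/-- The homomorphism carries the universal KZB connection to the connection with values in the
rational Cherednik algebra. -/
theorem completeMap_xi_kzbForm {κ : Type*} [Fintype κ] (e : Module.Basis κ ℂ H) {τ : ℍ} {z : H}
    (hz : z ∈ regular P τ) (u : H) :
    completeMap b (xi b B hθ) (xi_mem_rcaDeg b B hθ) (kzbForm P b e τ z u) =
      rcaForm b B e τ z u := by
  classical
  refine component_ext fun n => ?_
  have h : component n (completeMap b (xi b B hθ) (xi_mem_rcaDeg b B hθ) (kzbForm P b e τ z u)) =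
      xi b B hθ ((kzbForm P b e τ z u).1 n) := by
    simp only [component, completeMap, PowerSeries.coeff_mk]
  have h1 : (kzbForm P b e τ z u).1 n =
      -(∑ i with b.IsPos i, P.root' i u • (aellK P b τ i (P.root' i z)).1 n) +
        ∑ j, e.coord j u • (aellY P b (e j)).1 n := by
    rw [kzbForm]
    simp
  rw [h, h1, map_add, map_neg, map_sum, map_sum]
  simp only [map_smul]
  have hK : ∀ i, xi b B hθ ((aellK P b τ i (P.root' i z)).1 n) = if 2 ≤ n then
      kCoeff τ (P.root' i z) (n - 2) • ((if n - 2 = 0 then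
        (1 / (dualCoxeter b θ : ℂ)) • RCA.of P .hbar else 0) - B.rootTerm i (n - 2)) else 0 := by
    intro i
    simp only [aellK]
    split_ifs with hn h2
    · rw [map_smul, xi_iterate_ad, if_pos h2]
    · rw [map_smul, xi_iterate_ad, if_neg h2]
    · exact map_zero _
  have hY : ∀ j, xi b B hθ ((aellY P b (e j)).1 n) = if n = 1 then RCA.yL P (e j) else 0 := by
    intro j
    simp only [aellY]
    split_ifs
    · exact xi_y b B hθ _
    · exact map_zero _
  simp only [hK, hY]
  rcases lt_or_ge n 2 with hn | hn
  · rw [component_rcaForm_of_lt b B e _ _ _ hn]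
    simp only [if_neg (not_le.2 hn), smul_zero, Finset.sum_const_zero, neg_zero, zero_add]
    split_ifs
    · simp only [← map_smul, ← map_sum]
      exact congrArg _ (e.sum_repr u)
    · simp
  obtain ⟨n, rfl⟩ := Nat.exists_eq_add_of_le' hn
  have hy : component (n + 2) (RCAHat.of P (.y u)) = 0 := by
    rw [component_of, if_neg (by simp [RCAGen.deg])]
  rw [rcaForm_apply, ← componentL_apply, map_add, componentL_apply, componentL_apply, hy,
    add_zero, component_rootForm_add_two]
  simp only [← kCoeff_zero (regular_theta_ne_zero hz _), if_pos hn, Nat.add_sub_cancel,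
    if_neg (show ¬ n + 2 = 1 by omega), smul_zero, Finset.sum_const_zero, add_zero, smul_sub,
    Finset.sum_sub_distrib, neg_sub, smul_smul]
  congr 1
  split_ifs with h0
  · subst h0
    simp only [smul_smul, ← Finset.sum_smul, Finset.mul_sum]
    congr 1
    refine Finset.sum_congr rfl fun i _ => ?_
    ring
  · simp

end Xi

end KZB

/-! ### Assembly of the theorem -/

theorem mainTheorem7 {ι V H κ : Type*} [Fintype ι] [Fintype κ]
    [AddCommGroup V] [Module ℂ V] [AddCommGroup H] [Module ℂ H]
    (P : RootPairing ι ℂ V H) [P.IsRootSystem] [P.IsCrystallographic] [P.IsReduced]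
    [P.IsIrreducible] (b : P.Base) (θ : ι) (hθ : KZB.IsHighestRoot b θ)
    (B : KZB.NormalizedForm P θ) (e : Module.Basis κ ℂ H) (τ : UpperHalfPlane) :
    (∃ (ξ : KZB.Aell P b →ₗ⁅ℂ⁆ KZB.RCA P)
        (hξ : ∀ n, ∀ a ∈ KZB.aellDeg P b n, ξ a ∈ KZB.rcaDeg P n),
      (∀ v : H, ξ (KZB.Aell.x P b v) = KZB.RCA.of P (.x (B.iso v))) ∧
      (∀ u : H, ξ (KZB.Aell.y P b u) = KZB.RCA.of P (.y u)) ∧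
      (∀ i : ι, ξ (KZB.Aell.t P b i) =
        (1 / (KZB.dualCoxeter b θ : ℂ)) • KZB.RCA.of P .hbar -
          (2 / B.normSq (P.root i)) •
            (KZB.RCA.of P (.c (KZB.reflClass (KZB.reflOf P i))) *
              KZB.RCA.of P (.w (KZB.reflOf P i).1))) ∧
      ∀ z ∈ KZB.regular P τ, ∀ u : H,
        KZB.completeMap b ξ hξ (KZB.kzbForm P b e τ z u) = KZB.rcaForm b B e τ z u) ∧
    KZB.DescendsToTorus B τ (KZB.rcaForm b B e τ) ∧
    KZB.IsFlatOn (KZB.regular P τ) (KZB.rcaForm b B e τ) ∧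
    KZB.IsWEquivariantOn (KZB.regular P τ) (KZB.rcaForm b B e τ) := by
  refine ⟨⟨KZB.xi b B hθ, KZB.xi_mem_rcaDeg b B hθ, KZB.xi_x b B hθ, KZB.xi_y b B hθ,
    fun i => ?_, fun z hz u => KZB.completeMap_xi_kzbForm b B hθ e hz u⟩,
    KZB.descendsToTorus_rcaForm b B e hθ τ, KZB.isFlatOn_rcaForm b B e τ,
    KZB.isWEquivariantOn_rcaForm b B e τ⟩
  rw [KZB.xi_t, KZB.tImage, KZB.NormalizedForm.rootTerm, pow_zero, one_mul,
    KZB.NormalizedForm.par, smul_mul_assoc, B.two_div_normSq]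
  rfl
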